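/- Let $n\ge 2$ and let $T_1,\dots,T_{n^2-1}$ be traceless hermitian $n\times n$ matrices with $\mathrm{Tr}(T_iT_j)=\tfrac12\delta_{ij}$ (generators of $su(n)$ in the defining representation). Put $X_i=-\mathrm{i}\,T_i$ and define $f_{ijk}$, $d_{ijk}$ by $[T_i,T_j]=\mathrm{i}f_{ijk}T_k$ (so $[X_i,X_j]=f_{ijk}X_k$) and $\{T_i,T_j\}=\tfrac1n\delta_{ij}I+d_{ijk}T_k$. Repeated indices are summed; round (square) brackets denote unit-weight symmetrisation (antisymmetrisation). Let $d^{(4)}_{ijkl}=d_{ijx}d_{xkl}$, $d^{(5)}_{ijklm}=d_{ijx}d_{xky}d_{ylm}$ and $k_{i_1\dots i_m}=\mathrm{Tr}(X_{(i_1}\cdots X_{i_m)})$. For a symmetric invariant tensor $h$ of order $m\ge2$ let $$\Omega_{i_1\dots i_{2m-1}}=f_{[i_1i_2}{}^{l_1}\cdots f_{i_{2m-3}i_{2m-2}}{}^{l_{m-1}}h_{|l_1\dots l_{m-1}|\,i_{2m-1}]}$$ (antisymmetrised in $i_1,\dots,i_{2m-1}$), and $$t^{(m)}_{i_1\dots i_m}=\Omega_{j_1\dots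 j_{2m-2}i_m}f_{j_1j_2i_1}\cdots f_{j_{2m-3}j_{2m-2}i_{m-1}},\qquad K^{(m)}(n)=t^{(m)}_{i_1\dots i_m}t^{(m)}_{i_1\dots i_m},$$ where $h_{ij}=\delta_{ij}$ if $m=2$ and $h=k$ (order $m$) if $m\ge3$. Then there are nonzero complex constants $\lambda(n)$ ($n\ge2$), depending only on $n$, such that for every $n\ge 2$ and every choice of the $T_i$: 1. $t^{(4)}_{ijkl}=\frac1{120}\left[n(n^2+1)\,d^{(4)}_{(ijkl)}-2(n^2-4)\,\delta_{(ij}\delta_{kl)}\right]$. 2. $t^{(5)}_{ijklm}=\lambda(n)\left[n(n^2+5)\,d^{(5)}_{(ijklm)}-2(3n^2-20)\,d_{(ijk}\delta_{lm)}\right]$. 3. For $n=3$: $t^{(4)}_{ijkl}=\frac14\left[d^{(4)}_{(ijkl)}-\frac13\delta_{(ij}\delta_{kl)}\right]=0$ and $t^{(5)}_{ijklm}=42\lambda(3)\left[d^{(5)}_{(ijklm)}-\frac13d_{(ijk}\delta_{lm)}\right]=0$. 4. For $n=4$: $t^{(5)}_{ijklm}=84\lambda(4)\left[d^{(5)}_{(ijklm)}-\frac23d_{(ijk}\delta_{lm)}\right]=0$.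 5. $K^{(2)}(n)=n^2(n^2-1)$, $\;K^{(3)}(n)=-\frac1{144}n^3(n^2-1)(n^2-4)$, and $K^{(4)}(n)=\left(\frac1{120}\right)^2\frac23\,n^2(n^2+1)(n^2-1)(n^2-4)(n^2-9)$. -/

import Mathlib

open scoped BigOperators

namespace SuN

noncomputable section

/-- `T` is a family of hermitian generators of `su(n)` in the defining representation, normalised by
`Tr (T_i T_j) = δ_ij / 2`.  When the index type has `n ^ 2 - 1` elements, such a family is a basis of
the traceless hermitian `n × n` matrices (see `expand` below). -/
structure IsGenerators {n : ℕ} {ι : Type*} [DecidableEq ι]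
    (T : ι → Matrix (Fin n) (Fin n) ℂ) : Prop where
  isHermitian : ∀ i, (T i).IsHermitian
  trace_eq_zero : ∀ i, (T i).trace = 0
  trace_mul : ∀ i j, (T i * T j).trace = if i = j then 1 / 2 else 0

section Tensors

variable {n : ℕ} {ι : Type*} [Fintype ι] [DecidableEq ι]

/-- The antihermitian generators `X_i = -i T_i`. -/
def X (T : ι → Matrix (Fin n) (Fin n) ℂ) (i : ι) : Matrix (Fin n) (Fin n) ℂ :=
  (-Complex.I) • T i

/-- The structure constants: `[T_i, T_j] = i ∑_k f_ijk T_k`, equivalently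
`[X_i, X_j] = ∑_k f_ijk X_k` (see `commutator_eq` and `commutator_X_eq`). -/
def f (T : ι → Matrix (Fin n) (Fin n) ℂ) (i j k : ι) : ℂ :=
  (-2 * Complex.I) * ((T i * T j - T j * T i) * T k).trace

/-- The symmetric third order tensor: `{T_i, T_j} = (1 / n) δ_ij + ∑_k d_ijk T_k`
(see `anticommutator_eq`). -/
def d (T : ι → Matrix (Fin n) (Fin n) ℂ) (i j k : ι) : ℂ :=
  2 * ((T i * T j + T j * T i) * T k).trace

/-- The Kronecker symbol. -/
def delta (i j : ι) : ℂ := if i = j then 1 else 0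

/-- Symmetrisation with unit weight, `h_(i_1 … i_m)`. -/
def symmetrize {m : ℕ} (h : (Fin m → ι) → ℂ) (i : Fin m → ι) : ℂ :=
  (1 / (m.factorial : ℂ)) * ∑ σ : Equiv.Perm (Fin m), h (fun a => i (σ a))

/-- The (not yet symmetrised) tensors of the `d`-family; `dTensor T r` has order `r + 2`.
`d⁽²⁾ = δ`, and `d⁽ʳ⁺¹⁾_{i_1 … i_{r+1}} = ∑_j d⁽ʳ⁾_{i_1 … i_{r-1} j} d_{j i_r i_{r+1}}`;
in particular `d⁽³⁾ = d` (see `dTensor_one`). -/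
def dTensor (T : ι → Matrix (Fin n) (Fin n) ℂ) : (r : ℕ) → (Fin (r + 2) → ι) → ℂ
  | 0 => fun i => delta (i 0) (i 1)
  | r + 1 => fun i =>
      ∑ j : ι, dTensor T r (Fin.snoc (fun a : Fin (r + 1) => i a.castSucc.castSucc) j) *
        d T j (i (Fin.last (r + 1)).castSucc) (i (Fin.last (r + 2)))

/-- The symmetric trace tensors `k_{i_1 … i_m} = Tr (X_(i_1 ⋯ X_i_m))`. -/
def kTensor (T : ι → Matrix (Fin n) (Fin n) ℂ) (m : ℕ) : (Fin m → ι) → ℂ :=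
  symmetrize fun i => (List.ofFn fun a => X T (i a)).prod.trace

/-- The position of the first index of the `a`-th pair among `2 M` indices. -/
def fstIdx {M : ℕ} (a : Fin M) : Fin (2 * M) := ⟨2 * a, by omega⟩

/-- The position of the second index of the `a`-th pair among `2 M` indices. -/
def sndIdx {M : ℕ} (a : Fin M) : Fin (2 * M) := ⟨2 * a + 1, by omega⟩

/-- The coordinates of the `(2m-1)`-cocycle `Ω` built from a symmetric invariant tensor `h` of order
`m = M + 1`: the unit weight antisymmetrisation over all `2m - 1` indices of
`∑_l f_{i_1 i_2 l_1} ⋯ f_{i_{2m-3} i_{2m-2} l_{m-1}} h_{l_1 … l_{m-1} i_{2m-1}}`. -/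
def cocycle (T : ι → Matrix (Fin n) (Fin n) ℂ) {M : ℕ} (h : (Fin (M + 1) → ι) → ℂ)
    (i : Fin (2 * M + 1) → ι) : ℂ :=
  (1 / ((2 * M + 1).factorial : ℂ)) *
    ∑ σ : Equiv.Perm (Fin (2 * M + 1)), ((Equiv.Perm.sign σ : ℤ) : ℂ) *
      ∑ l : Fin M → ι,
        (∏ a : Fin M, f T (i (σ (fstIdx a).castSucc)) (i (σ (sndIdx a).castSucc)) (l a)) *
          h (Fin.snoc l (i (σ (Fin.last (2 * M)))))

/-- The `t`-tensor of order `m = M + 1` obtained from the cocycle of `h`: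
`t_{i_1 … i_m} = ∑_j Ω_{j_1 … j_{2m-2} i_m} f_{j_1 j_2 i_1} ⋯ f_{j_{2m-3} j_{2m-2} i_{m-1}}`. -/
def tOf (T : ι → Matrix (Fin n) (Fin n) ℂ) {M : ℕ} (h : (Fin (M + 1) → ι) → ℂ)
    (i : Fin (M + 1) → ι) : ℂ :=
  ∑ j : Fin (2 * M) → ι,
    cocycle T h (Fin.snoc j (i (Fin.last M))) *
      ∏ a : Fin M, f T (j (fstIdx a)) (j (sndIdx a)) (i a.castSucc)

/-- `t⁽²⁾`, from the three-cocycle of `δ`, that is, from the structure constants. -/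
def t2 (T : ι → Matrix (Fin n) (Fin n) ℂ) : (Fin 2 → ι) → ℂ :=
  tOf T (M := 1) fun i => delta (i 0) (i 1)

/-- `t⁽³⁾`, from the five-cocycle of `k⁽³⁾`. -/
def t3 (T : ι → Matrix (Fin n) (Fin n) ℂ) : (Fin 3 → ι) → ℂ := tOf T (M := 2) (kTensor T 3)

/-- `t⁽⁴⁾`, from the seven-cocycle of `k⁽⁴⁾`. -/
def t4 (T : ι → Matrix (Fin n) (Fin n) ℂ) : (Fin 4 → ι) → ℂ := tOf T (M := 3) (kTensor T 4)

/-- `t⁽⁵⁾`, from the nine-cocycle of `k⁽⁵⁾`. -/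
def t5 (T : ι → Matrix (Fin n) (Fin n) ℂ) : (Fin 5 → ι) → ℂ := tOf T (M := 4) (kTensor T 5)

/-- `d⁽⁴⁾_(ijkl)`. -/
def d4 (T : ι → Matrix (Fin n) (Fin n) ℂ) : (Fin 4 → ι) → ℂ := symmetrize (dTensor T 2)

/-- `d⁽⁵⁾_(ijklm)`. -/
def d5 (T : ι → Matrix (Fin n) (Fin n) ℂ) : (Fin 5 → ι) → ℂ := symmetrize (dTensor T 3)

/-- `δ_(ij δ_kl)`. -/
def deltaDelta : (Fin 4 → ι) → ℂ :=
  symmetrize fun i => delta (i 0) (i 1) * delta (i 2) (i 3)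

/-- `d_(ijk δ_lm)`. -/
def dDelta (T : ι → Matrix (Fin n) (Fin n) ℂ) : (Fin 5 → ι) → ℂ :=
  symmetrize fun i => d T (i 0) (i 1) (i 2) * delta (i 3) (i 4)

/-- The full contraction `∑_i t_{i_1 … i_m} t_{i_1 … i_m}` (no complex conjugation). -/
def contraction {m : ℕ} (t : (Fin m → ι) → ℂ) : ℂ := ∑ i : Fin m → ι, t i * t i

theorem dTensor_one (T : ι → Matrix (Fin n) (Fin n) ℂ) (i : Fin 3 → ι) :
    dTensor T 1 i = d T (i 0) (i 1) (i 2) := by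
  have h (j : ι) : dTensor T 0 (Fin.snoc (fun a : Fin 1 => i a.castSucc.castSucc) j)
      = delta (i 0) j := rfl
  have h2 : Fin.last 2 = (2 : Fin 3) := rfl
  simp only [dTensor]
  simp only [dTensor] at h
  simp only [h]
  simp [delta, h2]

end Tensors

section Expansion

variable {n : ℕ} {T : Fin (n ^ 2 - 1) → Matrix (Fin n) (Fin n) ℂ}

/-- The generators together with the unit matrix span all matrices. -/
theorem expand (hn : 0 < n) (hT : IsGenerators T) (A : Matrix (Fin n) (Fin n) ℂ) :
    A = (A.trace / n) • (1 : Matrix (Fin n) (Fin n) ℂ) + ∑ k, (2 * (A * T k).trace) • T k := by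
  have hn0 : (n : ℂ) ≠ 0 := by exact_mod_cast hn.ne'
  let v : Option (Fin (n ^ 2 - 1)) → Matrix (Fin n) (Fin n) ℂ := fun o => o.elim 1 T
  have key (g : Option (Fin (n ^ 2 - 1)) → ℂ) (B : Matrix (Fin n) (Fin n) ℂ)
      (hB : ∑ o, g o • v o = B) :
      B.trace = g none * n ∧ ∀ k, (B * T k).trace = g (some k) / 2 := by
    subst hB
    constructor
    · simp [Fintype.sum_option, v, Matrix.trace_add, Matrix.trace_sum, hT.trace_eq_zero]
    · intro k
      simp [Fintype.sum_option, v, Matrix.trace_add, Matrix.trace_sum, hT.trace_eq_zero,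
        Matrix.add_mul, Finset.sum_mul, hT.trace_mul, div_eq_mul_inv]
  have hli : LinearIndependent ℂ v := by
    rw [Fintype.linearIndependent_iff]
    intro g hg o
    obtain ⟨h1, h2⟩ := key g 0 hg
    cases o with
    | none => simpa [hn0] using h1.symm
    | some k => simpa using (h2 k).symm
  have hcard : Fintype.card (Option (Fin (n ^ 2 - 1))) =
      Module.finrank ℂ (Matrix (Fin n) (Fin n) ℂ) := by
    have : 1 ≤ n ^ 2 := Nat.one_le_pow _ _ hn
    simp [Module.finrank_matrix]
    rw [Nat.sub_add_cancel this, sq]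
  have hspan := hli.span_eq_top_of_card_eq_finrank' hcard
  have hA : A ∈ Submodule.span ℂ (Set.range v) := hspan ▸ Submodule.mem_top
  obtain ⟨g, hg⟩ := (Submodule.mem_span_range_iff_exists_fun ℂ).1 hA
  obtain ⟨h1, h2⟩ := key g A hg
  conv_lhs => rw [← hg]
  rw [Fintype.sum_option, h1]
  congr 1
  · simp [v, hn0]
  · refine Finset.sum_congr rfl fun k _ => ?_
    rw [h2 k]
    simp [v, mul_div_cancel₀]

theorem commutator_eq (hn : 0 < n) (hT : IsGenerators T) (i j : Fin (n ^ 2 - 1)) :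
    T i * T j - T j * T i = Complex.I • ∑ k, f T i j k • T k := by
  conv_lhs => rw [expand hn hT (T i * T j - T j * T i)]
  rw [Matrix.trace_sub, Matrix.trace_mul_comm (T i) (T j), sub_self, zero_div, zero_smul, zero_add,
    Finset.smul_sum]
  refine Finset.sum_congr rfl fun k _ => ?_
  rw [smul_smul, f]
  congr 1
  linear_combination (2 * ((T i * T j - T j * T i) * T k).trace) * Complex.I_mul_I

theorem commutator_X_eq (hn : 0 < n) (hT : IsGenerators T) (i j : Fin (n ^ 2 - 1)) :
    X T i * X T j - X T j * X T i = ∑ k, f T i j k • X T k := by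
  have h := commutator_eq hn hT i j
  simp only [X, smul_mul_smul_comm, ← smul_sub, h, Finset.smul_sum, smul_smul]
  refine Finset.sum_congr rfl fun k _ => ?_
  congr 1
  linear_combination (Complex.I * f T i j k) * Complex.I_mul_I

theorem anticommutator_eq (hn : 0 < n) (hT : IsGenerators T) (i j : Fin (n ^ 2 - 1)) :
    T i * T j + T j * T i =
      ((1 / n : ℂ) * delta i j) • (1 : Matrix (Fin n) (Fin n) ℂ) + ∑ k, d T i j k • T k := by
  conv_lhs => rw [expand hn hT (T i * T j + T j * T i)]
  rw [Matrix.trace_add, Matrix.trace_mul_comm (T j) (T i), hT.trace_mul]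
  congr 2
  by_cases h : i = j <;> simp [h, delta]
  norm_num

end Expansion

end

end SuN

/-! The tensor `t` of order M + 1 is visibly symmetric in its first M indices. It is therefore
determined by the numbers obtained by contracting those indices with one vector c and fixing the
last index z. Put x = ∑ c_i X_i and y = X_z. When the structure constants inside the trace tensor k
are written as commutators, antisymmetrisation turns Ω into 2^M / (2M)! times the alternating sum of
Tr(X_z X_{j_1} ⋯ X_{j_2M}) (`cocycle_kTensor_snoc`). Each remaining structure constant contracted
with c becomes the skew form β(a, b) = -2 Tr([X_a, X_b] x). Everything thus reduces to contracting
Tr(y X_{k_1} ⋯ X_{k_2M}) with the antisymmetrised product of M copies of β (`sum_tOf_kTensor`,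
`pairSum`).

This antisymmetrised product is a Pfaffian, a signed sum over perfect matchings (`sum_perm_pairs`).
By completeness of the generators, contracting two letters with β splits one trace into two or
merges two traces into one, inserting an x, and all 1/n corrections cancel
(`IsComplete.sum_trace_same`, `IsComplete.sum_trace_trace`). Contraction is therefore a rewriting
rule on cyclic words with integer coefficients. Applying it to the 1, 3, 15 or 105 matchings is a
finite computation independent of n, done by the kernel; n enters only as the trace of an empty
word. The results are polynomials in Tr x^a and Tr(x^a y).

The d-family is evaluated on the same vectors by completeness, and comparing coefficients of the
trace monomials gives the formulas for `t3`, `t4` and `t5` (`eq_of_polynomial_eq`). The case m = 2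
is included because δ is -2 times the second order trace tensor. For n = 3 and n = 4 the
Cayley–Hamilton identity of a traceless matrix makes the polynomials vanish. The scalars follow from
the explicit tensors and the loop contractions of d with two and three vertices (`sum_sum_d_mul_d`,
`sum_d_mul_d_mul_d`). -/

namespace SuN
noncomputable section

/-! ### Completeness relation and the two contraction rules. -/

section Completeness

variable {n : ℕ} {ι : Type*} [Fintype ι]

/-- The completeness relation of a basis `E` of the traceless matrices with `Tr (E_i E_j) = -δ_ij / 2`. -/
def IsComplete (E : ι → Matrix (Fin n) (Fin n) ℂ) : Prop :=
  ∀ A : Matrix (Fin n) (Fin n) ℂ,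
    ∑ k, (A * E k).trace • E k = (-1 / 2 : ℂ) • (A - (A.trace / n) • (1 : Matrix (Fin n) (Fin n) ℂ))

/-- The form `∑_i c_i f_{a b i}`, in terms of the matrix `x = ∑_i c_i E_i`. -/
def brackForm (E : ι → Matrix (Fin n) (Fin n) ℂ) (x : Matrix (Fin n) (Fin n) ℂ) (a b : ι) : ℂ :=
  -2 * ((E a * E b - E b * E a) * x).trace

omit [Fintype ι] in
theorem brackForm_swap (E : ι → Matrix (Fin n) (Fin n) ℂ) (x : Matrix (Fin n) (Fin n) ℂ) (a b : ι) :
    brackForm E x b a = -brackForm E x a b := by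
  rw [brackForm, brackForm, ← neg_sub, Matrix.neg_mul, Matrix.trace_neg]
  ring

variable {E : ι → Matrix (Fin n) (Fin n) ℂ}

/-- Completeness applied to matrix units gives the entrywise (Fierz) form of the relation, which is
then contracted with `M`. -/
theorem IsComplete.sum_mul_mul (hE : IsComplete E) (M : Matrix (Fin n) (Fin n) ℂ) :
    ∑ k, E k * M * E k = (-1 / 2 : ℂ) • (M.trace • 1 - (1 / n : ℂ) • M) := by
  have key (b c : Fin n) (a d : Fin n) : ∑ k, E k a b * E k c d =
      (-1 / 2 : ℂ) * ((if b = c then 1 else 0) * (if a = d then 1 else 0)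
        - (1 / n) * ((if a = b then 1 else 0) * (if c = d then 1 else 0))) := by
    have h := congrFun (congrFun (hE (Matrix.single b a 1)) c) d
    simp only [Matrix.sum_apply, Matrix.smul_apply, Matrix.sub_apply, Matrix.one_apply,
      Matrix.trace_single_mul, Matrix.single_apply, smul_eq_mul, one_mul] at h
    rw [h]
    by_cases hab : a = b
    · subst hab
      simp only [Matrix.trace_single_eq_same, if_true]
      by_cases h1 : a = c <;> by_cases h2 : a = d <;> by_cases h3 : c = d <;> simp_all
    · have : (Matrix.single b a (1:ℂ)).trace = 0 := Matrix.trace_single_eq_of_ne _ _ _ (Ne.symm hab)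
      rw [this]
      by_cases h1 : b = c <;> by_cases h2 : a = d <;> simp_all
  ext a d
  simp only [Matrix.sum_apply, Matrix.mul_apply, Finset.sum_mul]
  rw [Finset.sum_comm]
  have (c : Fin n) : ∑ k, ∑ b, E k a b * M b c * E k c d
      = ∑ b, M b c * ((-1 / 2 : ℂ) * ((if b = c then 1 else 0) * (if a = d then 1 else 0)
        - (1 / n) * ((if a = b then 1 else 0) * (if c = d then 1 else 0)))) := by
    rw [Finset.sum_comm]
    refine Finset.sum_congr rfl fun b _ => ?_
    rw [← key, Finset.mul_sum]
    exact Finset.sum_congr rfl fun k _ => by ring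
  simp only [this, Matrix.smul_apply, Matrix.sub_apply, Matrix.one_apply, smul_eq_mul, Matrix.trace,
    Matrix.diag_apply]
  have e (c : Fin n) : ∑ b, M b c * ((-1 / 2 : ℂ) * ((if b = c then 1 else 0) * (if a = d then 1 else 0)
        - (1 / n) * ((if a = b then 1 else 0) * (if c = d then 1 else 0))))
      = (-1/2 : ℂ) * (M c c * (if a = d then 1 else 0)) + (1 / 2 : ℂ) * ((1 / n) * (M a c * if c = d then 1 else 0)) := by
    have (b : Fin n) : M b c * ((-1 / 2 : ℂ) * ((if b = c then 1 else 0) * (if a = d then 1 else 0)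
        - (1 / n) * ((if a = b then 1 else 0) * (if c = d then 1 else 0))))
      = (if b = c then (-1/2 : ℂ) * (M b c * if a = d then 1 else 0) else 0) +
        (if a = b then (1 / 2 : ℂ) * ((1 / n) * (M b c * if c = d then 1 else 0)) else 0) := by
      split_ifs <;> ring
    simp only [this, Finset.sum_add_distrib, Finset.sum_ite_eq, Finset.sum_ite_eq', Finset.mem_univ, if_true]
  simp only [e, Finset.sum_add_distrib, ← Finset.mul_sum, ← Finset.sum_mul]
  simp
  split_ifs <;> ring

/-- Contraction of two letters in the same trace. -/
theorem IsComplete.sum_trace_same (hE : IsComplete E) (x M N : Matrix (Fin n) (Fin n) ℂ) :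
    ∑ a, ∑ b, brackForm E x a b * (E a * (M * (E b * N))).trace =
      1 / 2 * (M.trace * (x * N).trace - (M * x).trace * N.trace) := by
  -- The sum over `b` replaces `E b` by a multiple of the commutator of `x` and `E a`. That
  -- commutator is traceless, so no 1/n term appears.
  have h1 (a : ι) : ∑ b, brackForm E x a b * (E a * (M * (E b * N))).trace
      = (E a * M * x * E a * N - E a * M * E a * x * N).trace := by
    have h2 (b : ι) : brackForm E x a b = -2 * ((x * E a - E a * x) * E b).trace := by
      rw [brackForm, Matrix.sub_mul, Matrix.sub_mul, Matrix.trace_sub, Matrix.trace_sub,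
        Matrix.trace_mul_cycle (E a) (E b) x, Matrix.trace_mul_cycle (E b) (E a) x,
        Matrix.trace_mul_comm (x * E b) (E a), ← Matrix.mul_assoc, Matrix.mul_assoc x (E a) (E b),
        Matrix.mul_assoc]
    have h3 := congrArg (fun Z => -2 * (E a * (M * (Z * N))).trace) (hE (x * E a - E a * x))
    have h4 : (x * E a - E a * x).trace = 0 := by
      rw [Matrix.trace_sub, Matrix.trace_mul_comm, sub_self]
    simp only [h4, zero_div, zero_smul, sub_zero, Finset.sum_mul, Finset.mul_sum, Matrix.trace_sum,
      Matrix.smul_mul, Matrix.mul_smul, Matrix.trace_smul, smul_eq_mul] at h3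
    simp only [h2, mul_assoc]
    rw [h3]
    simp only [Matrix.sub_mul, Matrix.mul_sub, Matrix.mul_assoc]
    ring
  simp only [h1]
  rw [← Matrix.trace_sum, Finset.sum_sub_distrib]
  simp only [← Finset.sum_mul]
  have e1 : ∑ a, E a * M * x * E a = ∑ a, E a * (M * x) * E a := by simp only [Matrix.mul_assoc]
  -- Both sums over `a` carry the same correction Tr(M x N) / n, and it cancels in the difference.
  rw [e1, hE.sum_mul_mul, hE.sum_mul_mul]
  simp only [Matrix.trace_sub, Matrix.smul_mul, Matrix.sub_mul, Matrix.trace_smul, Matrix.one_mul, smul_eq_mul,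
    Matrix.mul_assoc]
  ring

/-- Contraction of two letters in different traces. -/
theorem IsComplete.sum_trace_trace (hE : IsComplete E) (x R S : Matrix (Fin n) (Fin n) ℂ) :
    ∑ a, ∑ b, brackForm E x a b * ((E a * R).trace * (E b * S).trace) =
      1 / 2 * ((R * (x * S)).trace - (R * (S * x)).trace) := by
  have h1 : ∑ a, ∑ b, brackForm E x a b * ((E a * R).trace * (E b * S).trace) =
      -2 * (((∑ a, (R * E a).trace • E a) * (∑ b, (S * E b).trace • E b)
        - (∑ b, (S * E b).trace • E b) * (∑ a, (R * E a).trace • E a)) * x).trace := by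
    rw [Finset.sum_mul_sum, Finset.sum_mul_sum, Finset.sum_comm (s := Finset.univ (α := ι)) (f := fun i j =>
      ((S * E i).trace • E i) * ((R * E j).trace • E j)), ← Finset.sum_sub_distrib]
    simp only [← Finset.sum_sub_distrib, Finset.sum_mul, Matrix.trace_sum, Finset.mul_sum]
    refine Finset.sum_congr rfl fun a _ => Finset.sum_congr rfl fun b _ => ?_
    rw [brackForm, Matrix.trace_mul_comm R, Matrix.trace_mul_comm S]
    simp only [Matrix.smul_mul, Matrix.mul_smul, smul_smul, Matrix.sub_mul, Matrix.trace_sub, Matrix.trace_smul,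
      smul_eq_mul]
    ring
  -- The multiples of the identity produced by completeness commute with everything and drop out of
  -- the commutator.
  rw [h1, hE, hE]
  have e : (S * (R * x)).trace = (R * (x * S)).trace := by
    rw [Matrix.trace_mul_comm, Matrix.mul_assoc]
  simp only [Matrix.smul_mul, Matrix.mul_smul, smul_smul, Matrix.sub_mul, Matrix.trace_sub, Matrix.trace_smul,
    smul_eq_mul, Matrix.mul_sub, Matrix.one_mul, Matrix.mul_one, smul_sub, Matrix.mul_assoc, e]
  ring

end Completeness

end
end SuN
namespace SuN
noncomputable section

/-! ### Contraction as a rewriting rule on cyclic words. -/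

section Words

/-- The parts of a word before and after the first occurrence of the letter `u`. -/
def cut (u : ℕ) : List ℕ → List ℕ × List ℕ
  | [] => ([], [])
  | a :: w => if a = u then ([], w) else (a :: (cut u w).1, (cut u w).2)

/-- In a product of cyclic words, the word containing `u`, rotated to start after `u`, and the other
words. -/
def pull (u : ℕ) : List (List ℕ) → List ℕ × List (List ℕ)
  | [] => ([], [])
  | w :: ws =>
      if u ∈ w then ((cut u w).2 ++ (cut u w).1, ws) else ((pull u ws).1, w :: (pull u ws).2)

/-- The outcome of contracting the letters `u` and `v` in a product of cyclic words, up to a factor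
`1 / 2`. The letter `0` stands for the matrix that defines the contraction. -/
def contractWords (u v : ℕ) (ts : List (List ℕ)) : List (ℤ × List (List ℕ)) :=
  let p := pull u ts
  if v ∈ p.1 then
    let q := cut v p.1
    [(1, q.1 :: (0 :: q.2) :: p.2), (-1, (q.1 ++ [0]) :: q.2 :: p.2)]
  else
    let q := pull v p.2
    [(1, (p.1 ++ 0 :: q.1) :: q.2), (-1, (p.1 ++ (q.1 ++ [0])) :: q.2)]

/-- Contract the pairs of slots in `m` one after the other; slot `u` is the letter `u + 2`. -/
def contractPairs : List (ℕ × ℕ) → List (ℤ × List (List ℕ)) → List (ℤ × List (List ℕ))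
  | [], l => l
  | (u, v) :: m, l => contractPairs m
      (l.flatMap fun p => (contractWords (u + 2) (v + 2) p.2).map fun q => (p.1 * q.1, q.2))

/-- The labels occurring in a list of pairs. -/
def pairLabels : List (ℕ × ℕ) → List ℕ
  | [] => []
  | (u, v) :: m => u :: v :: pairLabels m

theorem cut_eq {u : ℕ} {w : List ℕ} (h : u ∈ w) : w = (cut u w).1 ++ u :: (cut u w).2 := by
  induction w with
  | nil => simp at h
  | cons a w ih =>
    rw [cut]
    split_ifs with h1
    · simp [h1]
    · have : u ∈ w := by
        rcases List.mem_cons.1 h with h | h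
        · exact absurd h.symm h1
        · exact h
      simpa using ih this

/-- Pulling only rearranges letters. This keeps track of multiplicities during contractions. -/
theorem pull_perm {u : ℕ} {ts : List (List ℕ)} (h : u ∈ ts.flatten) :
    ts.flatten.Perm (u :: ((pull u ts).1 ++ (pull u ts).2.flatten)) := by
  induction ts with
  | nil => simp at h
  | cons w ws ih =>
    rw [pull]
    split_ifs with h1
    · rw [List.perm_iff_count]
      intro a
      have := congrArg (List.count a) (cut_eq h1)
      simp only [List.flatten_cons, List.count_append, List.count_cons] at this ⊢
      omega
    · have h2 : u ∈ ws.flatten := by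
        rw [List.flatten_cons, List.mem_append] at h
        exact h.resolve_left h1
      have := ih h2
      rw [List.perm_iff_count] at this ⊢
      intro a
      have := this a
      simp only [List.flatten_cons, List.count_append, List.count_cons] at this ⊢
      omega

/-- A contraction consumes `u` and `v` and creates only the letter `0`. Slots still to be contracted
therefore keep occurring exactly once. -/
theorem count_contractWords {u v l : ℕ} {ts : List (List ℕ)} (hl : l ≠ 0) (huv : u ≠ v) (hlu : l ≠ u)
    (hlv : l ≠ v) (hu : u ∈ ts.flatten) (hv : v ∈ ts.flatten) {p : ℤ × List (List ℕ)}
    (hp : p ∈ contractWords u v ts) : p.2.flatten.count l = ts.flatten.count l := by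
  have h1 := pull_perm hu
  have hl1 := h1.count_eq l
  rw [contractWords] at hp
  split_ifs at hp with h
  · have h2 := congrArg (List.count l) (cut_eq h)
    simp only [List.mem_cons, List.not_mem_nil, or_false] at hp
    rcases hp with rfl | rfl <;>
    · simp only [List.flatten_cons, List.count_append, List.count_cons, List.count_nil, beq_iff_eq] at *
      simp only [Ne.symm hl, Ne.symm hlu, Ne.symm hlv, if_false] at *
      omega
  · have h2 : v ∈ (pull u ts).2.flatten := by
      have := h1.mem_iff.1 hv
      simp only [List.mem_cons, List.mem_append] at this
      tauto
    have h3 := (pull_perm h2).count_eq l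
    simp only [List.mem_cons, List.not_mem_nil, or_false] at hp
    rcases hp with rfl | rfl <;>
    · simp only [List.flatten_cons, List.count_append, List.count_cons, List.count_nil, beq_iff_eq] at *
      simp only [Ne.symm hl, Ne.symm hlu, Ne.symm hlv, if_false] at *
      omega

end Words

/-! ### Evaluation of words, and soundness of the rewriting. -/

section Evaluation

variable {n : ℕ} {ι : Type*}

/-- The product of the letters of a word. -/
def wordProd (Y : ℕ → Matrix (Fin n) (Fin n) ℂ) (w : List ℕ) : Matrix (Fin n) (Fin n) ℂ :=
  (w.map Y).prod

/-- The product of the traces of the words in a list. -/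
def traceProd (Y : ℕ → Matrix (Fin n) (Fin n) ℂ) (ts : List (List ℕ)) : ℂ :=
  (ts.map fun w => (wordProd Y w).trace).prod

/-- The value of a linear combination of products of traces. -/
def traceSum (Y : ℕ → Matrix (Fin n) (Fin n) ℂ) (l : List (ℤ × List (List ℕ))) : ℂ :=
  (l.map fun p => (p.1 : ℂ) * traceProd Y p.2).sum

/-- The letters: `0` is `x`, `1` is `y`, and `l + 2` is the basis element with index `ω l`. -/
def letter (E : ι → Matrix (Fin n) (Fin n) ℂ) (x y : Matrix (Fin n) (Fin n) ℂ) (ω : ℕ → ι) :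
    ℕ → Matrix (Fin n) (Fin n) ℂ
  | 0 => x
  | 1 => y
  | l + 2 => E (ω l)

variable {Y Y' : ℕ → Matrix (Fin n) (Fin n) ℂ}

theorem wordProd_append (w w' : List ℕ) : wordProd Y (w ++ w') = wordProd Y w * wordProd Y w' := by
  simp [wordProd]

theorem wordProd_cons (a : ℕ) (w : List ℕ) : wordProd Y (a :: w) = Y a * wordProd Y w := by
  simp [wordProd]

theorem wordProd_nil : wordProd Y [] = 1 := rfl

theorem traceProd_cons (w : List ℕ) (ts : List (List ℕ)) :
    traceProd Y (w :: ts) = (wordProd Y w).trace * traceProd Y ts := by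
  simp [traceProd]

theorem traceSum_nil : traceSum Y [] = 0 := rfl

theorem traceSum_cons (p : ℤ × List (List ℕ)) (l : List (ℤ × List (List ℕ))) :
    traceSum Y (p :: l) = p.1 * traceProd Y p.2 + traceSum Y l := by
  simp [traceSum]

theorem traceSum_append (l l' : List (ℤ × List (List ℕ))) :
    traceSum Y (l ++ l') = traceSum Y l + traceSum Y l' := by
  simp [traceSum]

theorem traceSum_map_mul (c : ℤ) (l : List (ℤ × List (List ℕ))) :
    traceSum Y (l.map fun q => (c * q.1, q.2)) = c * traceSum Y l := by
  induction l with
  | nil => simp [traceSum]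
  | cons p l ih => rw [List.map_cons, traceSum_cons, traceSum_cons, ih]; push_cast; ring

theorem wordProd_congr {w : List ℕ} (h : ∀ l ∈ w, Y l = Y' l) : wordProd Y w = wordProd Y' w := by
  rw [wordProd, wordProd, List.map_congr_left h]

theorem traceProd_congr {ts : List (List ℕ)} (h : ∀ l ∈ ts.flatten, Y l = Y' l) :
    traceProd Y ts = traceProd Y' ts := by
  rw [traceProd, traceProd]
  congr 1
  refine List.map_congr_left fun w hw => ?_
  rw [wordProd_congr fun l hl => h l (List.mem_flatten.2 ⟨w, hw, hl⟩)]

/-- Cyclicity of the trace: the word containing `u` may be rotated to begin with `u`. -/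
theorem traceProd_pull {u : ℕ} {ts : List (List ℕ)} (h : u ∈ ts.flatten) :
    traceProd Y ts = (Y u * wordProd Y (pull u ts).1).trace * traceProd Y (pull u ts).2 := by
  induction ts with
  | nil => simp at h
  | cons w ws ih =>
    rw [pull]
    split_ifs with h1
    · conv_lhs => rw [traceProd_cons, cut_eq h1]
      rw [wordProd_append, wordProd_cons, Matrix.trace_mul_comm, wordProd_append, Matrix.mul_assoc]
    · have h2 : u ∈ ws.flatten := by
        rw [List.flatten_cons, List.mem_append] at h
        exact h.resolve_left h1
      rw [traceProd_cons, ih h2, traceProd_cons]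
      ring

variable [Fintype ι] {E : ι → Matrix (Fin n) (Fin n) ℂ}

omit [Fintype ι] in
theorem letter_update_of_ne (x y : Matrix (Fin n) (Fin n) ℂ) (ω : ℕ → ι) {u l : ℕ} (a : ι)
    (h : l ≠ u + 2) : letter E x y (Function.update ω u a) l = letter E x y ω l := by
  match l with
  | 0 => rfl
  | 1 => rfl
  | l + 2 =>
    have : l ≠ u := by omega
    simp [letter, this]

omit [Fintype ι] in
theorem letter_update_self (x y : Matrix (Fin n) (Fin n) ℂ) (ω : ℕ → ι) (u : ℕ) (a : ι) :
    letter E x y (Function.update ω u a) (u + 2) = E a := by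
  simp [letter]

/-- The contraction of a function of slots with the form `β`, in the slots `u` and `v`. -/
def contractSlots (β : ι → ι → ℂ) (u v : ℕ) (Φ : (ℕ → ι) → ℂ) (ω : ℕ → ι) : ℂ :=
  ∑ a, ∑ b, β a b * Φ (Function.update (Function.update ω u a) v b)

/-- The two branches of `contractWords` are the two completeness identities, for `v` in the same
trace as `u` or in another one. Since each slot letter occurs only once, the pieces left after
cutting do not depend on the summed indices. -/
theorem IsComplete.contractSlots_traceProd (hE : IsComplete E) (x y : Matrix (Fin n) (Fin n) ℂ)
    {u v : ℕ} (huv : u ≠ v) {ts : List (List ℕ)} (hu : ts.flatten.count (u + 2) = 1)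
    (hv : ts.flatten.count (v + 2) = 1) (ω : ℕ → ι) :
    contractSlots (brackForm E x) u v (fun ω => traceProd (letter E x y ω) ts) ω =
      1 / 2 * traceSum (letter E x y ω) (contractWords (u + 2) (v + 2) ts) := by
  have hu' : u + 2 ∈ ts.flatten := List.one_le_count_iff.1 hu.ge
  have hv' : v + 2 ∈ ts.flatten := List.one_le_count_iff.1 hv.ge
  have huv' : u + 2 ≠ v + 2 := by omega
  have h1 := pull_perm hu'
  have c1 := h1.count_eq (u + 2)
  have c2 := h1.count_eq (v + 2)
  simp only [List.count_append, List.count_cons, beq_iff_eq, huv', if_true, if_false,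
    hu, hv] at c1 c2
  have hY (a b : ι) (l : ℕ) (h : l ≠ u + 2) (h' : l ≠ v + 2) :
      letter E x y (Function.update (Function.update ω u a) v b) l = letter E x y ω l := by
    rw [letter_update_of_ne _ _ _ _ h', letter_update_of_ne _ _ _ _ h]
  have hYu (a b : ι) : letter E x y (Function.update (Function.update ω u a) v b) (u + 2) = E a := by
    rw [letter_update_of_ne _ _ _ _ huv', letter_update_self]
  have hYv (a b : ι) : letter E x y (Function.update (Function.update ω u a) v b) (v + 2) = E b :=
    letter_update_self _ _ _ _ _
  have hw (a b : ι) (w : List ℕ) (h : w.count (u + 2) = 0) (h' : w.count (v + 2) = 0) :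
      wordProd (letter E x y (Function.update (Function.update ω u a) v b)) w =
        wordProd (letter E x y ω) w :=
    wordProd_congr fun l hl => hY a b l (fun e => List.count_eq_zero.1 h (e ▸ hl))
      (fun e => List.count_eq_zero.1 h' (e ▸ hl))
  have ht (a b : ι) (w : List (List ℕ)) (h : w.flatten.count (u + 2) = 0)
      (h' : w.flatten.count (v + 2) = 0) :
      traceProd (letter E x y (Function.update (Function.update ω u a) v b)) w =
        traceProd (letter E x y ω) w :=
    traceProd_congr fun l hl => hY a b l (fun e => List.count_eq_zero.1 h (e ▸ hl))
      (fun e => List.count_eq_zero.1 h' (e ▸ hl))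
  rw [contractSlots, contractWords]
  split_ifs with h
  · have h2 := cut_eq h
    have d1 := congrArg (List.count (u + 2)) h2
    have d2 := congrArg (List.count (v + 2)) h2
    simp only [List.count_append, List.count_cons, beq_iff_eq, huv'.symm, if_true,
      if_false] at d1 d2
    have e (a b : ι) : traceProd (letter E x y (Function.update (Function.update ω u a) v b)) ts =
        (E a * (wordProd (letter E x y ω) (cut (v + 2) (pull (u + 2) ts).1).1 *
          (E b * wordProd (letter E x y ω) (cut (v + 2) (pull (u + 2) ts).1).2))).trace *
          traceProd (letter E x y ω) (pull (u + 2) ts).2 := by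
      rw [traceProd_pull hu', hYu, ht _ _ _ (by omega) (by omega)]
      conv_lhs => rw [h2]
      rw [wordProd_append, wordProd_cons, hYv, hw _ _ _ (by omega) (by omega),
        hw _ _ _ (by omega) (by omega)]
    simp only [e, ← mul_assoc (brackForm _ _ _ _), ← Finset.sum_mul]
    rw [hE.sum_trace_same]
    simp only [traceSum_cons, traceSum_nil, traceProd_cons, wordProd_append, wordProd_cons,
      wordProd_nil, Matrix.mul_one, letter]
    push_cast
    ring
  · have h2 : v + 2 ∈ (pull (u + 2) ts).2.flatten := by
      have := h1.mem_iff.1 hv'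
      simp only [List.mem_cons, List.mem_append] at this
      tauto
    have h3 := pull_perm h2
    have d1 := h3.count_eq (u + 2)
    have d2 := h3.count_eq (v + 2)
    simp only [List.count_append, List.count_cons, beq_iff_eq, huv'.symm, if_true,
      if_false] at d1 d2
    have e (a b : ι) : traceProd (letter E x y (Function.update (Function.update ω u a) v b)) ts =
        ((E a * wordProd (letter E x y ω) (pull (u + 2) ts).1).trace *
          (E b * wordProd (letter E x y ω) (pull (v + 2) (pull (u + 2) ts).2).1).trace) *
          traceProd (letter E x y ω) (pull (v + 2) (pull (u + 2) ts).2).2 := by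
      rw [traceProd_pull hu', hYu, traceProd_pull h2, hYv, ht _ _ _ (by omega) (by omega),
        hw _ _ _ (by omega) (List.count_eq_zero.2 h), hw _ _ _ (by omega) (by omega)]
      ring
    have e' := hE.sum_trace_trace x (wordProd (letter E x y ω) (pull (u + 2) ts).1)
      (wordProd (letter E x y ω) (pull (v + 2) (pull (u + 2) ts).2).1)
    simp only [← mul_assoc] at e'
    simp only [e, ← mul_assoc, ← Finset.sum_mul]
    rw [e']
    simp only [traceSum_cons, traceSum_nil, traceProd_cons, wordProd_append, wordProd_cons,
      wordProd_nil, Matrix.mul_one, letter, Matrix.mul_assoc]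
    push_cast
    ring

/-- Successive contraction of pairs of slots. -/
def sumPairs (β : ι → ι → ℂ) : List (ℕ × ℕ) → ((ℕ → ι) → ℂ) → (ℕ → ι) → ℂ
  | [], Φ => Φ
  | (u, v) :: m, Φ => sumPairs β m (contractSlots β u v Φ)

theorem contractSlots_const_mul (β : ι → ι → ℂ) (u v : ℕ) (c : ℂ) (Φ : (ℕ → ι) → ℂ) :
    contractSlots β u v (fun ω => c * Φ ω) = fun ω => c * contractSlots β u v Φ ω := by
  funext ω
  simp only [contractSlots, Finset.mul_sum]
  exact Finset.sum_congr rfl fun a _ => Finset.sum_congr rfl fun b _ => by ring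

theorem sumPairs_const_mul (β : ι → ι → ℂ) (m : List (ℕ × ℕ)) (c : ℂ) (Φ : (ℕ → ι) → ℂ) :
    sumPairs β m (fun ω => c * Φ ω) = fun ω => c * sumPairs β m Φ ω := by
  induction m generalizing Φ with
  | nil => rfl
  | cons p m ih =>
    obtain ⟨u, v⟩ := p
    rw [sumPairs, contractSlots_const_mul, ih]
    rfl

theorem IsComplete.contractSlots_traceSum (hE : IsComplete E) (x y : Matrix (Fin n) (Fin n) ℂ)
    {u v : ℕ} (huv : u ≠ v) {l : List (ℤ × List (List ℕ))}
    (hu : ∀ p ∈ l, p.2.flatten.count (u + 2) = 1) (hv : ∀ p ∈ l, p.2.flatten.count (v + 2) = 1) :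
    contractSlots (brackForm E x) u v (fun ω => traceSum (letter E x y ω) l) =
      fun ω => 1 / 2 * traceSum (letter E x y ω)
        (l.flatMap fun p => (contractWords (u + 2) (v + 2) p.2).map fun q => (p.1 * q.1, q.2)) := by
  funext ω
  induction l with
  | nil => simp [contractSlots, traceSum]
  | cons p l ih =>
    rw [List.flatMap_cons, traceSum_append, traceSum_map_mul, mul_add,
      ← ih (fun q hq => hu q (List.mem_cons_of_mem _ hq)) (fun q hq => hv q (List.mem_cons_of_mem _ hq)),
      mul_left_comm, ← hE.contractSlots_traceProd x y huv (hu p List.mem_cons_self)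
        (hv p List.mem_cons_self)]
    simp only [traceSum_cons, contractSlots, Finset.mul_sum, ← Finset.sum_add_distrib]
    exact Finset.sum_congr rfl fun a _ => Finset.sum_congr rfl fun b _ => by ring

/-- Each contraction costs a factor 1/2. The hypothesis on multiplicities survives each step by
`count_contractWords`. -/
theorem IsComplete.sumPairs_traceSum (hE : IsComplete E) (x y : Matrix (Fin n) (Fin n) ℂ)
    {m : List (ℕ × ℕ)} (hm : (pairLabels m).Nodup) {l : List (ℤ × List (List ℕ))}
    (hl : ∀ p ∈ l, ∀ u ∈ pairLabels m, p.2.flatten.count (u + 2) = 1) (ω : ℕ → ι) :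
    sumPairs (brackForm E x) m (fun ω => traceSum (letter E x y ω) l) ω =
      (1 / 2) ^ m.length * traceSum (letter E x y ω) (contractPairs m l) := by
  induction m generalizing l with
  | nil => simp [sumPairs, contractPairs]
  | cons p m ih =>
    obtain ⟨u, v⟩ := p
    simp only [pairLabels, List.nodup_cons, List.mem_cons, not_or] at hm hl
    obtain ⟨⟨huv, hum⟩, hvm, hm⟩ := hm
    rw [sumPairs, hE.contractSlots_traceSum x y huv (fun p hp => hl p hp u (Or.inl rfl))
      (fun p hp => hl p hp v (Or.inr (Or.inl rfl))), sumPairs_const_mul]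
    beta_reduce
    rw [ih hm, contractPairs, List.length_cons]
    · ring
    · intro p hp w hw
      obtain ⟨q, hq, hp⟩ := List.mem_flatMap.1 hp
      obtain ⟨r, hr, rfl⟩ := List.mem_map.1 hp
      have h0 := hl q hq
      rw [← h0 w (Or.inr (Or.inr hw))]
      show r.2.flatten.count (w + 2) = _
      refine count_contractWords (u := u + 2) (v := v + 2) (by omega) (by omega) ?_ ?_ ?_ ?_ hr
      · rintro h
        obtain rfl : w = u := by omega
        exact hum hw
      · rintro h
        obtain rfl : w = v := by omega
        exact hvm hw
      · exact List.one_le_count_iff.1 (h0 u (Or.inl rfl)).ge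
      · exact List.one_le_count_iff.1 (h0 v (Or.inr (Or.inl rfl))).ge

/-- Summation over the values of the slots in a list. -/
def sumSlots : List ℕ → ((ℕ → ι) → ℂ) → (ℕ → ι) → ℂ
  | [], Ψ, ω => Ψ ω
  | u :: L, Ψ, ω => ∑ a, sumSlots L Ψ (Function.update ω u a)

theorem sumSlots_append (L L' : List ℕ) (Ψ : (ℕ → ι) → ℂ) (ω : ℕ → ι) :
    sumSlots (L ++ L') Ψ ω = sumSlots L (sumSlots L' Ψ) ω := by
  induction L generalizing ω with
  | nil => rfl
  | cons u L ih => exact Finset.sum_congr rfl fun a _ => ih _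

theorem sumSlots_perm {L L' : List ℕ} (h : L.Perm L') (Ψ : (ℕ → ι) → ℂ) (ω : ℕ → ι) :
    sumSlots L Ψ ω = sumSlots L' Ψ ω := by
  induction h generalizing ω with
  | nil => rfl
  | cons u _ ih => exact Finset.sum_congr rfl fun a _ => ih _
  | swap u v L =>
    by_cases huv : u = v
    · rw [huv]
    · simp only [sumSlots]
      rw [Finset.sum_comm]
      simp only [Function.update_comm huv]
  | trans _ _ ih ih' => rw [ih, ih']

theorem sumSlots_congr {L : List ℕ} {Ψ Ψ' : (ℕ → ι) → ℂ} (h : ∀ ω, Ψ ω = Ψ' ω) (ω : ℕ → ι) :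
    sumSlots L Ψ ω = sumSlots L Ψ' ω := by
  rw [funext h]

/-- The pairs are disjoint, so each form depends only on its own two slots and the product of forms
can be summed one pair at a time. -/
theorem sumSlots_pairLabels (β : ι → ι → ℂ) {m : List (ℕ × ℕ)} (hm : (pairLabels m).Nodup)
    (Φ : (ℕ → ι) → ℂ) (ω : ℕ → ι) :
    sumSlots (pairLabels m) (fun ω => (m.map fun p => β (ω p.1) (ω p.2)).prod * Φ ω) ω =
      sumPairs β m Φ ω := by
  induction m generalizing Φ ω with
  | nil => simp [sumPairs, sumSlots, pairLabels]
  | cons p m ih =>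
    obtain ⟨u, v⟩ := p
    -- The first pair is moved to the innermost sums, where the forms of the other pairs are
    -- constant factors.
    have hp : (pairLabels ((u, v) :: m)).Perm (pairLabels m ++ [u, v]) := by
      rw [pairLabels]
      exact (List.perm_append_comm (l₁ := [u, v]) (l₂ := pairLabels m))
    simp only [pairLabels, List.nodup_cons, List.mem_cons, not_or] at hm
    obtain ⟨⟨huv, hum⟩, hvm, hm⟩ := hm
    rw [sumSlots_perm hp, sumSlots_append, sumPairs, ← ih hm]
    refine sumSlots_congr (fun ω => ?_) ω
    simp only [sumSlots, contractSlots, Finset.mul_sum]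
    refine Finset.sum_congr rfl fun a _ => Finset.sum_congr rfl fun b _ => ?_
    have e : (m.map fun p => β (Function.update (Function.update ω u a) v b p.1)
        (Function.update (Function.update ω u a) v b p.2)) = m.map fun p => β (ω p.1) (ω p.2) := by
      clear ih hp hm
      induction m with
      | nil => rfl
      | cons p m ih =>
        obtain ⟨s, t⟩ := p
        simp only [pairLabels, List.mem_cons, not_or] at hum hvm
        rw [List.map_cons, List.map_cons, ih hum.2.2 hvm.2.2]
        simp [Function.update_of_ne, Ne.symm hum.1, Ne.symm hum.2.1, Ne.symm hvm.1, Ne.symm hvm.2.1]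
    rw [List.map_cons, List.prod_cons, e]
    simp [Function.update_of_ne huv]
    ring

/-- Extend a finite family of slot values. -/
def extendSlots (ω : ℕ → ι) {N : ℕ} (k : Fin N → ι) (l : ℕ) : ι :=
  if h : l < N then k ⟨l, h⟩ else ω l

/-- Replaces a sum over index families by iterated sums over slots, whose order can be changed by
`sumSlots_perm`. The base assignment `ω` only fills the slots beyond `N`. -/
theorem sum_extendSlots (Ψ : (ℕ → ι) → ℂ) (N : ℕ) (ω : ℕ → ι) :
    ∑ k : Fin N → ι, Ψ (extendSlots ω k) = sumSlots (List.range N) Ψ ω := by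
  induction N generalizing Ψ with
  | zero =>
    have (k : Fin 0 → ι) : extendSlots ω k = ω := by funext l; simp [extendSlots]
    simp [this, sumSlots]
  | succ N ih =>
    rw [List.range_succ, sumSlots_append, ← ih, ← (Fin.snocEquiv fun _ => ι).sum_comp,
      Fintype.sum_prod_type, Finset.sum_comm]
    refine Finset.sum_congr rfl fun k _ => Finset.sum_congr rfl fun a _ => ?_
    show Ψ _ = Ψ _
    congr 1
    funext l
    by_cases h : l = N
    · subst h
      simp [extendSlots, Fin.snocEquiv, Fin.snoc]
    · by_cases h' : l < N
      · have : l < N + 1 := by omega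
        simp [extendSlots, Fin.snocEquiv, Fin.snoc, h, h', this]
      · have : ¬ l < N + 1 := by omega
        simp [extendSlots, h, h', this]

end Evaluation

end
end SuN
namespace SuN
noncomputable section

/-! ### Antisymmetrised products of a skew form as sums over matchings. -/

section Pfaffian

/-- The perfect matchings of the labels `ℓ`, with signs. -/
def matchings : (k : ℕ) → (Fin (2 * k) → ℕ) → List (ℤ × List (ℕ × ℕ))
  | 0, _ => [(1, [])]
  | k + 1, ℓ => (List.finRange (2 * k + 1)).flatMap fun q =>
      (matchings k fun i => ℓ (if i.succ = q then 0 else i.succ).succ).map fun p =>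
        ((if q = 0 then (1 : ℤ) else -1) * p.1, (ℓ 0, ℓ q.succ) :: p.2)

theorem fstIdx_ne_sndIdx {M : ℕ} (a b : Fin M) : fstIdx a ≠ sndIdx b := by
  simp only [fstIdx, sndIdx, ne_eq, Fin.mk.injEq]
  omega

theorem fstIdx_inj {M : ℕ} {a b : Fin M} : fstIdx a = fstIdx b ↔ a = b := by
  simp only [fstIdx, Fin.ext_iff]
  omega

theorem sndIdx_inj {M : ℕ} {a b : Fin M} : sndIdx a = sndIdx b ↔ a = b := by
  simp only [sndIdx, Fin.ext_iff]
  omega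

/-- The exchange of two pairs of indices. -/
def swapPairs {M : ℕ} (a b : Fin M) : Equiv.Perm (Fin (2 * M)) :=
  Equiv.swap (fstIdx a) (fstIdx b) * Equiv.swap (sndIdx a) (sndIdx b)

theorem swapPairs_fstIdx {M : ℕ} (a b c : Fin M) :
    swapPairs a b (fstIdx c) = fstIdx (Equiv.swap a b c) := by
  simp only [swapPairs, Equiv.Perm.mul_apply]
  rw [Equiv.swap_apply_of_ne_of_ne (fstIdx_ne_sndIdx _ _) (fstIdx_ne_sndIdx _ _)]
  simp only [Equiv.swap_apply_def, fstIdx_inj]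
  split_ifs <;> rfl

theorem swapPairs_sndIdx {M : ℕ} (a b c : Fin M) :
    swapPairs a b (sndIdx c) = sndIdx (Equiv.swap a b c) := by
  simp only [swapPairs, Equiv.Perm.mul_apply]
  have h : Equiv.swap (sndIdx a) (sndIdx b) (sndIdx c) = sndIdx (Equiv.swap a b c) := by
    simp only [Equiv.swap_apply_def, sndIdx_inj]
    split_ifs <;> rfl
  rw [h, Equiv.swap_apply_of_ne_of_ne (fstIdx_ne_sndIdx _ _).symm (fstIdx_ne_sndIdx _ _).symm]

theorem sign_swapPairs {M : ℕ} (a b : Fin M) : Equiv.Perm.sign (swapPairs a b) = 1 := by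
  rw [swapPairs, Equiv.Perm.sign_mul, Equiv.Perm.sign_swap', Equiv.Perm.sign_swap']
  simp only [fstIdx_inj, sndIdx_inj]
  split_ifs <;> rfl

/-- If `h` is invariant under permutations that move any point to `0`, its sum over all permutations
reduces to the permutations that fix `0`. -/
theorem sum_perm_eq_of_invariant {m : ℕ} (h : Equiv.Perm (Fin (m + 1)) → ℂ)
    (ρ : Fin (m + 1) → Equiv.Perm (Fin (m + 1))) (hρ : ∀ p, ρ p p = 0)
    (hh : ∀ p σ, h (σ * ρ p) = h σ) :
    ∑ σ, h σ = (m + 1 : ℂ) * ∑ e : Equiv.Perm (Fin m), h (Equiv.Perm.decomposeFin.symm (0, e)) := by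
  have h0 : ∑ e : Equiv.Perm (Fin m), h (Equiv.Perm.decomposeFin.symm (0, e)) =
      ∑ σ, if σ 0 = 0 then h σ else 0 := by
    rw [← Equiv.Perm.decomposeFin.symm.sum_comp, Fintype.sum_prod_type,
      Finset.sum_eq_single (0 : Fin (m + 1))]
    · simp
    · intro p _ hp
      simp [hp]
    · simp
  -- Right multiplication by `ρ p` carries the permutations with `σ 0 = 0` to those with `σ p = 0`,
  -- so all m + 1 classes contribute equally.
  have h1 (p : Fin (m + 1)) : ∑ σ, (if σ p = 0 then h σ else 0) = ∑ σ, if σ 0 = 0 then h σ else 0 := by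
    rw [← Equiv.sum_comp (Equiv.mulRight (ρ p))]
    refine Finset.sum_congr rfl fun σ _ => ?_
    simp only [Equiv.coe_mulRight, Equiv.Perm.mul_apply, hρ, hh]
  have h2 : ∑ σ, h σ = ∑ p, ∑ σ, if σ p = 0 then h σ else 0 := by
    rw [Finset.sum_comm]
    refine Finset.sum_congr rfl fun σ _ => ?_
    rw [Finset.sum_eq_single (σ⁻¹ 0)]
    · simp
    · intro p _ hp
      rw [if_neg]
      rintro h
      exact hp (by rw [← h]; simp)
    · simp
  rw [h2, h0, Finset.sum_congr rfl fun p _ => h1 p]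
  simp

/-- Exchanging two pairs is an even permutation; exchanging the members of one pair is odd, but is
compensated by the skewness of `B`. The summand is thus invariant under a group acting transitively
on positions, and one may fix `σ 0 = 0` at the cost of a factor 2(k + 1). The position paired with
`0` is then chosen freely, and the rest is the same sum for `k`. -/
theorem sum_perm_pairs (B : ℕ → ℕ → ℂ) (hB : ∀ i j, B j i = -B i j) (k : ℕ)
    (ℓ : Fin (2 * k) → ℕ) :
    ∑ σ : Equiv.Perm (Fin (2 * k)), ((Equiv.Perm.sign σ : ℤ) : ℂ) *
        ∏ a : Fin k, B (ℓ (σ (fstIdx a))) (ℓ (σ (sndIdx a))) =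
      2 ^ k * (k.factorial : ℂ) *
        ((matchings k ℓ).map fun p => (p.1 : ℂ) * (p.2.map fun q => B q.1 q.2).prod).sum := by
  induction k with
  | zero => simp [matchings]
  | succ k ih =>
    have hblk (a : Fin (k + 1)) (σ : Equiv.Perm (Fin (2 * (k + 1)))) :
        ((Equiv.Perm.sign (σ * swapPairs 0 a) : ℤ) : ℂ) *
          ∏ b : Fin (k + 1), B (ℓ ((σ * swapPairs 0 a) (fstIdx b))) (ℓ ((σ * swapPairs 0 a) (sndIdx b))) =
        ((Equiv.Perm.sign σ : ℤ) : ℂ) *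
          ∏ b : Fin (k + 1), B (ℓ (σ (fstIdx b))) (ℓ (σ (sndIdx b))) := by
      rw [Equiv.Perm.sign_mul, sign_swapPairs, mul_one,
        ← Equiv.prod_comp (Equiv.swap 0 a) fun b => B (ℓ (σ (fstIdx b))) (ℓ (σ (sndIdx b)))]
      simp only [Equiv.Perm.mul_apply, swapPairs_fstIdx, swapPairs_sndIdx]
    have hflip (a : Fin (k + 1)) (σ : Equiv.Perm (Fin (2 * (k + 1)))) :
        ((Equiv.Perm.sign (σ * Equiv.swap (fstIdx a) (sndIdx a)) : ℤ) : ℂ) *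
          ∏ b : Fin (k + 1), B (ℓ ((σ * Equiv.swap (fstIdx a) (sndIdx a)) (fstIdx b)))
            (ℓ ((σ * Equiv.swap (fstIdx a) (sndIdx a)) (sndIdx b))) =
        ((Equiv.Perm.sign σ : ℤ) : ℂ) *
          ∏ b : Fin (k + 1), B (ℓ (σ (fstIdx b))) (ℓ (σ (sndIdx b))) := by
      rw [Equiv.Perm.sign_mul, Equiv.Perm.sign_swap (fstIdx_ne_sndIdx a a),
        ← Finset.mul_prod_erase _ _ (Finset.mem_univ a), ← Finset.mul_prod_erase _ _ (Finset.mem_univ a)]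
      simp only [Equiv.Perm.mul_apply, Equiv.swap_apply_left, Equiv.swap_apply_right]
      have : ∀ b ∈ Finset.univ.erase a, B (ℓ (σ (Equiv.swap (fstIdx a) (sndIdx a) (fstIdx b))))
          (ℓ (σ (Equiv.swap (fstIdx a) (sndIdx a) (sndIdx b)))) = B (ℓ (σ (fstIdx b))) (ℓ (σ (sndIdx b))) := by
        intro b hb
        have hb := (Finset.mem_erase.1 hb).1
        rw [Equiv.swap_apply_of_ne_of_ne (by rwa [ne_eq, fstIdx_inj]) (fstIdx_ne_sndIdx _ _),
          Equiv.swap_apply_of_ne_of_ne (fstIdx_ne_sndIdx _ _).symm (by rwa [ne_eq, sndIdx_inj])]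
      rw [Finset.prod_congr rfl this, hB]
      push_cast
      ring
    -- An even position `p` opens the pair `p / 2`, which is exchanged with pair `0`. An odd
    -- position closes its pair, whose members are exchanged first.
    let ρ (p : Fin (2 * (k + 1))) : Equiv.Perm (Fin (2 * (k + 1))) :=
      if h : (p : ℕ) % 2 = 0 then swapPairs 0 ⟨p / 2, by omega⟩
      else swapPairs 0 ⟨p / 2, by omega⟩ *
        Equiv.swap (fstIdx ⟨p / 2, by omega⟩) (sndIdx ⟨p / 2, by omega⟩)
    have h0 : (0 : Fin (2 * (k + 1))) = fstIdx (0 : Fin (k + 1)) := rfl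
    have hρ (p : Fin (2 * (k + 1))) : ρ p p = 0 := by
      by_cases h : (p : ℕ) % 2 = 0
      · have hp : p = fstIdx ⟨p / 2, by omega⟩ := by
          ext; simp only [fstIdx]; omega
        have : ρ p = swapPairs 0 ⟨p / 2, by omega⟩ := dif_pos h
        rw [this, h0]
        refine (congrArg _ hp).trans ?_
        rw [swapPairs_fstIdx, Equiv.swap_apply_right]
      · have hp : p = sndIdx ⟨p / 2, by omega⟩ := by
          ext; simp only [sndIdx]; omega
        have : ρ p = swapPairs 0 ⟨p / 2, by omega⟩ *
          Equiv.swap (fstIdx ⟨p / 2, by omega⟩) (sndIdx ⟨p / 2, by omega⟩) := dif_neg h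
        rw [this, h0, Equiv.Perm.mul_apply]
        have e : Equiv.swap (fstIdx (⟨p / 2, by omega⟩ : Fin (k + 1))) (sndIdx ⟨p / 2, by omega⟩) p =
            fstIdx ⟨p / 2, by omega⟩ := by
          rw [Equiv.swap_apply_eq_iff, Equiv.swap_apply_left, ← hp]
        rw [e, swapPairs_fstIdx, Equiv.swap_apply_right]
    have hinv (p : Fin (2 * (k + 1))) (σ : Equiv.Perm (Fin (2 * (k + 1)))) :
        ((Equiv.Perm.sign (σ * ρ p) : ℤ) : ℂ) *
          ∏ b : Fin (k + 1), B (ℓ ((σ * ρ p) (fstIdx b))) (ℓ ((σ * ρ p) (sndIdx b))) =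
        ((Equiv.Perm.sign σ : ℤ) : ℂ) *
          ∏ b : Fin (k + 1), B (ℓ (σ (fstIdx b))) (ℓ (σ (sndIdx b))) := by
      by_cases h : (p : ℕ) % 2 = 0
      · have : ρ p = swapPairs 0 ⟨p / 2, by omega⟩ := dif_pos h
        rw [this, hblk]
      · have : ρ p = swapPairs 0 ⟨p / 2, by omega⟩ *
          Equiv.swap (fstIdx ⟨p / 2, by omega⟩) (sndIdx ⟨p / 2, by omega⟩) := dif_neg h
        rw [this, ← mul_assoc, hflip, hblk]
    have hs := sum_perm_eq_of_invariant (m := 2 * k + 1) (fun σ => ((Equiv.Perm.sign σ : ℤ) : ℂ) *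
      ∏ b : Fin (k + 1), B (ℓ (σ (fstIdx b))) (ℓ (σ (sndIdx b)))) ρ hρ hinv
    refine hs.trans ?_
    -- A second decomposition fixes the partner `q.succ` of `0`. Bringing it to position 1 is a
    -- transposition of sign -1 unless `q = 0`, as in the definition of `matchings`.
    rw [← Equiv.Perm.decomposeFin.symm.sum_comp, Fintype.sum_prod_type]
    have hq (q : Fin (2 * k + 1)) : ∑ e : Equiv.Perm (Fin (2 * k)),
        ((Equiv.Perm.sign (Equiv.Perm.decomposeFin.symm
          ((0 : Fin (2 * k + 2)), Equiv.Perm.decomposeFin.symm (q, e))) : ℤ) : ℂ) *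
        ∏ b : Fin (k + 1), B
          (ℓ (Equiv.Perm.decomposeFin.symm ((0 : Fin (2 * k + 2)), Equiv.Perm.decomposeFin.symm (q, e)) (fstIdx b)))
          (ℓ (Equiv.Perm.decomposeFin.symm ((0 : Fin (2 * k + 2)), Equiv.Perm.decomposeFin.symm (q, e)) (sndIdx b))) =
        2 ^ k * (k.factorial : ℂ) * (((matchings k fun i => ℓ (if i.succ = q then 0 else i.succ).succ).map
          fun p => ((if q = 0 then (1 : ℤ) else -1) * p.1, (ℓ 0, ℓ q.succ) :: p.2)).map
            fun p => (p.1 : ℂ) * (p.2.map fun q => B q.1 q.2).prod).sum := by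
      have h1 (e : Equiv.Perm (Fin (2 * k))) :
          ((Equiv.Perm.sign (Equiv.Perm.decomposeFin.symm
            ((0 : Fin (2 * k + 2)), Equiv.Perm.decomposeFin.symm (q, e))) : ℤ) : ℂ) *
          ∏ b : Fin (k + 1), B
            (ℓ (Equiv.Perm.decomposeFin.symm ((0 : Fin (2 * k + 2)), Equiv.Perm.decomposeFin.symm (q, e)) (fstIdx b)))
            (ℓ (Equiv.Perm.decomposeFin.symm ((0 : Fin (2 * k + 2)), Equiv.Perm.decomposeFin.symm (q, e)) (sndIdx b))) =
          ((if q = 0 then 1 else -1) * B (ℓ 0) (ℓ q.succ)) * (((Equiv.Perm.sign e : ℤ) : ℂ) *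
            ∏ b : Fin k, B (ℓ (if (e (fstIdx b)).succ = q then 0 else (e (fstIdx b)).succ).succ)
              (ℓ (if (e (sndIdx b)).succ = q then 0 else (e (sndIdx b)).succ).succ)) := by
        have f0 : (fstIdx (0 : Fin (k + 1)) : Fin (2 * k + 2)) = 0 := rfl
        have s0 : (sndIdx (0 : Fin (k + 1)) : Fin (2 * k + 2)) = Fin.succ 0 := rfl
        have fs (b : Fin k) : (fstIdx b.succ : Fin (2 * k + 2)) = (fstIdx b).succ.succ := by
          ext; simp [fstIdx]; ring
        have ss (b : Fin k) : (sndIdx b.succ : Fin (2 * k + 2)) = (sndIdx b).succ.succ := by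
          ext; simp [sndIdx]; ring
        have sw (i : Fin (2 * k)) : Equiv.swap 0 q i.succ = if i.succ = q then 0 else i.succ := by
          rw [Equiv.swap_apply_def, if_neg (Fin.succ_ne_zero i)]
        rw [Fin.prod_univ_succ, Equiv.Perm.decomposeFin.symm_sign, Equiv.Perm.decomposeFin.symm_sign]
        erw [f0, s0]
        simp only [fs, ss]
        simp only [Equiv.Perm.decomposeFin_symm_apply_zero, Equiv.Perm.decomposeFin_symm_apply_succ,
          Equiv.swap_self, Equiv.refl_apply, sw, if_true]
        push_cast
        split_ifs <;> push_cast <;> ring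
      simp only [h1, ← Finset.mul_sum]
      rw [ih fun i => ℓ (if i.succ = q then 0 else i.succ).succ]
      rw [mul_left_comm]
      congr 1
      rw [List.map_map, ← List.sum_map_mul_left]
      congr 1
      refine List.map_congr_left fun p _ => ?_
      simp only [Function.comp, List.map_cons, List.prod_cons]
      split_ifs <;> push_cast <;> ring
    rw [Finset.sum_congr rfl fun q _ => hq q, matchings, ← Finset.mul_sum, List.map_flatMap]
    rw [Nat.factorial_succ]
    have : ((List.finRange (2 * k + 1)).flatMap fun q => ((matchings k fun i => ℓ (if i.succ = q then 0 else i.succ).succ).map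
          fun p => ((if q = 0 then (1 : ℤ) else -1) * p.1, (ℓ 0, ℓ q.succ) :: p.2)).map
            fun p => (p.1 : ℂ) * (p.2.map fun q => B q.1 q.2).prod).sum =
        ∑ q : Fin (2 * k + 1), (((matchings k fun i => ℓ (if i.succ = q then 0 else i.succ).succ).map
          fun p => ((if q = 0 then (1 : ℤ) else -1) * p.1, (ℓ 0, ℓ q.succ) :: p.2)).map
            fun p => (p.1 : ℂ) * (p.2.map fun q => B q.1 q.2).prod).sum := by
      rw [List.flatMap_def, List.sum_flatten, List.map_map, ← Fin.sum_univ_def]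
      rfl
    rw [this]
    push_cast
    ring

end Pfaffian

end
end SuN
namespace SuN
noncomputable section

/-! ### Normal forms of trace polynomials. -/

section NormalForm

variable {n : ℕ} {ι : Type*}

/-- The code of a word with at most one letter `1`: the cyclic word `0 ^ p 1 ^ q` has code `2 p + q`. -/
def wordCode (w : List ℕ) : ℕ := 2 * w.count 0 + w.count 1

/-- The words in the letters `0` and `1` with at most one letter `1`. -/
def IsSimpleWord (w : List ℕ) : Bool := w.all (· ≤ 1) && decide (w.count 1 ≤ 1)

/-- Add a term to a linear combination, merging it with a term of the same kind. -/
def addTerm (c : ℤ) (k : List ℕ) : List (ℤ × List ℕ) → List (ℤ × List ℕ)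
  | [] => [(c, k)]
  | (c', k') :: l => if k = k' then (c + c', k') :: l else (c', k') :: addTerm c k l

/-- The normal form of a linear combination of products of traces, for traceless letters. -/
def collect (l : List (ℤ × List (List ℕ))) : List (ℤ × List ℕ) :=
  (l.foldr (fun p l => addTerm p.1 ((p.2.map wordCode).insertionSort (· ≤ ·)) l) []).filter
    fun p => p.1 ≠ 0 ∧ 1 ∉ p.2 ∧ 2 ∉ p.2

/-- The value of a product of traces in normal form. -/
def codeProd (x y : Matrix (Fin n) (Fin n) ℂ) (k : List ℕ) : ℂ :=
  (k.map fun c => (x ^ (c / 2) * y ^ (c % 2)).trace).prod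

/-- The value of a linear combination in normal form. -/
def codeSum (x y : Matrix (Fin n) (Fin n) ℂ) (l : List (ℤ × List ℕ)) : ℂ :=
  (l.map fun p => (p.1 : ℂ) * codeProd x y p.2).sum

theorem wordProd_of_forall_eq_zero {Y : ℕ → Matrix (Fin n) (Fin n) ℂ} {w : List ℕ}
    (h : ∀ l ∈ w, l = 0) : wordProd Y w = Y 0 ^ w.count 0 := by
  rw [List.eq_replicate_of_mem h]
  simp [wordProd]

/-- A cyclic word with at most one letter `1` can be rotated to put that letter last, so the numbers
of `0`s and `1`s determine its trace. -/
theorem trace_wordProd {E : ι → Matrix (Fin n) (Fin n) ℂ} {x y : Matrix (Fin n) (Fin n) ℂ}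
    {ω : ℕ → ι} {w : List ℕ} (hw : IsSimpleWord w) :
    (wordProd (letter E x y ω) w).trace = (x ^ (wordCode w / 2) * y ^ (wordCode w % 2)).trace := by
  simp only [IsSimpleWord, Bool.and_eq_true, List.all_eq_true, decide_eq_true_eq] at hw
  obtain ⟨h1, h2⟩ := hw
  by_cases h : 1 ∈ w
  · have e := cut_eq h
    have c := congrArg (List.count 1) e
    have c0 := congrArg (List.count 0) e
    simp only [List.count_append, List.count_cons, beq_self_eq_true, if_true] at c
    simp at c0
    have z1 : ∀ l ∈ (cut 1 w).1, l = 0 := by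
      intro l hl
      have a := h1 l (by rw [e]; simp [hl])
      have : l ≠ 1 := by
        rintro rfl
        have := List.one_le_count_iff.2 hl
        omega
      omega
    have z2 : ∀ l ∈ (cut 1 w).2, l = 0 := by
      intro l hl
      have a := h1 l (by rw [e]; simp [hl])
      have : l ≠ 1 := by
        rintro rfl
        have := List.one_le_count_iff.2 hl
        omega
      omega
    have d1 : wordCode w / 2 = (cut 1 w).2.count 0 + (cut 1 w).1.count 0 := by
      have := List.one_le_count_iff.2 h
      rw [wordCode]; omega
    have d2 : wordCode w % 2 = 1 := by
      have := List.one_le_count_iff.2 h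
      rw [wordCode]; omega
    rw [d1, d2]
    conv_lhs => rw [e]
    rw [wordProd_append, wordProd_cons, wordProd_of_forall_eq_zero z1, wordProd_of_forall_eq_zero z2,
      pow_one, pow_add, ← Matrix.mul_assoc, Matrix.trace_mul_comm, ← Matrix.mul_assoc]
    rfl
  · have z : ∀ l ∈ w, l = 0 := by
      intro l hl
      have a := h1 l hl
      have : l ≠ 1 := by
        rintro rfl
        exact h hl
      omega
    have c : w.count 1 = 0 := List.count_eq_zero.2 h
    have d1 : wordCode w / 2 = w.count 0 := by rw [wordCode]; omega
    have d2 : wordCode w % 2 = 0 := by rw [wordCode]; omega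
    rw [d1, d2, wordProd_of_forall_eq_zero z, pow_zero, mul_one]
    rfl

theorem codeSum_addTerm (x y : Matrix (Fin n) (Fin n) ℂ) (c : ℤ) (k : List ℕ)
    (l : List (ℤ × List ℕ)) : codeSum x y (addTerm c k l) = c * codeProd x y k + codeSum x y l := by
  induction l with
  | nil => simp [addTerm, codeSum]
  | cons p l ih =>
    obtain ⟨c', k'⟩ := p
    rw [addTerm]
    split_ifs with h
    · subst h
      simp only [codeSum, List.map_cons, List.sum_cons]
      push_cast
      ring
    · simp only [codeSum, List.map_cons, List.sum_cons] at ih ⊢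
      rw [ih]
      ring

/-- Code `1` is the one-letter word `y` and code `2` is the one-letter word `x`. -/
theorem codeProd_eq_zero {x y : Matrix (Fin n) (Fin n) ℂ} (hx : x.trace = 0) (hy : y.trace = 0)
    {k : List ℕ} (h : 1 ∈ k ∨ 2 ∈ k) : codeProd x y k = 0 := by
  rw [codeProd]
  apply List.prod_eq_zero
  rw [List.mem_map]
  rcases h with h | h
  · exact ⟨1, h, by simpa using hy⟩
  · exact ⟨2, h, by simpa using hx⟩

/-- Traces commute as scalars, so a product of them may be sorted by code. Merging equal products,
then dropping zero coefficients and traces of single letters, does not change the value. -/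
theorem traceSum_eq_codeSum {E : ι → Matrix (Fin n) (Fin n) ℂ} {x y : Matrix (Fin n) (Fin n) ℂ}
    (hx : x.trace = 0) (hy : y.trace = 0) {ω : ℕ → ι} {l : List (ℤ × List (List ℕ))}
    (hl : l.all fun p => p.2.all IsSimpleWord) :
    traceSum (letter E x y ω) l = codeSum x y (collect l) := by
  have h1 (k : List (ℤ × List ℕ)) :
      codeSum x y (k.filter fun p => p.1 ≠ 0 ∧ 1 ∉ p.2 ∧ 2 ∉ p.2) = codeSum x y k := by
    induction k with
    | nil => rfl
    | cons p k ih =>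
      simp only [codeSum] at ih
      simp only [codeSum, List.filter_cons, List.map_cons, List.sum_cons]
      split_ifs with h
      · rw [List.map_cons, List.sum_cons, ih]
      · rw [ih]
        simp only [decide_eq_true_eq, not_and_or, not_not] at h
        rcases h with h | h
        · simp [h]
        · rw [codeProd_eq_zero hx hy h, mul_zero, zero_add]
  rw [collect, h1]
  induction l with
  | nil => rfl
  | cons p l ih =>
    simp only [List.all_cons, Bool.and_eq_true] at hl
    rw [List.foldr_cons, codeSum_addTerm, traceSum_cons, ih hl.2]
    congr 2
    rw [traceProd, codeProd, ((List.perm_insertionSort (· ≤ ·) (p.2.map wordCode)).map _).prod_eq,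
      List.map_map]
    congr 1
    refine List.map_congr_left fun w hw => ?_
    exact trace_wordProd (List.all_eq_true.1 hl.1 w hw)

/-- The words with `2 M` slots, contracted along all matchings of the slots. -/
def contractedWords (M : ℕ) : List (ℤ × List (List ℕ)) :=
  (matchings M fun i => (i : ℕ)).flatMap fun p =>
    contractPairs p.2 [(p.1, [1 :: (List.range (2 * M)).map (· + 2)])]

variable [Fintype ι] {E : ι → Matrix (Fin n) (Fin n) ℂ}

theorem matchings_length (k : ℕ) (ℓ : Fin (2 * k) → ℕ) : ∀ p ∈ matchings k ℓ, p.2.length = k := by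
  induction k with
  | zero => simp [matchings]
  | succ k ih =>
    intro p hp
    obtain ⟨q, _, hp⟩ := List.mem_flatMap.1 hp
    obtain ⟨r, hr, rfl⟩ := List.mem_map.1 hp
    simp [ih _ r hr]

/-- The Pfaffian expansion contributes 2^M M! and the M contractions (1/2)^M, which leaves M!. The
assignment `ω` is irrelevant once every slot is contracted; it is only needed to form letters. -/
theorem IsComplete.sum_trace_mul_pairs (hE : IsComplete E) (x y : Matrix (Fin n) (Fin n) ℂ) (ω : ℕ → ι)
    {M : ℕ} (hM : ∀ p ∈ matchings M fun i => (i : ℕ), (pairLabels p.2).Perm (List.range (2 * M))) :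
    ∑ k : Fin (2 * M) → ι, (y * (List.ofFn fun b => E (k b)).prod).trace *
      ∑ σ : Equiv.Perm (Fin (2 * M)), ((Equiv.Perm.sign σ : ℤ) : ℂ) *
        ∏ a : Fin M, brackForm E x (k (σ (fstIdx a))) (k (σ (sndIdx a))) =
      (M.factorial : ℂ) * traceSum (letter E x y ω) (contractedWords M) := by
  have h1 (k : Fin (2 * M) → ι) :
      ∑ σ : Equiv.Perm (Fin (2 * M)), ((Equiv.Perm.sign σ : ℤ) : ℂ) *
        ∏ a : Fin M, brackForm E x (k (σ (fstIdx a))) (k (σ (sndIdx a))) =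
      2 ^ M * (M.factorial : ℂ) * ((matchings M fun i => (i : ℕ)).map fun p => (p.1 : ℂ) *
        (p.2.map fun q => brackForm E x (extendSlots ω k q.1) (extendSlots ω k q.2)).prod).sum := by
    rw [← sum_perm_pairs (fun i j => brackForm E x (extendSlots ω k i) (extendSlots ω k j))
      (fun i j => brackForm_swap E x _ _)]
    simp [extendSlots]
  have h2 (k : Fin (2 * M) → ι) : (y * (List.ofFn fun b => E (k b)).prod).trace =
      traceProd (letter E x y (extendSlots ω k)) [1 :: (List.range (2 * M)).map (· + 2)] := by
    rw [traceProd]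
    simp only [List.map_cons, List.map_nil, List.prod_cons, List.prod_nil, mul_one, wordProd_cons]
    congr 2
    rw [wordProd, List.map_map]
    congr 1
    apply List.ext_getElem
    · simp
    · intro i h h'
      have : i < 2 * M := by simpa using h
      simp [letter, extendSlots, this]
  -- Stated for arbitrary lists of matchings so that it can be proved by induction on the list.
  have h3 : ∀ L : List (ℤ × List (ℕ × ℕ)), (∀ p ∈ L, p ∈ matchings M fun i => (i : ℕ)) →
      ∑ k : Fin (2 * M) → ι, (y * (List.ofFn fun b => E (k b)).prod).trace *
        (L.map fun p => (p.1 : ℂ) *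
          (p.2.map fun q => brackForm E x (extendSlots ω k q.1) (extendSlots ω k q.2)).prod).sum =
      (1 / 2) ^ M * traceSum (letter E x y ω) (L.flatMap fun p =>
        contractPairs p.2 [(p.1, [1 :: (List.range (2 * M)).map (· + 2)])]) := by
    intro L hL
    induction L with
    | nil => simp [traceSum]
    | cons p L ih =>
      have hp := hM p (hL p List.mem_cons_self)
      have hnd : (pairLabels p.2).Nodup := hp.nodup_iff.2 List.nodup_range
      have hlen := matchings_length M _ p (hL p List.mem_cons_self)
      rw [List.flatMap_cons, traceSum_append, mul_add,
        ← ih fun q hq => hL q (List.mem_cons_of_mem _ hq)]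
      simp only [List.map_cons, List.sum_cons, mul_add, Finset.sum_add_distrib]
      congr 1
      have hc : ∀ q ∈ [(p.1, [1 :: (List.range (2 * M)).map (· + 2)])], ∀ u ∈ pairLabels p.2,
          q.2.flatten.count (u + 2) = 1 := by
        intro q hq u hu
        rw [List.mem_singleton] at hq
        subst hq
        have hu' : u ∈ List.range (2 * M) := hp.mem_iff.1 hu
        have : (List.map (· + 2) (List.range (2 * M))).count (u + 2) = (List.range (2 * M)).count u :=
          List.count_map_of_injective _ _ (add_left_injective 2) u
        simp only [List.flatten_cons, List.flatten_nil, List.append_nil, List.count_cons, this,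
          List.count_eq_one_of_mem List.nodup_range hu']
        simp
      have hs := hE.sumPairs_traceSum x y hnd hc ω
      rw [hlen] at hs
      rw [← hs, ← sumSlots_pairLabels _ hnd, sumSlots_perm hp,
        ← sum_extendSlots]
      refine Finset.sum_congr rfl fun k _ => ?_
      rw [traceSum_cons, traceSum_nil, h2]
      ring
  simp only [h1]
  have := h3 _ fun p hp => hp
  rw [contractedWords]
  simp only [mul_left_comm _ (2 ^ M * (M.factorial : ℂ)), ← Finset.mul_sum]
  rw [this]
  have h2 : (2 : ℂ) ^ M * (1 / 2) ^ M = 1 := by rw [← mul_pow]; norm_num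
  linear_combination (M.factorial : ℂ) * traceSum (letter E x y ω) ((matchings M fun i => (i : ℕ)).flatMap fun p =>
    contractPairs p.2 [(p.1, [1 :: (List.range (2 * M)).map (· + 2)])]) * h2

end NormalForm

/-! ### Kernel computation of the contractions for M = 1, 2, 3, 4. -/

section Computation

theorem matchings_perm_one : ∀ p ∈ matchings 1 fun i => (i : ℕ),
    (pairLabels p.2).Perm (List.range (2 * 1)) := by
  decide +kernel

theorem matchings_perm_two : ∀ p ∈ matchings 2 fun i => (i : ℕ),
    (pairLabels p.2).Perm (List.range (2 * 2)) := by
  decide +kernel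

theorem matchings_perm_three : ∀ p ∈ matchings 3 fun i => (i : ℕ),
    (pairLabels p.2).Perm (List.range (2 * 3)) := by
  decide +kernel

theorem matchings_perm_four : ∀ p ∈ matchings 4 fun i => (i : ℕ),
    (pairLabels p.2).Perm (List.range (2 * 4)) := by
  decide +kernel

theorem contractedWords_one_simple : ((contractedWords 1).all fun p => p.2.all IsSimpleWord) = true := by
  decide +kernel

theorem contractedWords_two_simple : ((contractedWords 2).all fun p => p.2.all IsSimpleWord) = true := by
  decide +kernel

theorem contractedWords_three_simple : ((contractedWords 3).all fun p => p.2.all IsSimpleWord) = true := by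
  decide +kernel

theorem contractedWords_four_simple : ((contractedWords 4).all fun p => p.2.all IsSimpleWord) = true := by
  decide +kernel

theorem collect_contractedWords_one : collect (contractedWords 1) = [(1, [0, 3])] := by
  decide +kernel

theorem collect_contractedWords_two : collect (contractedWords 2) = [(1, [0, 0, 5])] := by
  decide +kernel

/-- A code `c` stands for Tr(x^(c / 2) y^(c % 2)), and `0` for Tr 1 = n. The list reads -2 n² Tr(xy)
Tr(x²) + 3 Tr(xy) Tr(x²) + n Tr(x³y) + n³ Tr(x³y). -/
theorem collect_contractedWords_three : collect (contractedWords 3) =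
    [(-2, [0, 0, 3, 4]), (3, [3, 4]), (1, [0, 7]), (1, [0, 0, 0, 7])] := by
  decide +kernel

theorem collect_contractedWords_four : collect (contractedWords 4) =
    [(-2, [0, 0, 0, 3, 6]), (4, [0, 3, 6]), (6, [0, 4, 5]), (5, [0, 0, 9]), (-3, [0, 0, 0, 4, 5]),
      (1, [0, 0, 0, 0, 9])] := by
  decide +kernel

variable {n : ℕ} {ι : Type*} [Fintype ι] [Nonempty ι] {E : ι → Matrix (Fin n) (Fin n) ℂ}

/-- The full contraction of `Tr (y E_1 ⋯ E_{2M})` with the antisymmetrised product of `M` forms. -/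
def pairSum (E : ι → Matrix (Fin n) (Fin n) ℂ) (M : ℕ) (x y : Matrix (Fin n) (Fin n) ℂ) : ℂ :=
  ∑ k : Fin (2 * M) → ι, (y * (List.ofFn fun b => E (k b)).prod).trace *
    ∑ σ : Equiv.Perm (Fin (2 * M)), ((Equiv.Perm.sign σ : ℤ) : ℂ) *
      ∏ a : Fin M, brackForm E x (k (σ (fstIdx a))) (k (σ (sndIdx a)))

theorem IsComplete.pairSum_one (hE : IsComplete E) {x y : Matrix (Fin n) (Fin n) ℂ}
    (hx : x.trace = 0) (hy : y.trace = 0) : pairSum E 1 x y = n * (x * y).trace := by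
  rw [pairSum, hE.sum_trace_mul_pairs x y (fun _ => Classical.arbitrary ι) matchings_perm_one,
    traceSum_eq_codeSum hx hy contractedWords_one_simple, collect_contractedWords_one]
  simp [codeSum, codeProd]

theorem IsComplete.pairSum_two (hE : IsComplete E) {x y : Matrix (Fin n) (Fin n) ℂ}
    (hx : x.trace = 0) (hy : y.trace = 0) : pairSum E 2 x y = 2 * ((n : ℂ) ^ 2 * (x ^ 2 * y).trace) := by
  rw [pairSum, hE.sum_trace_mul_pairs x y (fun _ => Classical.arbitrary ι) matchings_perm_two,
    traceSum_eq_codeSum hx hy contractedWords_two_simple, collect_contractedWords_two]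
  simp [codeSum, codeProd]
  ring

theorem IsComplete.pairSum_three (hE : IsComplete E) {x y : Matrix (Fin n) (Fin n) ℂ}
    (hx : x.trace = 0) (hy : y.trace = 0) : pairSum E 3 x y = 6 * ((n : ℂ) * (n ^ 2 + 1) * (x ^ 3 * y).trace
      + (3 - 2 * n ^ 2) * ((x ^ 2).trace * (x * y).trace)) := by
  rw [pairSum, hE.sum_trace_mul_pairs x y (fun _ => Classical.arbitrary ι) matchings_perm_three,
    traceSum_eq_codeSum hx hy contractedWords_three_simple, collect_contractedWords_three]
  simp [codeSum, codeProd, Nat.factorial]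
  ring

theorem IsComplete.pairSum_four (hE : IsComplete E) {x y : Matrix (Fin n) (Fin n) ℂ}
    (hx : x.trace = 0) (hy : y.trace = 0) : pairSum E 4 x y =
      24 * ((n : ℂ) ^ 2 * (n ^ 2 + 5) * (x ^ 4 * y).trace
        + (6 * n - 3 * n ^ 3) * ((x ^ 2).trace * (x ^ 2 * y).trace)
        + (4 * n - 2 * n ^ 3) * ((x ^ 3).trace * (x * y).trace)) := by
  rw [pairSum, hE.sum_trace_mul_pairs x y (fun _ => Classical.arbitrary ι) matchings_perm_four,
    traceSum_eq_codeSum hx hy contractedWords_four_simple, collect_contractedWords_four]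
  simp [codeSum, codeProd, Nat.factorial]
  ring

end Computation

end
end SuN
namespace SuN
noncomputable section

/-! ### Cyclic symmetry of traces under permutation sums. -/

section Rotation

variable {n : ℕ}

/-- The powers of the rotation already move any position to `0`, so `sum_perm_eq_of_invariant`
applies. -/
theorem sum_perm_eq_of_rotate {m : ℕ} (h : Equiv.Perm (Fin (m + 1)) → ℂ)
    (hh : ∀ σ, h (σ * finRotate (m + 1)) = h σ) :
    ∑ σ, h σ = (m + 1 : ℂ) * ∑ e : Equiv.Perm (Fin m), h (Equiv.Perm.decomposeFin.symm (0, e)) := by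
  have h1 (σ : Equiv.Perm (Fin (m + 1))) : h (σ * (finRotate (m + 1))⁻¹) = h σ := by
    rw [← hh, inv_mul_cancel_right]
  have h2 (k : ℕ) (σ : Equiv.Perm (Fin (m + 1))) : h (σ * (finRotate (m + 1))⁻¹ ^ k) = h σ := by
    induction k generalizing σ with
    | zero => simp
    | succ k ih => rw [pow_succ, ← mul_assoc, h1, ih]
  have h3 (k : ℕ) (hk : k < m + 1) : ((finRotate (m + 1))⁻¹ ^ k) ⟨k, hk⟩ = 0 := by
    induction k with
    | zero => simp
    | succ k ih =>
      have : (finRotate (m + 1))⁻¹ ⟨k + 1, hk⟩ = ⟨k, by omega⟩ := by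
        rw [Equiv.Perm.inv_eq_iff_eq, finRotate_of_lt (by omega)]
      rw [pow_succ, Equiv.Perm.mul_apply, this, ih]
  exact sum_perm_eq_of_invariant h (fun p => (finRotate (m + 1))⁻¹ ^ (p : ℕ)) (fun p => h3 p p.2)
    fun p σ => h2 p σ

theorem trace_prod_rotate {m : ℕ} (g : Fin (m + 1) → Matrix (Fin n) (Fin n) ℂ) :
    (List.ofFn fun b => g (finRotate (m + 1) b)).prod.trace = (List.ofFn g).prod.trace := by
  rw [List.ofFn_succ', List.concat_eq_append, List.prod_append, List.prod_singleton, List.ofFn_succ,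
    List.prod_cons, Matrix.trace_mul_comm]
  simp

theorem cons_finRotate {α : Type*} {m : ℕ} (l : Fin m → α) (z : α) (b : Fin (m + 1)) :
    (Fin.cons z l : Fin (m + 1) → α) (finRotate (m + 1) b) = (Fin.snoc l z : Fin (m + 1) → α) b := by
  refine Fin.lastCases ?_ (fun a => ?_) b
  · rw [finRotate_last, Fin.cons_zero, Fin.snoc_last]
  · rw [Fin.snoc_castSucc]
    have : finRotate (m + 1) a.castSucc = a.succ := by simp
    rw [this, Fin.cons_succ]

/-- By cyclicity every term of the symmetrised trace can be rotated to begin with the distinguished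
index. Each arrangement of the others arises M + 1 times, so (M + 1)! becomes M!. -/
theorem kTensor_snoc {ι : Type*} (T : ι → Matrix (Fin n) (Fin n) ℂ) (M : ℕ)
    (l : Fin M → ι) (z : ι) : kTensor T (M + 1) (Fin.snoc l z) =
      (1 / (M.factorial : ℂ)) * ∑ e : Equiv.Perm (Fin M),
        (X T z * (List.ofFn fun a => X T (l (e a))).prod).trace := by
  have h0 : ∑ σ : Equiv.Perm (Fin (M + 1)),
      (List.ofFn fun b => X T ((Fin.snoc l z : Fin (M + 1) → ι) (σ b))).prod.trace =
      ∑ σ : Equiv.Perm (Fin (M + 1)),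
        (List.ofFn fun b => X T ((Fin.cons z l : Fin (M + 1) → ι) (σ b))).prod.trace := by
    conv_rhs => rw [← Equiv.sum_comp (Equiv.mulLeft (finRotate (M + 1)))]
    simp only [Equiv.coe_mulLeft, Equiv.Perm.mul_apply, cons_finRotate]
  rw [kTensor, symmetrize, h0, sum_perm_eq_of_rotate]
  · rw [Nat.factorial_succ]
    have h1 : (M.factorial : ℂ) ≠ 0 := by exact_mod_cast M.factorial_ne_zero
    have h2 : (M + 1 : ℂ) ≠ 0 := by exact_mod_cast M.succ_ne_zero
    rw [← mul_assoc]
    congr 1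
    · push_cast
      field_simp
    · refine Finset.sum_congr rfl fun e _ => ?_
      rw [List.ofFn_succ, List.prod_cons]
      simp
  · intro σ
    exact trace_prod_rotate fun b => X T ((Fin.cons z l : Fin (M + 1) → ι) (σ b))

end Rotation

/-! ### Antisymmetry of the cocycle and symmetry of `tOf`. -/

section Lift

/-- A permutation of the first `N` points, as a permutation of `N + 1` points. -/
def liftPerm {N : ℕ} (s : Equiv.Perm (Fin N)) : Equiv.Perm (Fin (N + 1)) :=
  s.viaFintypeEmbedding Fin.castSuccEmb

theorem liftPerm_castSucc {N : ℕ} (s : Equiv.Perm (Fin N)) (b : Fin N) :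
    liftPerm s b.castSucc = (s b).castSucc :=
  s.viaFintypeEmbedding_apply_image Fin.castSuccEmb b

theorem liftPerm_last {N : ℕ} (s : Equiv.Perm (Fin N)) : liftPerm s (Fin.last N) = Fin.last N := by
  refine s.viaFintypeEmbedding_apply_notMem_range _ ?_
  rintro ⟨b, hb⟩
  exact (Fin.castSucc_lt_last b).ne hb

theorem sign_liftPerm {N : ℕ} (s : Equiv.Perm (Fin N)) :
    Equiv.Perm.sign (liftPerm s) = Equiv.Perm.sign s :=
  s.viaFintypeEmbedding_sign _

theorem snoc_comp_liftPerm {α : Type*} {N : ℕ} (j : Fin N → α) (z : α) (s : Equiv.Perm (Fin N)) :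
    (fun b => (Fin.snoc j z : Fin (N + 1) → α) (liftPerm s b)) = Fin.snoc (fun b => j (s b)) z := by
  funext b
  refine Fin.lastCases ?_ (fun a => ?_) b
  · simp [liftPerm_last]
  · simp [liftPerm_castSucc]

variable {n : ℕ} {ι : Type*} [Fintype ι]

theorem cocycle_comp_perm (T : ι → Matrix (Fin n) (Fin n) ℂ) {M : ℕ} (h : (Fin (M + 1) → ι) → ℂ)
    (w : Fin (2 * M + 1) → ι) (ρ : Equiv.Perm (Fin (2 * M + 1))) :
    cocycle T h (fun b => w (ρ b)) = ((Equiv.Perm.sign ρ : ℤ) : ℂ) * cocycle T h w := by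
  rw [cocycle, cocycle, mul_left_comm]
  congr 1
  rw [← Equiv.sum_comp (Equiv.mulLeft ρ⁻¹), Finset.mul_sum]
  refine Finset.sum_congr rfl fun σ _ => ?_
  simp only [Equiv.coe_mulLeft, Equiv.Perm.mul_apply, Equiv.Perm.inv_def, Equiv.apply_symm_apply,
    Equiv.Perm.sign_mul, Equiv.Perm.sign_symm]
  push_cast
  ring

/-- Exchanging two of the first M indices amounts to exchanging two pairs of summation indices, an
even permutation under which the cocycle is invariant. Symmetry under moving the last index is not
needed. -/
theorem tOf_snoc_comp_perm (T : ι → Matrix (Fin n) (Fin n) ℂ) {M : ℕ} (h : (Fin (M + 1) → ι) → ℂ)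
    (e : Equiv.Perm (Fin M)) (i : Fin M → ι) (z : ι) :
    tOf T h (Fin.snoc (fun a => i (e a)) z) = tOf T h (Fin.snoc i z) := by
  induction e using Equiv.Perm.swap_induction_on generalizing i with
  | one => rfl
  | swap_mul e a b _ ih =>
    have := ih (fun c => i (Equiv.swap a b c))
    simp only [Equiv.Perm.mul_apply]
    rw [this]
    simp only [tOf, Fin.snoc_last, Fin.snoc_castSucc]
    rw [← Equiv.sum_comp ((swapPairs a b).arrowCongr (Equiv.refl ι))]
    refine Finset.sum_congr rfl fun j _ => ?_
    have hj : ((swapPairs a b).arrowCongr (Equiv.refl ι)) j = fun c => j ((swapPairs a b)⁻¹ c) := rfl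
    -- `swapPairs` is an involution, checked on first and second members of pairs, which exhaust the
    -- positions.
    have hs : (swapPairs a b)⁻¹ = swapPairs a b := by
      rw [swapPairs, mul_inv_rev, Equiv.swap_inv, Equiv.swap_inv]
      refine Equiv.ext fun c => ?_
      obtain ⟨d, rfl | rfl⟩ : ∃ d, c = fstIdx d ∨ c = sndIdx d := by
        refine ⟨⟨c / 2, by omega⟩, ?_⟩
        simp only [fstIdx, sndIdx, Fin.ext_iff]
        omega
      · have h1 := swapPairs_fstIdx a b d
        rw [swapPairs] at h1
        rw [h1]
        simp only [Equiv.Perm.mul_apply]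
        have : Equiv.swap (fstIdx a) (fstIdx b) (fstIdx d) = fstIdx (Equiv.swap a b d) := by
          simp only [Equiv.swap_apply_def, fstIdx_inj]
          split_ifs <;> rfl
        rw [this, Equiv.swap_apply_of_ne_of_ne (fstIdx_ne_sndIdx _ _) (fstIdx_ne_sndIdx _ _)]
      · have h1 := swapPairs_sndIdx a b d
        rw [swapPairs] at h1
        rw [h1]
        simp only [Equiv.Perm.mul_apply]
        have : Equiv.swap (sndIdx a) (sndIdx b) (sndIdx d) = sndIdx (Equiv.swap a b d) := by
          simp only [Equiv.swap_apply_def, sndIdx_inj]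
          split_ifs <;> rfl
        rw [Equiv.swap_apply_of_ne_of_ne (fstIdx_ne_sndIdx _ _).symm (fstIdx_ne_sndIdx _ _).symm, this]
    rw [hj, hs, ← snoc_comp_liftPerm, cocycle_comp_perm, sign_liftPerm, sign_swapPairs,
      ← Equiv.prod_comp (Equiv.swap a b)]
    simp [swapPairs_fstIdx, swapPairs_sndIdx]

end Lift

/-! ### The cocycle of a trace tensor as an antisymmetrised trace. -/

section CocycleTrace

variable {n : ℕ} {ι : Type*} [Fintype ι]

/-- Multilinearity of the matrix product. Relabelling `l` by `e` aligns the coefficients with the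
permuted factors. -/
theorem sum_prod_mul_trace (F : Fin M → ι → ℂ) (E : ι → Matrix (Fin n) (Fin n) ℂ)
    (Z : Matrix (Fin n) (Fin n) ℂ) (e : Equiv.Perm (Fin M)) :
    ∑ l : Fin M → ι, (∏ a, F a (l a)) * (Z * (List.ofFn fun a => E (l (e a))).prod).trace =
      (Z * (List.ofFn fun a => ∑ k, F (e a) k • E k).prod).trace := by
  classical
  have h := (MultilinearMap.mkPiAlgebraFin ℂ M (Matrix (Fin n) (Fin n) ℂ)).map_sum
    (fun a k => F (e a) k • E k)
  rw [MultilinearMap.mkPiAlgebraFin_apply] at h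
  rw [h, Finset.mul_sum, Matrix.trace_sum, ← Equiv.sum_comp (e.arrowCongr (Equiv.refl ι))]
  refine Finset.sum_congr rfl fun l _ => ?_
  rw [MultilinearMap.map_smul_univ (MultilinearMap.mkPiAlgebraFin ℂ M (Matrix (Fin n) (Fin n) ℂ))
    (fun a => F (e a) (l a)) fun a => E (l a), MultilinearMap.mkPiAlgebraFin_apply, Matrix.mul_smul,
    Matrix.trace_smul, smul_eq_mul, ← Equiv.prod_comp e]
  simp [Equiv.arrowCongr]

theorem prod_ofFn_pairs {M : ℕ} (A : Fin (2 * M) → Matrix (Fin n) (Fin n) ℂ) :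
    (List.ofFn fun a : Fin M => A (fstIdx a) * A (sndIdx a)).prod = (List.ofFn A).prod := by
  rw [List.ofFn_mul', List.prod_flatten, List.map_ofFn]
  congr 2
  funext a
  simp [fstIdx, sndIdx]

/-- The antisymmetrised product of commutators, in terms of the antisymmetrised product. -/
theorem sum_sign_trace_commutators {M : ℕ} (A : Fin (2 * M + 1) → Matrix (Fin n) (Fin n) ℂ)
    (e : Equiv.Perm (Fin M)) :
    ∑ σ : Equiv.Perm (Fin (2 * M + 1)), ((Equiv.Perm.sign σ : ℤ) : ℂ) *
      (A (σ (Fin.last _)) * (List.ofFn fun a =>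
        A (σ (fstIdx (e a)).castSucc) * A (σ (sndIdx (e a)).castSucc) -
        A (σ (sndIdx (e a)).castSucc) * A (σ (fstIdx (e a)).castSucc)).prod).trace =
    2 ^ M * ∑ σ : Equiv.Perm (Fin (2 * M + 1)), ((Equiv.Perm.sign σ : ℤ) : ℂ) *
      (List.ofFn fun b => A (σ b)).prod.trace := by
  classical
  -- The order of the commutators is immaterial: permuting whole pairs is an even permutation,
  -- absorbed in `σ`.
  have hblock : ∑ σ : Equiv.Perm (Fin (2 * M + 1)), ((Equiv.Perm.sign σ : ℤ) : ℂ) *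
      (A (σ (Fin.last _)) * (List.ofFn fun a =>
        A (σ (fstIdx (e a)).castSucc) * A (σ (sndIdx (e a)).castSucc) -
        A (σ (sndIdx (e a)).castSucc) * A (σ (fstIdx (e a)).castSucc)).prod).trace =
      ∑ σ : Equiv.Perm (Fin (2 * M + 1)), ((Equiv.Perm.sign σ : ℤ) : ℂ) *
      (A (σ (Fin.last _)) * (List.ofFn fun a =>
        A (σ (fstIdx a).castSucc) * A (σ (sndIdx a).castSucc) -
        A (σ (sndIdx a).castSucc) * A (σ (fstIdx a).castSucc)).prod).trace := by
    induction e using Equiv.Perm.swap_induction_on with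
    | one => rfl
    | swap_mul e a b _ ih =>
      rw [← ih, ← Equiv.sum_comp (Equiv.mulRight (liftPerm (swapPairs a b)))]
      refine Finset.sum_congr rfl fun σ _ => ?_
      simp only [Equiv.coe_mulRight, Equiv.Perm.mul_apply, liftPerm_castSucc, liftPerm_last,
        swapPairs_fstIdx, swapPairs_sndIdx, Equiv.swap_apply_self, Equiv.Perm.sign_mul, sign_liftPerm,
        sign_swapPairs, mul_one]
  rw [hblock]
  let P (σ : Equiv.Perm (Fin (2 * M + 1))) (a : Fin M) :=
    A (σ (fstIdx a).castSucc) * A (σ (sndIdx a).castSucc)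
  let Q (σ : Equiv.Perm (Fin (2 * M + 1))) (a : Fin M) :=
    A (σ (sndIdx a).castSucc) * A (σ (fstIdx a).castSucc)
  -- `R s` is the term of the expanded commutators in which the pairs in `s` are reversed. Each
  -- reversal is a transposition absorbed in `σ`; its sign cancels the sign from the expansion, so
  -- all 2^M terms agree.
  let R (s : Finset (Fin M)) : ℂ := ∑ σ : Equiv.Perm (Fin (2 * M + 1)), ((Equiv.Perm.sign σ : ℤ) : ℂ) *
    (A (σ (Fin.last _)) * (List.ofFn (s.piecewise (Q σ) (P σ))).prod).trace
  have hR (s : Finset (Fin M)) : R s = (-1) ^ s.card * R ∅ := by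
    induction s using Finset.induction_on with
    | empty => simp
    | insert a s ha ih =>
      rw [Finset.card_insert_of_notMem ha, pow_succ, mul_assoc, neg_one_mul, mul_neg, ← ih]
      have hsw (σ : Equiv.Perm (Fin (2 * M + 1))) :
          (insert a s).piecewise (Q σ) (P σ) =
            s.piecewise (Q (σ * liftPerm (Equiv.swap (fstIdx a) (sndIdx a))))
              (P (σ * liftPerm (Equiv.swap (fstIdx a) (sndIdx a)))) := by
        funext b
        by_cases hb : b = a
        · subst hb
          rw [Finset.piecewise_eq_of_mem _ _ _ (Finset.mem_insert_self _ _),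
            Finset.piecewise_eq_of_notMem _ _ _ ha]
          simp [P, Q, liftPerm_castSucc]
        · have e1 : Equiv.swap (fstIdx a) (sndIdx a) (fstIdx b) = fstIdx b :=
            Equiv.swap_apply_of_ne_of_ne (by rwa [ne_eq, fstIdx_inj]) (fstIdx_ne_sndIdx _ _)
          have e2 : Equiv.swap (fstIdx a) (sndIdx a) (sndIdx b) = sndIdx b :=
            Equiv.swap_apply_of_ne_of_ne (fstIdx_ne_sndIdx _ _).symm (by rwa [ne_eq, sndIdx_inj])
          simp [Finset.piecewise, P, Q, liftPerm_castSucc, hb, e1, e2]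
      simp only [R]
      conv_rhs => rw [← Equiv.sum_comp (Equiv.mulRight (liftPerm (Equiv.swap (fstIdx a) (sndIdx a))))]
      rw [← Finset.sum_neg_distrib]
      refine Finset.sum_congr rfl fun σ _ => ?_
      rw [hsw]
      simp only [Equiv.coe_mulRight, Equiv.Perm.sign_mul, sign_liftPerm,
        Equiv.Perm.sign_swap (fstIdx_ne_sndIdx a a), Equiv.Perm.mul_apply, liftPerm_last]
      push_cast
      ring
  have hexp (σ : Equiv.Perm (Fin (2 * M + 1))) :
      (List.ofFn fun a => P σ a - Q σ a).prod =
        ∑ s : Finset (Fin M), (-1 : ℂ) ^ s.card • (List.ofFn (s.piecewise (Q σ) (P σ))).prod := by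
    have h := (MultilinearMap.mkPiAlgebraFin ℂ M (Matrix (Fin n) (Fin n) ℂ)).map_add_univ
      (fun a => (-1 : ℂ) • Q σ a) (P σ)
    have h0 : (fun a => (-1 : ℂ) • Q σ a) + P σ = fun a => P σ a - Q σ a := by
      funext a
      simp [sub_eq_add_neg, add_comm]
    rw [h0, MultilinearMap.mkPiAlgebraFin_apply] at h
    rw [h]
    refine Finset.sum_congr rfl fun s _ => ?_
    have h1 : s.piecewise (fun a => (-1 : ℂ) • Q σ a) (P σ) =
        fun a => (if a ∈ s then (-1 : ℂ) else 1) • s.piecewise (Q σ) (P σ) a := by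
      funext a
      by_cases ha : a ∈ s <;> simp [ha]
    rw [h1, MultilinearMap.map_smul_univ, MultilinearMap.mkPiAlgebraFin_apply, Finset.prod_ite]
    simp
  have hsum : ∑ σ : Equiv.Perm (Fin (2 * M + 1)), ((Equiv.Perm.sign σ : ℤ) : ℂ) *
      (A (σ (Fin.last _)) * (List.ofFn fun a => P σ a - Q σ a).prod).trace =
      ∑ s : Finset (Fin M), (-1 : ℂ) ^ s.card * R s := by
    simp only [hexp, R, Finset.mul_sum, Matrix.trace_sum, Matrix.mul_smul, Matrix.trace_smul, smul_eq_mul]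
    rw [Finset.sum_comm]
    refine Finset.sum_congr rfl fun s _ => Finset.sum_congr rfl fun σ _ => ?_
    ring
  refine hsum.trans ?_
  have hs (s : Finset (Fin M)) : (-1 : ℂ) ^ s.card * R s = R ∅ := by
    rw [hR, ← mul_assoc, ← mul_pow]
    norm_num
  simp only [hs, Finset.sum_const, Finset.card_univ, Fintype.card_finset, Fintype.card_fin, nsmul_eq_mul]
  push_cast
  congr 1
  refine Finset.sum_congr rfl fun σ _ => ?_
  congr 1
  have : (∅ : Finset (Fin M)).piecewise (Q σ) (P σ) = P σ := Finset.piecewise_empty _ _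
  rw [this, List.ofFn_succ', List.concat_eq_append, List.prod_append, List.prod_singleton,
    Matrix.trace_mul_comm, ← prod_ofFn_pairs fun b => A (σ b.castSucc)]

/-- The relation `hc` turns the structure constants into commutators, and antisymmetrisation turns
each commutator into twice a product. The constant is 1/(2M + 1)! · 1/M! · M! · 2^M · (2M + 1): the
sum over orderings of the commutators gives M!, and rotating `X T z` to the front gives 2M + 1. -/
theorem cocycle_kTensor_snoc {T : ι → Matrix (Fin n) (Fin n) ℂ}
    (hc : ∀ i j, X T i * X T j - X T j * X T i = ∑ k, f T i j k • X T k) {M : ℕ}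
    (j : Fin (2 * M) → ι) (z : ι) :
    cocycle T (kTensor T (M + 1)) (Fin.snoc j z) =
      2 ^ M / ((2 * M).factorial : ℂ) * ∑ e : Equiv.Perm (Fin (2 * M)), ((Equiv.Perm.sign e : ℤ) : ℂ) *
        (X T z * (List.ofFn fun b => X T (j (e b))).prod).trace := by
  set w : Fin (2 * M + 1) → ι := Fin.snoc j z with hw
  have h1 (σ : Equiv.Perm (Fin (2 * M + 1))) :
      ∑ l : Fin M → ι, (∏ a : Fin M, f T (w (σ (fstIdx a).castSucc)) (w (σ (sndIdx a).castSucc)) (l a)) *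
          kTensor T (M + 1) (Fin.snoc l (w (σ (Fin.last (2 * M))))) =
      (1 / (M.factorial : ℂ)) * ∑ e : Equiv.Perm (Fin M), (X T (w (σ (Fin.last _))) * (List.ofFn fun a =>
        X T (w (σ (fstIdx (e a)).castSucc)) * X T (w (σ (sndIdx (e a)).castSucc)) -
        X T (w (σ (sndIdx (e a)).castSucc)) * X T (w (σ (fstIdx (e a)).castSucc))).prod).trace := by
    simp only [kTensor_snoc, mul_left_comm _ (1 / (M.factorial : ℂ)), ← Finset.mul_sum]
    congr 1
    simp only [Finset.mul_sum]
    rw [Finset.sum_comm]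
    refine Finset.sum_congr rfl fun e _ => ?_
    rw [sum_prod_mul_trace fun a k => f T (w (σ (fstIdx a).castSucc)) (w (σ (sndIdx a).castSucc)) k]
    simp only [hc]
  rw [cocycle]
  simp only [h1, mul_left_comm _ (1 / (M.factorial : ℂ)), ← Finset.mul_sum]
  simp only [Finset.mul_sum (Finset.univ (α := Equiv.Perm (Fin M)))]
  rw [Finset.sum_comm]
  rw [Finset.sum_congr rfl fun e _ => sum_sign_trace_commutators (fun b => X T (w b)) e]
  have h2 : ∑ σ : Equiv.Perm (Fin (2 * M + 1)), ((Equiv.Perm.sign σ : ℤ) : ℂ) *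
      (List.ofFn fun b => X T (w (σ b))).prod.trace =
      (2 * M + 1 : ℂ) * ∑ e : Equiv.Perm (Fin (2 * M)), ((Equiv.Perm.sign e : ℤ) : ℂ) *
        (X T z * (List.ofFn fun b => X T (j (e b))).prod).trace := by
    -- A rotation of an odd number of points is even, so the cyclic symmetry respects the signs.
    have hsgn : Equiv.Perm.sign (finRotate (2 * M + 1)) = 1 := by
      rw [sign_finRotate]; simp
    have h0 : ∑ σ : Equiv.Perm (Fin (2 * M + 1)), ((Equiv.Perm.sign σ : ℤ) : ℂ) *
        (List.ofFn fun b => X T (w (σ b))).prod.trace =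
        ∑ σ : Equiv.Perm (Fin (2 * M + 1)), ((Equiv.Perm.sign σ : ℤ) : ℂ) *
        (List.ofFn fun b => X T ((Fin.cons z j : Fin (2 * M + 1) → ι) (σ b))).prod.trace := by
      conv_rhs => rw [← Equiv.sum_comp (Equiv.mulLeft (finRotate (2 * M + 1)))]
      simp only [Equiv.coe_mulLeft, Equiv.Perm.mul_apply, cons_finRotate, Equiv.Perm.sign_mul, hsgn,
        one_mul, hw]
    rw [h0, sum_perm_eq_of_rotate]
    · push_cast
      congr 1
      refine Finset.sum_congr rfl fun e _ => ?_
      rw [List.ofFn_succ, List.prod_cons]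
      simp
    · intro σ
      rw [Equiv.Perm.sign_mul, hsgn, mul_one]
      congr 1
      exact trace_prod_rotate fun b => X T ((Fin.cons z j : Fin (2 * M + 1) → ι) (σ b))
  rw [h2]
  simp only [Finset.sum_const, Finset.card_univ, Fintype.card_perm, Fintype.card_fin, nsmul_eq_mul]
  rw [Nat.factorial_succ]
  have e1 : (M.factorial : ℂ) ≠ 0 := by exact_mod_cast M.factorial_ne_zero
  have e2 : ((2 * M).factorial : ℂ) ≠ 0 := by exact_mod_cast (2 * M).factorial_ne_zero
  have e3 : (2 * M + 1 : ℂ) ≠ 0 := by exact_mod_cast (2 * M).succ_ne_zero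
  push_cast
  field_simp

omit [Fintype ι] in
theorem f_eq (T : ι → Matrix (Fin n) (Fin n) ℂ) (i j k : ι) :
    f T i j k = -2 * ((X T i * X T j - X T j * X T i) * X T k).trace := by
  simp only [f, X, smul_mul_smul_comm, ← smul_sub, Matrix.trace_smul, smul_eq_mul]
  linear_combination (-2 * Complex.I * ((T i * T j - T j * T i) * T k).trace) * Complex.I_mul_I

theorem sum_mul_f (T : ι → Matrix (Fin n) (Fin n) ℂ) (c : ι → ℂ) (a b : ι) :
    ∑ i, c i * f T a b i = brackForm (X T) (∑ i, c i • X T i) a b := by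
  simp only [f_eq, brackForm, Finset.mul_sum, Matrix.trace_sum, Matrix.mul_smul, Matrix.trace_smul,
    smul_eq_mul]
  exact Finset.sum_congr rfl fun i _ => by ring

/-- For fixed `j` the contraction with the powers of `c` factorises over the pairs, each factor
being the form of `∑ i, c i • X T i`. -/
theorem sum_tOf_eq (T : ι → Matrix (Fin n) (Fin n) ℂ) {M : ℕ} (h : (Fin (M + 1) → ι) → ℂ)
    (c : ι → ℂ) (z : ι) :
    ∑ i : Fin M → ι, (∏ a, c (i a)) * tOf T h (Fin.snoc i z) =
      ∑ j : Fin (2 * M) → ι, cocycle T h (Fin.snoc j z) *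
        ∏ a, brackForm (X T) (∑ i, c i • X T i) (j (fstIdx a)) (j (sndIdx a)) := by
  classical
  simp only [tOf, Fin.snoc_last, Fin.snoc_castSucc, Finset.mul_sum]
  rw [Finset.sum_comm]
  refine Finset.sum_congr rfl fun j _ => ?_
  simp only [← sum_mul_f, Finset.prod_univ_sum, Fintype.piFinset_univ, Finset.mul_sum]
  refine Finset.sum_congr rfl fun i _ => ?_
  rw [Finset.prod_mul_distrib]
  ring

/-- Relabelling the summation indices moves the permutation from the trace to the forms as its
inverse, which has the same sign. -/
theorem sum_tOf_kTensor {T : ι → Matrix (Fin n) (Fin n) ℂ}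
    (hc : ∀ i j, X T i * X T j - X T j * X T i = ∑ k, f T i j k • X T k) (M : ℕ) (c : ι → ℂ) (z : ι) :
    ∑ i : Fin M → ι, (∏ a, c (i a)) * tOf T (kTensor T (M + 1)) (Fin.snoc i z) =
      2 ^ M / ((2 * M).factorial : ℂ) * pairSum (X T) M (∑ i, c i • X T i) (X T z) := by
  rw [sum_tOf_eq, pairSum]
  simp only [cocycle_kTensor_snoc hc, mul_assoc, ← Finset.mul_sum]
  congr 1
  simp only [Finset.mul_sum, Finset.sum_mul]
  rw [Finset.sum_comm]
  conv_rhs => rw [Finset.sum_comm, ← Equiv.sum_comp (Equiv.inv _)]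
  refine Finset.sum_congr rfl fun e _ => ?_
  rw [← Equiv.sum_comp (e.arrowCongr (Equiv.refl ι))]
  refine Finset.sum_congr rfl fun k _ => ?_
  simp only [Equiv.inv_apply, Equiv.Perm.sign_inv, Equiv.arrowCongr_apply, Equiv.refl_apply,
    Function.comp, Equiv.symm_apply_apply]
  rw [mul_left_comm, mul_assoc]
  rfl

end CocycleTrace

end
end SuN
namespace SuN
noncomputable section

/-! ### Symmetric tensors as polynomials. -/

section Polarization

variable {ι : Type*} [Fintype ι]

omit [Fintype ι] in
-- Equal exponent vectors mean that the fibres of `i` and `j` have equal cardinalities; bijections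
-- between fibres glue to a permutation.
theorem exists_perm_of_sum_single_eq {M : ℕ} {i j : Fin M → ι}
    (h : ∑ a, Finsupp.single (i a) 1 = ∑ a, Finsupp.single (j a) (1 : ℕ)) :
    ∃ e : Equiv.Perm (Fin M), ∀ a, i a = j (e a) := by
  classical
  have hc (k : ι) : Fintype.card {a // i a = k} = Fintype.card {a // j a = k} := by
    have := DFunLike.congr_fun h k
    simpa [Finsupp.finsetSum_apply, Finsupp.single_apply, Fintype.card_subtype] using this
  refine ⟨(Equiv.sigmaFiberEquiv i).symm.trans
    ((Equiv.sigmaCongrRight fun k => Fintype.equivOfCardEq (hc k)).trans (Equiv.sigmaFiberEquiv j)),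
    fun a => ?_⟩
  exact (Fintype.equivOfCardEq (hc (i a)) ⟨a, rfl⟩).2.symm

/-- A symmetric tensor is determined by the homogeneous polynomial attached to it. -/
theorem eq_zero_of_polynomial_eq_zero {M : ℕ} {F : (Fin M → ι) → ℂ}
    (hF : ∀ (e : Equiv.Perm (Fin M)) i, F (fun a => i (e a)) = F i)
    (h : ∀ c : ι → ℂ, ∑ i, (∏ a, c (i a)) * F i = 0) (i : Fin M → ι) : F i = 0 := by
  classical
  let P : MvPolynomial ι ℂ := ∑ i : Fin M → ι, MvPolynomial.monomial (∑ a, Finsupp.single (i a) 1) (F i)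
  have hP : P = 0 := by
    refine MvPolynomial.funext fun c => ?_
    rw [map_zero, ← h c, map_sum]
    refine Finset.sum_congr rfl fun i _ => ?_
    rw [MvPolynomial.eval_monomial, mul_comm, ← Finsupp.prod_finsetSum_index (by simp) (by simp [pow_add])]
    simp
  have h1 := congrArg (MvPolynomial.coeff (∑ a, Finsupp.single (i a) 1)) hP
  simp only [P, MvPolynomial.coeff_sum, MvPolynomial.coeff_monomial, MvPolynomial.coeff_zero] at h1
  have h2 (j : Fin M → ι) : (if ∑ a, Finsupp.single (j a) 1 = ∑ a, Finsupp.single (i a) (1 : ℕ)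
      then F j else 0) = if ∑ a, Finsupp.single (j a) 1 = ∑ a, Finsupp.single (i a) (1 : ℕ)
      then F i else 0 := by
    split_ifs with hj
    · obtain ⟨e, he⟩ := exists_perm_of_sum_single_eq hj
      rw [← hF e i]
      exact congrArg F (funext he)
    · rfl
  simp only [h2] at h1
  -- The coefficient of the monomial is `F i` times the number of rearrangements of `i`, which is
  -- positive because `i` is one of them.
  rw [← Finset.sum_filter, Finset.sum_const, nsmul_eq_mul, mul_eq_zero, Nat.cast_eq_zero,
    Finset.card_eq_zero] at h1
  refine h1.resolve_left fun h3 => ?_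
  have : i ∈ Finset.univ.filter fun j : Fin M → ι =>
      ∑ a, Finsupp.single (j a) 1 = ∑ a, Finsupp.single (i a) (1 : ℕ) := by simp
  rw [h3] at this
  simp at this

/-- The last index is kept fixed, so that symmetry in the first M indices suffices. -/
theorem eq_of_polynomial_eq {M : ℕ} {F G : (Fin (M + 1) → ι) → ℂ}
    (hF : ∀ (e : Equiv.Perm (Fin M)) i z,
      F (Fin.snoc (fun a => i (e a)) z) = F (Fin.snoc i z))
    (hG : ∀ (e : Equiv.Perm (Fin M)) i z,
      G (Fin.snoc (fun a => i (e a)) z) = G (Fin.snoc i z))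
    (h : ∀ (c : ι → ℂ) z, ∑ i, (∏ a, c (i a)) * F (Fin.snoc i z) =
      ∑ i, (∏ a, c (i a)) * G (Fin.snoc i z)) (i : Fin (M + 1) → ι) : F i = G i := by
  have := eq_zero_of_polynomial_eq_zero (F := fun j => F (Fin.snoc j (i (Fin.last M))) -
    G (Fin.snoc j (i (Fin.last M)))) (fun e j => by rw [hF, hG])
    (fun c => by simp only [mul_sub, Finset.sum_sub_distrib, h, sub_self]) fun a => i a.castSucc
  have hi : (Fin.snoc (fun a : Fin M => i a.castSucc) (i (Fin.last M)) : Fin (M + 1) → ι) = i :=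
    Fin.snoc_init_self i
  rw [hi] at this
  exact sub_eq_zero.1 this

/-- The evaluation of a tensor on vectors. -/
def evalTensor {m : ℕ} (v : Fin m → ι → ℂ) (h : (Fin m → ι) → ℂ) : ℂ := ∑ i, (∏ a, v a (i a)) * h i

theorem evalTensor_comp_perm {m : ℕ} (v : Fin m → ι → ℂ) (h : (Fin m → ι) → ℂ)
    (σ : Equiv.Perm (Fin m)) :
    evalTensor v (fun i => h fun a => i (σ a)) = evalTensor (fun a => v (σ a)) h := by
  rw [evalTensor, evalTensor, ← Equiv.sum_comp (σ.arrowCongr (Equiv.refl ι))]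
  refine Finset.sum_congr rfl fun i _ => ?_
  rw [← Equiv.prod_comp σ]
  simp [Equiv.arrowCongr]

theorem sum_perm_apply {m : ℕ} (Φ : Fin (m + 1) → ℂ) (q : Fin (m + 1)) :
    ∑ σ : Equiv.Perm (Fin (m + 1)), Φ (σ⁻¹ q) = (m.factorial : ℂ) * ∑ p, Φ p := by
  -- After inversion and right multiplication by the swap of `0` and `q`, the argument becomes `σ
  -- 0`. Each of its values is taken by m! permutations.
  rw [← Equiv.sum_comp (Equiv.inv _), ← Equiv.sum_comp (Equiv.mulRight (Equiv.swap 0 q)),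
    ← Equiv.Perm.decomposeFin.symm.sum_comp, Fintype.sum_prod_type, Finset.mul_sum]
  refine Finset.sum_congr rfl fun p _ => ?_
  simp [Fintype.card_perm]

theorem sum_mul_snoc [DecidableEq ι] {m : ℕ} (G : (Fin (m + 1) → ι) → ℂ) (c : ι → ℂ) (z : ι) :
    ∑ i : Fin m → ι, (∏ a, c (i a)) * G (Fin.snoc i z) =
    evalTensor (Function.update (fun _ => c) (Fin.last m) (Pi.single z 1)) G := by
  rw [evalTensor, ← (Fin.snocEquiv fun _ => ι).sum_comp, Fintype.sum_prod_type,
    Finset.sum_eq_single z]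
  · refine Finset.sum_congr rfl fun i _ => ?_
    rw [Fin.prod_univ_castSucc]
    simp [Fin.snocEquiv]
  · intro a _ ha
    refine Finset.sum_eq_zero fun i _ => ?_
    rw [Fin.prod_univ_castSucc]
    simp [Fin.snocEquiv, ha]
  · simp

/-- With all other arguments equal to `c`, a permutation matters only through the position it gives
to the basis vector. Symmetrisation is then an average over m + 1 positions. -/
theorem sum_mul_symmetrize_snoc [DecidableEq ι] {m : ℕ} (h : (Fin (m + 1) → ι) → ℂ) (c : ι → ℂ) (z : ι) :
    ∑ i : Fin m → ι, (∏ a, c (i a)) * symmetrize h (Fin.snoc i z) =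
      (1 / (m + 1 : ℂ)) * ∑ p, evalTensor (Function.update (fun _ => c) p (Pi.single z 1)) h := by
  have h2 (v : Fin (m + 1) → ι → ℂ) : evalTensor v (symmetrize h) =
      (1 / ((m + 1).factorial : ℂ)) * ∑ σ : Equiv.Perm (Fin (m + 1)), evalTensor (fun a => v (σ a)) h := by
    have (σ : Equiv.Perm (Fin (m + 1))) := (evalTensor_comp_perm v h σ).symm
    simp only [this]
    simp only [evalTensor, symmetrize, Finset.mul_sum]
    rw [Finset.sum_comm]
    exact Finset.sum_congr rfl fun i _ => Finset.sum_congr rfl fun σ _ => by ring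
  have h3 (σ : Equiv.Perm (Fin (m + 1))) (w : ι → ℂ) :
      (fun a => Function.update (fun _ => c) (Fin.last m) w (σ a)) =
        Function.update (fun _ => c) (σ⁻¹ (Fin.last m)) w := by
    funext a
    by_cases ha : σ a = Fin.last m
    · have : a = σ⁻¹ (Fin.last m) := by rw [← ha]; simp
      rw [← this, ha]
      simp
    · have : a ≠ σ⁻¹ (Fin.last m) := by
        rintro rfl
        exact ha (by simp)
      rw [Function.update_of_ne ha, Function.update_of_ne this]
  rw [sum_mul_snoc, h2]
  simp only [h3]
  rw [sum_perm_apply fun p => evalTensor (Function.update (fun _ => c) p (Pi.single z 1)) h,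
    Nat.factorial_succ, ← mul_assoc]
  congr 1
  have e1 : (m.factorial : ℂ) ≠ 0 := by exact_mod_cast m.factorial_ne_zero
  have e2 : (m + 1 : ℂ) ≠ 0 := by exact_mod_cast m.succ_ne_zero
  push_cast
  field_simp

omit [Fintype ι] in
theorem symmetrize_comp_perm {m : ℕ} (h : (Fin m → ι) → ℂ) (i : Fin m → ι) (e : Equiv.Perm (Fin m)) :
    symmetrize h (fun a => i (e a)) = symmetrize h i := by
  rw [symmetrize, symmetrize]
  congr 1
  rw [← Equiv.sum_comp (Equiv.mulLeft e⁻¹)]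
  simp

omit [Fintype ι] in
theorem symmetrize_snoc_comp_perm {m : ℕ} (h : (Fin (m + 1) → ι) → ℂ) (e : Equiv.Perm (Fin m))
    (i : Fin m → ι) (z : ι) :
    symmetrize h (Fin.snoc (fun a => i (e a)) z) = symmetrize h (Fin.snoc i z) := by
  rw [← snoc_comp_liftPerm, symmetrize_comp_perm]

theorem sum_fin_succ {m : ℕ} (G : (Fin (m + 1) → ι) → ℂ) :
    ∑ i, G i = ∑ a, ∑ i : Fin m → ι, G (Fin.cons a i) := by
  rw [← (Fin.consEquiv fun _ => ι).sum_comp, Fintype.sum_prod_type]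
  rfl

end Polarization

/-! ### Evaluation of the d-family and of the Kronecker tensors on vectors. -/

section Tensors

variable {n : ℕ}

/-- The expansion in the `T k`; the factor (-i)² = -1 accounts for the sign in `IsComplete`. -/
theorem isComplete_X {T : Fin (n ^ 2 - 1) → Matrix (Fin n) (Fin n) ℂ} (hn : 0 < n)
    (hT : IsGenerators T) : IsComplete (X T) := by
  intro A
  have h := expand hn hT A
  have h1 : A - (A.trace / n) • (1 : Matrix (Fin n) (Fin n) ℂ) = ∑ k, (2 * (A * T k).trace) • T k :=
    sub_eq_iff_eq_add'.2 h
  rw [h1, Finset.smul_sum]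
  refine Finset.sum_congr rfl fun k _ => ?_
  simp only [X, Matrix.mul_smul, Matrix.trace_smul, smul_smul, smul_eq_mul]
  congr 1
  linear_combination ((A * T k).trace) * Complex.I_mul_I

/-- The matrix with given coordinates. -/
def combo {ι : Type*} [Fintype ι] (T : ι → Matrix (Fin n) (Fin n) ℂ) (v : ι → ℂ) :
    Matrix (Fin n) (Fin n) ℂ := ∑ i, v i • T i

/-- The anticommutator. -/
def anti (A B : Matrix (Fin n) (Fin n) ℂ) : Matrix (Fin n) (Fin n) ℂ := A * B + B * A

variable {T : Fin (n ^ 2 - 1) → Matrix (Fin n) (Fin n) ℂ}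

/-- Completeness in the form that removes a contracted internal index: two traces are joined, up to
a 1/n term. -/
theorem sum_trace_mul_trace (hn : 0 < n) (hT : IsGenerators T) (A B : Matrix (Fin n) (Fin n) ℂ) :
    ∑ j, (A * T j).trace * (B * T j).trace = 1 / 2 * ((A * B).trace - A.trace * B.trace / n) := by
  have h := congrArg (fun Z => (Z * B).trace) (expand hn hT A)
  simp only [Matrix.add_mul, Matrix.smul_mul, Matrix.one_mul, Matrix.trace_add, Matrix.trace_smul,
    Finset.sum_mul, Matrix.trace_sum, smul_eq_mul, mul_assoc, ← Finset.mul_sum] at h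
  rw [h]
  simp only [Matrix.trace_mul_comm (T _) B]
  ring

theorem d_eq (T : Fin (n ^ 2 - 1) → Matrix (Fin n) (Fin n) ℂ) (i j k : Fin (n ^ 2 - 1)) :
    d T i j k = 2 * (anti (T i) (T j) * T k).trace := rfl

theorem trace_anti_mul (A B C : Matrix (Fin n) (Fin n) ℂ) :
    (anti A B * C).trace = (anti B C * A).trace := by
  simp only [anti, Matrix.add_mul, Matrix.trace_add]
  rw [Matrix.trace_mul_cycle B C A, Matrix.trace_mul_cycle B A C]

theorem sum_sum_d (u v : Fin (n ^ 2 - 1) → ℂ) (j : Fin (n ^ 2 - 1)) :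
    ∑ a, ∑ b, u a * v b * d T a b j = 2 * (anti (combo T u) (combo T v) * T j).trace := by
  simp only [d_eq, anti, combo, Matrix.add_mul, Finset.sum_mul, Finset.mul_sum, Matrix.trace_add, Matrix.trace_sum,
    Matrix.smul_mul, Matrix.mul_smul, Matrix.trace_smul, smul_eq_mul, mul_add, Finset.sum_add_distrib]
  congr 1
  · rw [Finset.sum_comm]
    exact Finset.sum_congr rfl fun a _ => Finset.sum_congr rfl fun b _ => by ring
  · exact Finset.sum_congr rfl fun a _ => Finset.sum_congr rfl fun b _ => by ring

theorem d_cycle (T : Fin (n ^ 2 - 1) → Matrix (Fin n) (Fin n) ℂ) (i j k : Fin (n ^ 2 - 1)) :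
    d T i j k = d T j k i := by
  rw [d_eq, d_eq, trace_anti_mul]

theorem sum_sum_d' (u v : Fin (n ^ 2 - 1) → ℂ) (j : Fin (n ^ 2 - 1)) :
    ∑ a, ∑ b, u a * v b * d T j a b = 2 * (anti (combo T u) (combo T v) * T j).trace := by
  simp only [d_cycle T j, sum_sum_d]

theorem sum_d (w : Fin (n ^ 2 - 1) → ℂ) (k j : Fin (n ^ 2 - 1)) :
    ∑ c, w c * d T k c j = 2 * (anti (combo T w) (T j) * T k).trace := by
  simp only [d_cycle T k, d_eq, combo, anti, Matrix.add_mul, Finset.sum_mul, Finset.mul_sum, Matrix.trace_add, Matrix.trace_sum,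
    Matrix.smul_mul, Matrix.mul_smul, Matrix.trace_smul, smul_eq_mul, mul_add, Finset.sum_add_distrib]
  congr 1 <;> exact Finset.sum_congr rfl fun a _ => by ring

theorem trace_anti (A B : Matrix (Fin n) (Fin n) ℂ) : (anti A B).trace = 2 * (A * B).trace := by
  rw [anti, Matrix.trace_add, Matrix.trace_mul_comm B A]
  ring

theorem sum_sum_delta (hT : IsGenerators T) (u v : Fin (n ^ 2 - 1) → ℂ) :
    ∑ a, ∑ b, u a * v b * delta a b = 2 * (combo T u * combo T v).trace := by
  simp only [combo, Finset.sum_mul, Finset.mul_sum, Matrix.trace_sum,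
    Matrix.smul_mul, Matrix.mul_smul, Matrix.trace_smul, smul_eq_mul, hT.trace_mul, delta]
  rw [Finset.sum_comm]
  refine Finset.sum_congr rfl fun a _ => Finset.sum_congr rfl fun b _ => ?_
  by_cases h : a = b
  · subst h; simp; ring
  · simp [Ne.symm h]

theorem dTensor_two (a b c e : Fin (n ^ 2 - 1)) (w : Fin 0 → Fin (n ^ 2 - 1)) :
    dTensor T 2 (Fin.cons a (Fin.cons b (Fin.cons c (Fin.cons e w)))) = ∑ j, d T a b j * d T j c e := by
  rw [dTensor]
  simp only [dTensor_one]
  rfl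

theorem dTensor_three (a b c e g : Fin (n ^ 2 - 1)) (w : Fin 0 → Fin (n ^ 2 - 1)) :
    dTensor T 3 (Fin.cons a (Fin.cons b (Fin.cons c (Fin.cons e (Fin.cons g w))))) =
      ∑ j, (∑ k, d T a b k * d T k c j) * d T j e g := by
  rw [dTensor]
  refine Finset.sum_congr rfl fun j _ => ?_
  congr 1
  exact dTensor_two a b c j w

theorem evalTensor_dTensor_two (hn : 0 < n) (hT : IsGenerators T) (v : Fin 4 → Fin (n ^ 2 - 1) → ℂ) :
    evalTensor v (dTensor T 2) =
      2 * ((anti (combo T (v 0)) (combo T (v 1)) * anti (combo T (v 2)) (combo T (v 3))).trace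
        - (anti (combo T (v 0)) (combo T (v 1))).trace * (anti (combo T (v 2)) (combo T (v 3))).trace / n) := by
  have h : evalTensor v (dTensor T 2) = ∑ j, (∑ c, ∑ e, v 2 c * v 3 e * d T j c e) *
      (∑ a, ∑ b, v 0 a * v 1 b * d T a b j) := by
    simp only [evalTensor, sum_fin_succ, Finset.univ_unique, Finset.sum_singleton, dTensor_two]
    simp only [Finset.sum_mul, Finset.mul_sum]
    conv_rhs => rw [Finset.sum_comm]
    refine Finset.sum_congr rfl fun a _ => ?_
    conv_rhs => rw [Finset.sum_comm]
    refine Finset.sum_congr rfl fun b _ => ?_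
    conv_rhs => rw [Finset.sum_comm]
    refine Finset.sum_congr rfl fun c _ => ?_
    conv_rhs => rw [Finset.sum_comm]
    refine Finset.sum_congr rfl fun e _ => Finset.sum_congr rfl fun j _ => ?_
    simp only [Fin.prod_univ_succ, Finset.univ_unique, Finset.prod_singleton, Fin.cons_succ, Fin.cons_zero]
    simp
    ring
  rw [h]
  simp only [sum_sum_d, sum_sum_d']
  have := sum_trace_mul_trace hn hT (anti (combo T (v 0)) (combo T (v 1))) (anti (combo T (v 2)) (combo T (v 3)))
  calc _ = 4 * ∑ j, (anti (combo T (v 0)) (combo T (v 1)) * T j).trace *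
      (anti (combo T (v 2)) (combo T (v 3)) * T j).trace := by
        rw [Finset.mul_sum]; exact Finset.sum_congr rfl fun j _ => by ring
    _ = _ := by rw [this]; ring

/-- There are two internal indices, removed one after the other by `sum_trace_mul_trace`. Each
removal leaves a 1/n correction. -/
theorem evalTensor_dTensor_three (hn : 0 < n) (hT : IsGenerators T) (v : Fin 5 → Fin (n ^ 2 - 1) → ℂ) :
    evalTensor v (dTensor T 3) =
      2 * (anti (anti (combo T (v 0)) (combo T (v 1))) (combo T (v 2)) *
          anti (combo T (v 3)) (combo T (v 4))).trace
        - 2 / n * ((anti (anti (combo T (v 0)) (combo T (v 1))) (combo T (v 2))).trace *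
          (anti (combo T (v 3)) (combo T (v 4))).trace)
        - 4 / n * ((anti (combo T (v 0)) (combo T (v 1))).trace *
          ((combo T (v 2) * anti (combo T (v 3)) (combo T (v 4))).trace
            - (combo T (v 2)).trace * (anti (combo T (v 3)) (combo T (v 4))).trace / n)) := by
  have h : evalTensor v (dTensor T 3) = ∑ j, (∑ e, ∑ g, v 3 e * v 4 g * d T j e g) *
      (∑ k, (∑ c, v 2 c * d T k c j) * (∑ a, ∑ b, v 0 a * v 1 b * d T a b k)) := by
    simp only [evalTensor, sum_fin_succ, Finset.univ_unique, Finset.sum_singleton, dTensor_three]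
    simp only [Finset.sum_mul, Finset.mul_sum]
    have hjk (G : Fin (n ^ 2 - 1) → Fin (n ^ 2 - 1) → Fin (n ^ 2 - 1) → ℂ) :
      ∑ j, ∑ k, ∑ a, G j k a = ∑ a, ∑ j, ∑ k, G j k a := by
      conv_rhs => rw [Finset.sum_comm]
      exact Finset.sum_congr rfl fun j _ => Finset.sum_comm
    conv_rhs => rw [hjk]
    refine Finset.sum_congr rfl fun a _ => ?_
    conv_rhs => rw [hjk]
    refine Finset.sum_congr rfl fun b _ => ?_
    conv_rhs => rw [hjk]
    refine Finset.sum_congr rfl fun c _ => ?_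
    conv_rhs => rw [hjk]
    refine Finset.sum_congr rfl fun e _ => ?_
    conv_rhs => rw [hjk]
    refine Finset.sum_congr rfl fun g _ => Finset.sum_congr rfl fun j _ =>
      Finset.sum_congr rfl fun k _ => ?_
    simp only [Fin.prod_univ_succ, Finset.univ_unique, Finset.prod_singleton, Fin.cons_succ, Fin.cons_zero]
    simp
    ring
  rw [h]
  simp only [sum_sum_d, sum_sum_d']
  simp only [sum_d]
  generalize hA : anti (combo T (v 0)) (combo T (v 1)) = A
  generalize hB : anti (combo T (v 3)) (combo T (v 4)) = B
  generalize combo T (v 2) = W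
  have h1 (j : Fin (n ^ 2 - 1)) : ∑ k, 2 * (anti W (T j) * T k).trace * (2 * (A * T k).trace) =
      2 * ((anti A W * T j).trace - A.trace * (2 * (W * T j).trace) / n) := by
    calc _ = 4 * ∑ k, (anti W (T j) * T k).trace * (A * T k).trace := by
          rw [Finset.mul_sum]; exact Finset.sum_congr rfl fun j _ => by ring
      _ = _ := by
        rw [sum_trace_mul_trace hn hT, trace_anti, ← trace_anti_mul A W]
        ring
  simp only [h1]
  calc _ = 4 * ∑ j, (anti A W * T j).trace * (B * T j).trace
        - 8 / n * A.trace * ∑ j, (W * T j).trace * (B * T j).trace := by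
        rw [Finset.mul_sum, Finset.mul_sum, ← Finset.sum_sub_distrib]
        exact Finset.sum_congr rfl fun j _ => by ring
    _ = _ := by rw [sum_trace_mul_trace hn hT, sum_trace_mul_trace hn hT]; ring

theorem evalTensor_delta_delta (hT : IsGenerators T) (v : Fin 4 → Fin (n ^ 2 - 1) → ℂ) :
    evalTensor v (fun i => delta (i 0) (i 1) * delta (i 2) (i 3)) =
      4 * ((combo T (v 0) * combo T (v 1)).trace * (combo T (v 2) * combo T (v 3)).trace) := by
  have h : evalTensor v (fun i => delta (i 0) (i 1) * delta (i 2) (i 3)) =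
      (∑ c, ∑ e, v 2 c * v 3 e * delta c e) * (∑ a, ∑ b, v 0 a * v 1 b * delta a b) := by
    simp only [evalTensor, sum_fin_succ, Finset.univ_unique, Finset.sum_singleton]
    simp only [Finset.sum_mul, Finset.mul_sum]
    refine Finset.sum_congr rfl fun a _ => Finset.sum_congr rfl fun b _ => Finset.sum_congr rfl fun c _ =>
      Finset.sum_congr rfl fun e _ => ?_
    simp only [Fin.prod_univ_succ, Finset.univ_unique, Finset.prod_singleton, Fin.cons_succ, Fin.cons_zero]
    have h1 : (Fin.cons a (Fin.cons b (Fin.cons c (Fin.cons e default))) : Fin 4 → Fin (n ^ 2 - 1)) 1 = b := rfl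
    have h2 : (Fin.cons a (Fin.cons b (Fin.cons c (Fin.cons e default))) : Fin 4 → Fin (n ^ 2 - 1)) 2 = c := rfl
    have h3 : (Fin.cons a (Fin.cons b (Fin.cons c (Fin.cons e default))) : Fin 4 → Fin (n ^ 2 - 1)) 3 = e := rfl
    rw [h1, h2, h3]
    simp
    ring
  rw [h, sum_sum_delta hT, sum_sum_delta hT]
  ring

theorem evalTensor_d_delta (hT : IsGenerators T) (v : Fin 5 → Fin (n ^ 2 - 1) → ℂ) :
    evalTensor v (fun i => d T (i 0) (i 1) (i 2) * delta (i 3) (i 4)) =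
      4 * ((anti (combo T (v 0)) (combo T (v 1)) * combo T (v 2)).trace *
        (combo T (v 3) * combo T (v 4)).trace) := by
  have h : evalTensor v (fun i => d T (i 0) (i 1) (i 2) * delta (i 3) (i 4)) =
      (∑ c, ∑ e, v 3 c * v 4 e * delta c e) * (∑ j, v 2 j * ∑ a, ∑ b, v 0 a * v 1 b * d T a b j) := by
    simp only [evalTensor, sum_fin_succ, Finset.univ_unique, Finset.sum_singleton]
    simp only [Finset.sum_mul, Finset.mul_sum]
    conv_rhs => rw [Finset.sum_comm]
    refine Finset.sum_congr rfl fun a _ => ?_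
    conv_rhs => rw [Finset.sum_comm]
    refine Finset.sum_congr rfl fun b _ => Finset.sum_congr rfl fun j _ => Finset.sum_congr rfl fun e _ =>
      Finset.sum_congr rfl fun g _ => ?_
    have h1 : (Fin.cons a (Fin.cons b (Fin.cons j (Fin.cons e (Fin.cons g default)))) :
      Fin 5 → Fin (n ^ 2 - 1)) 1 = b := rfl
    have h2 : (Fin.cons a (Fin.cons b (Fin.cons j (Fin.cons e (Fin.cons g default)))) :
      Fin 5 → Fin (n ^ 2 - 1)) 2 = j := rfl
    have h3 : (Fin.cons a (Fin.cons b (Fin.cons j (Fin.cons e (Fin.cons g default)))) :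
      Fin 5 → Fin (n ^ 2 - 1)) 3 = e := rfl
    have h4 : (Fin.cons a (Fin.cons b (Fin.cons j (Fin.cons e (Fin.cons g default)))) :
      Fin 5 → Fin (n ^ 2 - 1)) 4 = g := rfl
    rw [h1, h2, h3, h4]
    simp only [Fin.prod_univ_succ, Finset.univ_unique, Finset.prod_singleton, Fin.cons_succ, Fin.cons_zero]
    simp
    ring
  rw [h, sum_sum_delta hT]
  simp only [sum_sum_d]
  have : ∑ j, v 2 j * (2 * (anti (combo T (v 0)) (combo T (v 1)) * T j).trace) =
      2 * (anti (combo T (v 0)) (combo T (v 1)) * combo T (v 2)).trace := by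
    conv_rhs => rw [combo.eq_1 T (v 2)]
    rw [Finset.mul_sum, Matrix.trace_sum, Finset.mul_sum]
    refine Finset.sum_congr rfl fun j _ => ?_
    rw [Matrix.mul_smul, Matrix.trace_smul, smul_eq_mul]
    ring
  rw [this]
  ring

theorem evalTensor_d (v : Fin 3 → Fin (n ^ 2 - 1) → ℂ) :
    evalTensor v (dTensor T 1) = 2 * (anti (combo T (v 0)) (combo T (v 1)) * combo T (v 2)).trace := by
  have h : evalTensor v (dTensor T 1) = ∑ j, v 2 j * ∑ a, ∑ b, v 0 a * v 1 b * d T a b j := by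
    simp only [evalTensor, sum_fin_succ, Finset.univ_unique, Finset.sum_singleton]
    simp only [Finset.mul_sum, dTensor_one]
    conv_rhs => rw [Finset.sum_comm]
    refine Finset.sum_congr rfl fun a _ => ?_
    conv_rhs => rw [Finset.sum_comm]
    refine Finset.sum_congr rfl fun b _ => Finset.sum_congr rfl fun j _ => ?_
    have h1 : (Fin.cons a (Fin.cons b (Fin.cons j default)) : Fin 3 → Fin (n ^ 2 - 1)) 1 = b := rfl
    have h2 : (Fin.cons a (Fin.cons b (Fin.cons j default)) : Fin 3 → Fin (n ^ 2 - 1)) 2 = j := rfl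
    rw [h1, h2]
    simp only [Fin.prod_univ_succ, Finset.univ_unique, Finset.prod_singleton, Fin.cons_succ, Fin.cons_zero]
    simp
    ring
  rw [h]
  simp only [sum_sum_d]
  conv_rhs => rw [combo.eq_1 T (v 2)]
  rw [Finset.mul_sum, Matrix.trace_sum, Finset.mul_sum]
  refine Finset.sum_congr rfl fun j _ => ?_
  rw [Matrix.mul_smul, Matrix.trace_smul, smul_eq_mul]
  ring

theorem combo_single (T : Fin (n ^ 2 - 1) → Matrix (Fin n) (Fin n) ℂ) (z : Fin (n ^ 2 - 1)) :
    combo T (Pi.single z 1) = T z := by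
  simp [combo, Pi.single_apply]

theorem combo_trace (hT : IsGenerators T) (c : Fin (n ^ 2 - 1) → ℂ) : (combo T c).trace = 0 := by
  simp [combo, Matrix.trace_sum, hT.trace_eq_zero]

theorem sum_smul_X (T : Fin (n ^ 2 - 1) → Matrix (Fin n) (Fin n) ℂ) (c : Fin (n ^ 2 - 1) → ℂ) :
    ∑ i, c i • X T i = (-Complex.I) • combo T c := by
  rw [combo, Finset.smul_sum]
  exact Finset.sum_congr rfl fun i _ => smul_comm _ _ _

variable (x y : Matrix (Fin n) (Fin n) ℂ)

/-- Cyclicity: a word with a single `y` depends only on the number of `x`s. The word lemmas below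
provide the shapes met in the expansions. -/
theorem trace_pow_mul_comm (k l : ℕ) : (x ^ k * (y * x ^ l)).trace = (x ^ (k + l) * y).trace := by
  rw [← Matrix.mul_assoc, Matrix.trace_mul_comm, ← Matrix.mul_assoc, add_comm, pow_add]

theorem trace_word_three : (x * (y * x)).trace = (x ^ 2 * y).trace ∧ (y * (x * x)).trace = (x ^ 2 * y).trace ∧
    (x * (x * y)).trace = (x ^ 2 * y).trace := by
  refine ⟨?_, ?_, ?_⟩
  · simpa using trace_pow_mul_comm x y 1 1
  · simpa [pow_two] using trace_pow_mul_comm x y 0 2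
  · simp [pow_two, mul_assoc]

theorem trace_word_four : (x * (x * (y * x))).trace = (x ^ 3 * y).trace ∧
    (x * (y * (x * x))).trace = (x ^ 3 * y).trace ∧ (y * (x * (x * x))).trace = (x ^ 3 * y).trace ∧
    (x * (x * (x * y))).trace = (x ^ 3 * y).trace := by
  refine ⟨?_, ?_, ?_, ?_⟩
  · simpa [pow_succ, mul_assoc] using trace_pow_mul_comm x y 2 1
  · simpa [pow_succ, mul_assoc] using trace_pow_mul_comm x y 1 2
  · simpa [pow_succ, mul_assoc] using trace_pow_mul_comm x y 0 3
  · simp [pow_succ, mul_assoc]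

theorem trace_word_five : (x * (x * (x * (y * x)))).trace = (x ^ 4 * y).trace ∧
    (x * (x * (y * (x * x)))).trace = (x ^ 4 * y).trace ∧ (x * (y * (x * (x * x)))).trace = (x ^ 4 * y).trace ∧
    (y * (x * (x * (x * x)))).trace = (x ^ 4 * y).trace ∧ (x * (x * (x * (x * y)))).trace = (x ^ 4 * y).trace := by
  refine ⟨?_, ?_, ?_, ?_, ?_⟩
  · simpa [pow_succ, mul_assoc] using trace_pow_mul_comm x y 3 1
  · simpa [pow_succ, mul_assoc] using trace_pow_mul_comm x y 2 2
  · simpa [pow_succ, mul_assoc] using trace_pow_mul_comm x y 1 3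
  · simpa [pow_succ, mul_assoc] using trace_pow_mul_comm x y 0 4
  · simp [pow_succ, mul_assoc]

end Tensors

/-! ### Polynomials of the reference tensors. -/

section Polynomials

variable {n : ℕ} {T : Fin (n ^ 2 - 1) → Matrix (Fin n) (Fin n) ℂ}

theorem sum_mul_d4 (hn : 0 < n) (hT : IsGenerators T) (c : Fin (n ^ 2 - 1) → ℂ) (z : Fin (n ^ 2 - 1)) :
    ∑ i : Fin 3 → Fin (n ^ 2 - 1), (∏ a, c (i a)) * d4 T (Fin.snoc i z) =
      8 * ((combo T c ^ 3 * T z).trace - (combo T c ^ 2).trace * (combo T c * T z).trace / n) := by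
  refine (sum_mul_symmetrize_snoc (m := 3) (dTensor T 2) c z).trans
    ((congrArg _ (Fin.sum_univ_four _)).trans ?_)
  simp only [evalTensor_dTensor_two hn hT]
  obtain ⟨h1, h2, h3, h4⟩ := trace_word_four (combo T c) (T z)
  have hc := Matrix.trace_mul_comm (T z) (combo T c)
  simp [Function.update, combo_single, anti, mul_add, add_mul, mul_assoc, h1, h2, h3, h4, hc, pow_two]
  ring

theorem sum_mul_deltaDelta (hT : IsGenerators T) (c : Fin (n ^ 2 - 1) → ℂ) (z : Fin (n ^ 2 - 1)) :
    ∑ i : Fin 3 → Fin (n ^ 2 - 1), (∏ a, c (i a)) * deltaDelta (Fin.snoc i z) =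
      4 * ((combo T c ^ 2).trace * (combo T c * T z).trace) := by
  refine (sum_mul_symmetrize_snoc (m := 3) (fun i => delta (i 0) (i 1) * delta (i 2) (i 3)) c z).trans
    ((congrArg _ (Fin.sum_univ_four _)).trans ?_)
  simp only [evalTensor_delta_delta hT]
  have hc := Matrix.trace_mul_comm (T z) (combo T c)
  simp [Function.update, combo_single, hc, pow_two]
  ring

/-- Averaging over the five positions of `T z` produces the fifths. The 1/n terms are the
corrections from the two internal indices; those containing Tr `combo T c` or Tr `T z` vanish. -/
theorem sum_mul_d5 (hn : 0 < n) (hT : IsGenerators T) (c : Fin (n ^ 2 - 1) → ℂ) (z : Fin (n ^ 2 - 1)) :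
    ∑ i : Fin 4 → Fin (n ^ 2 - 1), (∏ a, c (i a)) * d5 T (Fin.snoc i z) =
      16 * ((combo T c ^ 4 * T z).trace
        - 6 / (5 * n) * ((combo T c ^ 2).trace * (combo T c ^ 2 * T z).trace)
        - 4 / (5 * n) * ((combo T c ^ 3).trace * (combo T c * T z).trace)) := by
  refine (sum_mul_symmetrize_snoc (m := 4) (dTensor T 3) c z).trans
    ((congrArg _ (Fin.sum_univ_five _)).trans ?_)
  simp only [evalTensor_dTensor_three hn hT]
  obtain ⟨h1, h2, h3, h4, h5⟩ := trace_word_five (combo T c) (T z)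
  obtain ⟨g1, g2, g3⟩ := trace_word_three (combo T c) (T z)
  have hc := Matrix.trace_mul_comm (T z) (combo T c)
  have h0 := combo_trace hT c
  have p3 : combo T c ^ 3 = combo T c * (combo T c * combo T c) := pow_three _
  have p2 : (combo T c * combo T c) = combo T c ^ 2 := (pow_two _).symm
  simp [Function.update, combo_single, anti, mul_add, add_mul, mul_assoc, h1, h2, h3, h4, h5, g1, g2, g3,
    hc, h0, hT.trace_eq_zero, p3]
  simp [p2]
  ring

theorem sum_mul_dDelta (hT : IsGenerators T) (c : Fin (n ^ 2 - 1) → ℂ) (z : Fin (n ^ 2 - 1)) :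
    ∑ i : Fin 4 → Fin (n ^ 2 - 1), (∏ a, c (i a)) * dDelta T (Fin.snoc i z) =
      16 / 5 * ((combo T c ^ 3).trace * (combo T c * T z).trace) +
        24 / 5 * ((combo T c ^ 2).trace * (combo T c ^ 2 * T z).trace) := by
  refine (sum_mul_symmetrize_snoc (m := 4) (fun i => d T (i 0) (i 1) (i 2) * delta (i 3) (i 4)) c z).trans
    ((congrArg _ (Fin.sum_univ_five _)).trans ?_)
  simp only [evalTensor_d_delta hT]
  obtain ⟨g1, g2, g3⟩ := trace_word_three (combo T c) (T z)
  have hc := Matrix.trace_mul_comm (T z) (combo T c)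
  have p3 : combo T c ^ 3 = combo T c * (combo T c * combo T c) := pow_three _
  have p2 : (combo T c * combo T c) = combo T c ^ 2 := (pow_two _).symm
  simp [Function.update, combo_single, anti, add_mul, mul_assoc, g1, g2, g3, hc, p3]
  simp [p2]
  ring

end Polynomials

end
end SuN
namespace SuN
noncomputable section

/-! ### Explicit forms of the t-tensors. -/

section Evaluation

variable {n : ℕ} {T : Fin (n ^ 2 - 1) → Matrix (Fin n) (Fin n) ℂ}

theorem nonempty_index (hn : 2 ≤ n) : Nonempty (Fin (n ^ 2 - 1)) := by
  have : 2 * 2 ≤ n ^ 2 := by rw [pow_two]; exact Nat.mul_le_mul hn hn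
  exact ⟨⟨0, by omega⟩⟩

theorem trace_smul_pow_mul_smul (x y : Matrix (Fin n) (Fin n) ℂ) (r : ℂ) (k : ℕ) :
    ((r • x) ^ k * (r • y)).trace = r ^ (k + 1) * (x ^ k * y).trace := by
  rw [smul_pow, smul_mul_smul_comm, Matrix.trace_smul, pow_succ, smul_eq_mul]

theorem trace_smul_pow (x : Matrix (Fin n) (Fin n) ℂ) (r : ℂ) (k : ℕ) :
    ((r • x) ^ k).trace = r ^ k * (x ^ k).trace := by
  rw [smul_pow, Matrix.trace_smul, smul_eq_mul]

theorem trace_smul_mul_smul (x y : Matrix (Fin n) (Fin n) ℂ) (r : ℂ) :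
    ((r • x) * (r • y)).trace = r ^ 2 * (x * y).trace := by
  rw [smul_mul_smul_comm, Matrix.trace_smul, pow_two, smul_eq_mul]

theorem neg_I_pow : (-Complex.I) ^ 2 = -1 ∧ (-Complex.I) ^ 3 = Complex.I ∧ (-Complex.I) ^ 4 = 1 ∧
    (-Complex.I) ^ 5 = -Complex.I := by
  have h : (-Complex.I) ^ 2 = -1 := by rw [neg_sq, Complex.I_sq]
  refine ⟨h, ?_, ?_, ?_⟩
  · linear_combination (-Complex.I) * h
  · linear_combination ((-Complex.I) ^ 2 - 1) * h
  · linear_combination (-Complex.I) * ((-Complex.I) ^ 2 - 1) * h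

/-- The prefactor is 2³/6! · 3! = 1/15. The monomials have total degree 4 in the generators, so
passing from X to T contributes (-i)⁴ = 1. -/
theorem sum_mul_t4 (hn : 2 ≤ n) (hT : IsGenerators T) (c : Fin (n ^ 2 - 1) → ℂ) (z : Fin (n ^ 2 - 1)) :
    ∑ i : Fin 3 → Fin (n ^ 2 - 1), (∏ a, c (i a)) * t4 T (Fin.snoc i z) =
      1 / 15 * ((n : ℂ) * (n ^ 2 + 1) * (combo T c ^ 3 * T z).trace
        + (3 - 2 * n ^ 2) * ((combo T c ^ 2).trace * (combo T c * T z).trace)) := by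
  have := nonempty_index hn
  obtain ⟨i2, i3, i4, i5⟩ := neg_I_pow
  refine (sum_tOf_kTensor (commutator_X_eq (by omega) hT) 3 c z).trans ?_
  rw [sum_smul_X, X, (isComplete_X (by omega) hT).pairSum_three
    (by rw [Matrix.trace_smul, combo_trace hT, smul_zero])
    (by rw [Matrix.trace_smul, hT.trace_eq_zero, smul_zero]),
    trace_smul_pow_mul_smul, trace_smul_pow, trace_smul_mul_smul, i2, i4]
  norm_num [Nat.factorial]
  ring

/-- Here 2⁴/8! · 4! = 1/105, and the degree 5 contributes (-i)⁵ = -i. -/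
theorem sum_mul_t5 (hn : 2 ≤ n) (hT : IsGenerators T) (c : Fin (n ^ 2 - 1) → ℂ) (z : Fin (n ^ 2 - 1)) :
    ∑ i : Fin 4 → Fin (n ^ 2 - 1), (∏ a, c (i a)) * t5 T (Fin.snoc i z) =
      -Complex.I / 105 * ((n : ℂ) ^ 2 * (n ^ 2 + 5) * (combo T c ^ 4 * T z).trace
        + (6 * n - 3 * n ^ 3) * ((combo T c ^ 2).trace * (combo T c ^ 2 * T z).trace)
        + (4 * n - 2 * n ^ 3) * ((combo T c ^ 3).trace * (combo T c * T z).trace)) := by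
  have := nonempty_index hn
  obtain ⟨i2, i3, i4, i5⟩ := neg_I_pow
  refine (sum_tOf_kTensor (commutator_X_eq (by omega) hT) 4 c z).trans ?_
  rw [sum_smul_X, X, (isComplete_X (by omega) hT).pairSum_four
    (by rw [Matrix.trace_smul, combo_trace hT, smul_zero])
    (by rw [Matrix.trace_smul, hT.trace_eq_zero, smul_zero]),
    trace_smul_pow_mul_smul, trace_smul_pow_mul_smul, trace_smul_pow, trace_smul_pow, trace_smul_mul_smul,
    i2, i3, i5]
  norm_num [Nat.factorial]
  ring

theorem sum_mul_t3 (hn : 2 ≤ n) (hT : IsGenerators T) (c : Fin (n ^ 2 - 1) → ℂ) (z : Fin (n ^ 2 - 1)) :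
    ∑ i : Fin 2 → Fin (n ^ 2 - 1), (∏ a, c (i a)) * t3 T (Fin.snoc i z) =
      Complex.I / 3 * ((n : ℂ) ^ 2 * (combo T c ^ 2 * T z).trace) := by
  have := nonempty_index hn
  obtain ⟨i2, i3, i4, i5⟩ := neg_I_pow
  refine (sum_tOf_kTensor (commutator_X_eq (by omega) hT) 2 c z).trans ?_
  rw [sum_smul_X, X, (isComplete_X (by omega) hT).pairSum_two
    (by rw [Matrix.trace_smul, combo_trace hT, smul_zero])
    (by rw [Matrix.trace_smul, hT.trace_eq_zero, smul_zero]), trace_smul_pow_mul_smul, i3]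
  norm_num [Nat.factorial]
  ring

theorem t4_snoc_comp_perm (T : Fin (n ^ 2 - 1) → Matrix (Fin n) (Fin n) ℂ) (e : Equiv.Perm (Fin 3))
    (i : Fin 3 → Fin (n ^ 2 - 1)) (z : Fin (n ^ 2 - 1)) :
    t4 T (Fin.snoc (fun a => i (e a)) z) = t4 T (Fin.snoc i z) :=
  tOf_snoc_comp_perm (M := 3) T (kTensor T 4) e i z

theorem t5_snoc_comp_perm (T : Fin (n ^ 2 - 1) → Matrix (Fin n) (Fin n) ℂ) (e : Equiv.Perm (Fin 4))
    (i : Fin 4 → Fin (n ^ 2 - 1)) (z : Fin (n ^ 2 - 1)) :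
    t5 T (Fin.snoc (fun a => i (e a)) z) = t5 T (Fin.snoc i z) :=
  tOf_snoc_comp_perm (M := 4) T (kTensor T 5) e i z

/-- The 1/n term in the polynomial of `d4` also feeds the product of traces: -(n² + 1) - (n² - 4) =
3 - 2n² is its coefficient in `sum_mul_t4`. -/
theorem t4_eq (hn : 2 ≤ n) (hT : IsGenerators T) (i : Fin 4 → Fin (n ^ 2 - 1)) :
    t4 T i = (1 / 120 : ℂ) * ((n : ℂ) * ((n : ℂ) ^ 2 + 1) * d4 T i
      - 2 * ((n : ℂ) ^ 2 - 4) * deltaDelta i) := by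
  have hn0 : (n : ℂ) ≠ 0 := by exact_mod_cast (by omega : n ≠ 0)
  refine eq_of_polynomial_eq (M := 3) (G := fun i => (1 / 120 : ℂ) * ((n : ℂ) * ((n : ℂ) ^ 2 + 1) * d4 T i
      - 2 * ((n : ℂ) ^ 2 - 4) * deltaDelta i)) (t4_snoc_comp_perm T) (fun e j z => ?_) (fun c z => ?_) i
  · simp only [d4, deltaDelta]
    rw [symmetrize_snoc_comp_perm (m := 3), symmetrize_snoc_comp_perm (m := 3)]
  · have h1 := sum_mul_d4 (by omega) hT c z
    have h2 := sum_mul_deltaDelta hT c z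
    have h3 : ∑ i : Fin 3 → Fin (n ^ 2 - 1), (∏ a, c (i a)) * ((1 / 120 : ℂ) * ((n : ℂ) * ((n : ℂ) ^ 2 + 1) *
        d4 T (Fin.snoc i z) - 2 * ((n : ℂ) ^ 2 - 4) * deltaDelta (Fin.snoc i z : Fin 4 → Fin (n ^ 2 - 1)))) =
        (1 / 120 : ℂ) * ((n : ℂ) * ((n : ℂ) ^ 2 + 1) *
          ∑ i : Fin 3 → Fin (n ^ 2 - 1), (∏ a, c (i a)) * d4 T (Fin.snoc i z)
        - 2 * ((n : ℂ) ^ 2 - 4) * ∑ i : Fin 3 → Fin (n ^ 2 - 1), (∏ a, c (i a)) *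
          deltaDelta (Fin.snoc i z : Fin 4 → Fin (n ^ 2 - 1))) := by
      simp only [Finset.mul_sum, ← Finset.sum_sub_distrib]
      exact Finset.sum_congr rfl fun i _ => by ring
    rw [sum_mul_t4 hn hT]
    refine Eq.trans ?_ h3.symm
    rw [h1, h2]
    field_simp
    ring

theorem t5_eq (hn : 2 ≤ n) (hT : IsGenerators T) (i : Fin 5 → Fin (n ^ 2 - 1)) :
    t5 T i = (-Complex.I * n / 1680) * ((n : ℂ) * ((n : ℂ) ^ 2 + 5) * d5 T i
      - 2 * (3 * (n : ℂ) ^ 2 - 20) * dDelta T i) := by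
  have hn0 : (n : ℂ) ≠ 0 := by exact_mod_cast (by omega : n ≠ 0)
  refine eq_of_polynomial_eq (M := 4) (G := fun i => (-Complex.I * n / 1680) *
    ((n : ℂ) * ((n : ℂ) ^ 2 + 5) * d5 T i - 2 * (3 * (n : ℂ) ^ 2 - 20) * dDelta T i))
    (t5_snoc_comp_perm T) (fun e j z => ?_) (fun c z => ?_) i
  · simp only [d5, dDelta]
    rw [symmetrize_snoc_comp_perm (m := 4), symmetrize_snoc_comp_perm (m := 4)]
  · have h1 := sum_mul_d5 (by omega) hT c z
    have h2 := sum_mul_dDelta hT c z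
    have h3 : ∑ i : Fin 4 → Fin (n ^ 2 - 1), (∏ a, c (i a)) * ((-Complex.I * n / 1680) *
        ((n : ℂ) * ((n : ℂ) ^ 2 + 5) * d5 T (Fin.snoc i z)
          - 2 * (3 * (n : ℂ) ^ 2 - 20) * dDelta T (Fin.snoc i z))) =
        (-Complex.I * n / 1680) * ((n : ℂ) * ((n : ℂ) ^ 2 + 5) *
          ∑ i : Fin 4 → Fin (n ^ 2 - 1), (∏ a, c (i a)) * d5 T (Fin.snoc i z)
        - 2 * (3 * (n : ℂ) ^ 2 - 20) * ∑ i : Fin 4 → Fin (n ^ 2 - 1), (∏ a, c (i a)) *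
          dDelta T (Fin.snoc i z)) := by
      simp only [Finset.mul_sum, ← Finset.sum_sub_distrib]
      exact Finset.sum_congr rfl fun i _ => by ring
    rw [sum_mul_t5 hn hT]
    refine Eq.trans ?_ h3.symm
    rw [h1, h2]
    field_simp
    ring

theorem d_comm (T : Fin (n ^ 2 - 1) → Matrix (Fin n) (Fin n) ℂ) (i j k : Fin (n ^ 2 - 1)) :
    d T i j k = d T j i k := by
  rw [d, d, add_comm]

theorem t3_eq (hn : 2 ≤ n) (hT : IsGenerators T) (i : Fin 3 → Fin (n ^ 2 - 1)) :
    t3 T i = Complex.I * n ^ 2 / 12 * d T (i 0) (i 1) (i 2) := by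
  rw [← dTensor_one]
  refine eq_of_polynomial_eq (M := 2) (G := fun i => Complex.I * n ^ 2 / 12 * dTensor T 1 i)
    (tOf_snoc_comp_perm (M := 2) T (kTensor T 3)) (fun e j z => ?_) (fun c z => ?_) i
  · have h (i : Fin 2 → Fin (n ^ 2 - 1)) : dTensor T 1 (Fin.snoc i z) = d T (i 0) (i 1) z := by
      rw [dTensor_one]; rfl
    rw [h, h]
    -- `dTensor` is not symmetrised by definition, so its symmetry in the first two indices is
    -- checked on the two permutations.
    have he : (e 0 = 0 ∧ e 1 = 1) ∨ (e 0 = 1 ∧ e 1 = 0) := by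
      revert e; decide
    rcases he with ⟨h0, h1⟩ | ⟨h0, h1⟩
    · rw [h0, h1]
    · rw [h0, h1, d_comm]
  · refine (sum_mul_t3 hn hT c z).trans ?_
    have h := (sum_mul_snoc (m := 2) (dTensor T 1) c z).trans (evalTensor_d _)
    have h3 : ∑ i : Fin 2 → Fin (n ^ 2 - 1), (∏ a, c (i a)) *
        (Complex.I * n ^ 2 / 12 * dTensor T 1 (Fin.snoc i z)) =
        Complex.I * n ^ 2 / 12 * ∑ i : Fin 2 → Fin (n ^ 2 - 1), (∏ a, c (i a)) * dTensor T 1 (Fin.snoc i z) := by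
      simp only [Finset.mul_sum]
      exact Finset.sum_congr rfl fun i _ => by ring
    refine Eq.trans ?_ h3.symm
    rw [h]
    have hl : Fin.last 2 = (2 : Fin 3) := rfl
    simp [Function.update, combo_single, anti, add_mul, pow_two, hl]
    ring

/-- Brings the case m = 2, where h = δ, under the general treatment of trace tensors. -/
theorem kTensor_two (hT : IsGenerators T) (i : Fin 2 → Fin (n ^ 2 - 1)) :
    kTensor T 2 i = -1 / 2 * delta (i 0) (i 1) := by
  have h := kTensor_snoc T 1 (fun _ => i 0) (i 1)
  have hi : (Fin.snoc (fun _ : Fin 1 => i 0) (i 1) : Fin 2 → Fin (n ^ 2 - 1)) = i := by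
    funext a; fin_cases a <;> rfl
  rw [hi] at h
  rw [h]
  have hI : Complex.I * (Complex.I * 2⁻¹) = -1 / 2 := by
    linear_combination 2⁻¹ * Complex.I_mul_I
  simp [X, hT.trace_mul, delta, hI]
  exact if_congr eq_comm rfl rfl

theorem tOf_const_mul (T : Fin (n ^ 2 - 1) → Matrix (Fin n) (Fin n) ℂ) {M : ℕ} (r : ℂ)
    (h : (Fin (M + 1) → Fin (n ^ 2 - 1)) → ℂ) (i : Fin (M + 1) → Fin (n ^ 2 - 1)) :
    tOf T (fun l => r * h l) i = r * tOf T h i := by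
  simp only [tOf, cocycle, Finset.mul_sum, Finset.sum_mul]
  refine Finset.sum_congr rfl fun j _ => Finset.sum_congr rfl fun σ _ => Finset.sum_congr rfl fun l _ => ?_
  ring

theorem tOf_kTensor_two (hn : 2 ≤ n) (hT : IsGenerators T) (i : Fin 2 → Fin (n ^ 2 - 1)) :
    tOf T (M := 1) (kTensor T 2) i = -n / 2 * delta (i 0) (i 1) := by
  refine eq_of_polynomial_eq (M := 1) (F := tOf T (M := 1) (kTensor T 2))
    (G := fun i => -n / 2 * delta (i 0) (i 1)) (tOf_snoc_comp_perm (M := 1) T (kTensor T 2))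
    (fun e j z => ?_) (fun c z => ?_) i
  · rw [Subsingleton.elim e 1]
    rfl
  · have := nonempty_index hn
    refine (sum_tOf_kTensor (commutator_X_eq (by omega) hT) 1 c z).trans ?_
    rw [sum_smul_X, X, (isComplete_X (by omega) hT).pairSum_one
      (by rw [Matrix.trace_smul, combo_trace hT, smul_zero])
      (by rw [Matrix.trace_smul, hT.trace_eq_zero, smul_zero]), trace_smul_mul_smul, neg_I_pow.1]
    have hc : (combo T c * T z).trace = c z / 2 := by
      simp [combo, Finset.sum_mul, Matrix.trace_sum, hT.trace_mul, div_eq_mul_inv]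
    have hs (i : Fin 1 → Fin (n ^ 2 - 1)) : delta ((Fin.snoc i z : Fin 2 → Fin (n ^ 2 - 1)) 0)
        ((Fin.snoc i z : Fin 2 → Fin (n ^ 2 - 1)) 1) = delta (i 0) z := rfl
    simp only [hs, sum_fin_succ]
    rw [hc]
    simp [delta]
    ring

theorem t2_eq (hn : 2 ≤ n) (hT : IsGenerators T) (i : Fin 2 → Fin (n ^ 2 - 1)) :
    t2 T i = n * delta (i 0) (i 1) := by
  have h : (fun i : Fin 2 → Fin (n ^ 2 - 1) => delta (i 0) (i 1)) = fun i => -2 * kTensor T 2 i := by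
    funext i
    rw [kTensor_two hT]
    ring
  rw [t2, h]
  refine (tOf_const_mul (M := 1) T (-2) (kTensor T 2) i).trans ?_
  rw [tOf_kTensor_two hn hT]
  ring

end Evaluation

end
end SuN
namespace SuN
noncomputable section

/-! ### Cayley–Hamilton and vanishing for n = 3 and n = 4. -/

section Collapse

/-- Cayley–Hamilton with the coefficients expressed by power sums. Eliminating the last diagonal
entry through the trace leaves polynomial identities in the entries. -/
theorem pow_three_of_trace_eq_zero (x : Matrix (Fin 3) (Fin 3) ℂ) (hx : x.trace = 0) :
    x ^ 3 = (1 / 2 * (x ^ 2).trace) • x + (1 / 3 * (x ^ 3).trace) • (1 : Matrix (Fin 3) (Fin 3) ℂ) := by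
  have h : x 2 2 = -(x 0 0 + x 1 1) := by
    rw [Matrix.trace_fin_three] at hx
    linear_combination hx
  ext i j
  simp only [pow_succ, pow_zero, one_mul, Matrix.add_apply, Matrix.smul_apply, smul_eq_mul,
    Matrix.trace_fin_three, Matrix.mul_apply, Fin.sum_univ_three, Matrix.one_apply]
  fin_cases i <;> fin_cases j <;> simp [h] <;> ring

theorem pow_four_of_trace_eq_zero (x : Matrix (Fin 4) (Fin 4) ℂ) (hx : x.trace = 0) :
    x ^ 4 = (1 / 2 * (x ^ 2).trace) • x ^ 2 + (1 / 3 * (x ^ 3).trace) • x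
      + (1 / 4 * ((x ^ 4).trace - 1 / 2 * (x ^ 2).trace ^ 2)) • (1 : Matrix (Fin 4) (Fin 4) ℂ) := by
  have h : x 3 3 = -(x 0 0 + x 1 1 + x 2 2) := by
    simp only [Matrix.trace, Matrix.diag_apply, Fin.sum_univ_four] at hx
    linear_combination hx
  have e2 : x ^ 2 = x * x := pow_two x
  have e3 : x ^ 3 = x * (x * x) := by rw [pow_succ', pow_two]
  have e4 : x ^ 4 = (x * x) * (x * x) := by rw [← pow_two, ← pow_two, ← pow_mul]
  rw [e2, e3, e4]
  ext i j
  simp only [Matrix.add_apply, Matrix.smul_apply, smul_eq_mul,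
    Matrix.trace, Matrix.diag_apply, Matrix.mul_apply, Fin.sum_univ_four, Matrix.one_apply, h]
  fin_cases i <;> fin_cases j <;> simp [h] <;> ring

/-- After substitution the coefficient is n(n² + 1)/2 + 3 - 2n², which is 15 + 3 - 18 = 0. -/
theorem t4_eq_zero_of_three {T : Fin (3 ^ 2 - 1) → Matrix (Fin 3) (Fin 3) ℂ} (hT : IsGenerators T)
    (i : Fin 4 → Fin (3 ^ 2 - 1)) : t4 T i = 0 := by
  refine eq_of_polynomial_eq (M := 3) (G := fun _ => 0) (t4_snoc_comp_perm T) (fun _ _ _ => rfl)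
    (fun c z => ?_) i
  have h := pow_three_of_trace_eq_zero (combo T c) (combo_trace hT c)
  have h3 : (combo T c ^ 3 * T z).trace = 1 / 2 * (combo T c ^ 2).trace * (combo T c * T z).trace := by
    conv_lhs => rw [h]
    simp [Matrix.add_mul, hT.trace_eq_zero]
  rw [sum_mul_t4 (by norm_num) hT, h3]
  simp only [mul_zero, Finset.sum_const_zero]
  push_cast
  ring

/-- Multiplying the cubic identity by x leaves no separate trace of `T z`. The two coefficients are
126/2 - 63 and 126/3 - 42. -/
theorem t5_eq_zero_of_three {T : Fin (3 ^ 2 - 1) → Matrix (Fin 3) (Fin 3) ℂ} (hT : IsGenerators T)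
    (i : Fin 5 → Fin (3 ^ 2 - 1)) : t5 T i = 0 := by
  refine eq_of_polynomial_eq (M := 4) (G := fun _ => 0) (t5_snoc_comp_perm T) (fun _ _ _ => rfl)
    (fun c z => ?_) i
  have h := pow_three_of_trace_eq_zero (combo T c) (combo_trace hT c)
  have h4 : (combo T c ^ 4 * T z).trace = 1 / 2 * (combo T c ^ 2).trace * (combo T c ^ 2 * T z).trace
      + 1 / 3 * (combo T c ^ 3).trace * (combo T c * T z).trace := by
    conv_lhs => rw [pow_succ, h]
    simp [Matrix.add_mul, pow_two]
  rw [sum_mul_t5 (by norm_num) hT, h4]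
  simp only [mul_zero, Finset.sum_const_zero]
  push_cast
  ring

/-- The identity part of the quartic identity is killed by Tr `T z` = 0. The two coefficients are
336/2 - 168 and 336/3 - 112. -/
theorem t5_eq_zero_of_four {T : Fin (4 ^ 2 - 1) → Matrix (Fin 4) (Fin 4) ℂ} (hT : IsGenerators T)
    (i : Fin 5 → Fin (4 ^ 2 - 1)) : t5 T i = 0 := by
  refine eq_of_polynomial_eq (M := 4) (G := fun _ => 0) (t5_snoc_comp_perm T) (fun _ _ _ => rfl)
    (fun c z => ?_) i
  have h := pow_four_of_trace_eq_zero (combo T c) (combo_trace hT c)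
  have h4 : (combo T c ^ 4 * T z).trace = 1 / 2 * (combo T c ^ 2).trace * (combo T c ^ 2 * T z).trace
      + 1 / 3 * (combo T c ^ 3).trace * (combo T c * T z).trace := by
    conv_lhs => rw [h]
    simp [Matrix.add_mul, hT.trace_eq_zero]
  rw [sum_mul_t5 (by norm_num) hT, h4]
  simp only [mul_zero, Finset.sum_const_zero]
  push_cast
  ring

end Collapse

end
end SuN
namespace SuN
noncomputable section

/-! ### Squares of symmetrised fourth order tensors. -/

section Symmetrization

variable {ι : Type*}

theorem sum_perm_four (H : Fin 4 → Fin 4 → Fin 4 → Fin 4 → ℂ) :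
    ∑ σ : Equiv.Perm (Fin 4), H (σ 0) (σ 1) (σ 2) (σ 3) =
      H 0 1 2 3 + H 0 1 3 2 + H 0 2 1 3 + H 0 2 3 1 + H 0 3 2 1 + H 0 3 1 2 + H 1 0 2 3 + H 1
      0 3 2 + H 1 2 0 3 + H 1 2 3 0 + H 1 3 2 0 + H 1 3 0 2 + H 2 1 0 3 + H 2 1 3 0 + H 2 0 1
      3 + H 2 0 3 1 + H 2 3 0 1 + H 2 3 1 0 + H 3 1 2 0 + H 3 1 0 2 + H 3 2 1 0 + H 3 2 0 1 +
      H 3 0 2 1 + H 3 0 1 2 := by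
  have h1 : (1 : Fin 4) = Fin.succ 0 := rfl
  have h2 : (2 : Fin 4) = Fin.succ (Fin.succ 0) := rfl
  have h3 : (3 : Fin 4) = Fin.succ (Fin.succ (Fin.succ 0)) := rfl
  conv_lhs => rw [h1, h2, h3]
  simp only [← Equiv.Perm.decomposeFin.symm.sum_comp, Fintype.sum_prod_type,
    Equiv.Perm.decomposeFin_symm_apply_zero, Equiv.Perm.decomposeFin_symm_apply_succ,
    Fin.sum_univ_four, Fin.sum_univ_three, Fin.sum_univ_two, Finset.univ_unique, Finset.sum_singleton, ← add_assoc]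
  rfl

/-- The three symmetries generate a group of order 8, so the 24 permutations fall into three
classes, one for each splitting of the indices into two pairs. -/
theorem symmetrize_four {H : ι → ι → ι → ι → ℂ} (h1 : ∀ a b c e, H a b c e = H b a c e)
    (h2 : ∀ a b c e, H a b c e = H a b e c) (h3 : ∀ a b c e, H a b c e = H c e a b) (i : Fin 4 → ι) :
    symmetrize (fun i : Fin 4 → ι => H (i 0) (i 1) (i 2) (i 3)) i = 1 / 3 * (H (i 0) (i 1) (i 2) (i 3)
      + H (i 0) (i 2) (i 1) (i 3) + H (i 0) (i 3) (i 1) (i 2)) := by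
  have hs : ∑ σ : Equiv.Perm (Fin 4), H (i (σ 0)) (i (σ 1)) (i (σ 2)) (i (σ 3)) =
      8 * (H (i 0) (i 1) (i 2) (i 3) + H (i 0) (i 2) (i 1) (i 3) + H (i 0) (i 3) (i 1) (i 2)) := by
    have h8 (a b c e : ι) : H a b c e + H a b e c + H b a c e + H b a e c + H c e a b + H c e b a + H e c a b
        + H e c b a = 8 * H a b c e := by
      rw [h3 c e a b, h3 c e b a, h3 e c a b, h3 e c b a, h1 b a, h1 b a, ← h2 a b c e]
      ring
    rw [sum_perm_four fun p q r s => H (i p) (i q) (i r) (i s)]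
    linear_combination h8 (i 0) (i 1) (i 2) (i 3) + h8 (i 0) (i 2) (i 1) (i 3) + h8 (i 0) (i 3) (i 1) (i 2)
  rw [symmetrize, hs]
  norm_num [Nat.factorial]
  ring

variable [Fintype ι]

/-- Against a symmetric tensor, every permuted copy of `h` has the same contraction; one factor
therefore need not be symmetrised. -/
theorem sum_symmetrize_mul {m : ℕ} (h S : (Fin m → ι) → ℂ)
    (hS : ∀ (e : Equiv.Perm (Fin m)) i, S (fun a => i (e a)) = S i) :
    ∑ i, symmetrize h i * S i = ∑ i, h i * S i := by
  have hσ (σ : Equiv.Perm (Fin m)) : ∑ i : Fin m → ι, h (fun a => i (σ a)) * S i = ∑ i, h i * S i := by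
    rw [← Equiv.sum_comp (σ.arrowCongr (Equiv.refl ι))]
    refine Finset.sum_congr rfl fun i _ => ?_
    rw [← hS σ]
    simp [Equiv.arrowCongr]
  simp only [symmetrize, mul_assoc, Finset.sum_mul, ← Finset.mul_sum]
  rw [Finset.sum_comm]
  simp only [hσ]
  have : (m.factorial : ℂ) ≠ 0 := by exact_mod_cast m.factorial_ne_zero
  simp [Fintype.card_perm, this]

theorem sum_comm_three (G : ι → ι → ι → ℂ) : ∑ a, ∑ b, ∑ j, G a b j = ∑ j, ∑ a, ∑ b, G a b j := by
  conv_rhs => rw [Finset.sum_comm]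
  exact Finset.sum_congr rfl fun j _ => Finset.sum_comm

theorem sum_fin_four (G : (Fin 4 → ι) → ℂ) : ∑ i, G i = ∑ a, ∑ b, ∑ c, ∑ e, G ![a, b, c, e] := by
  simp only [sum_fin_succ, Finset.univ_unique, Finset.sum_singleton]
  rfl

/-- The square of the symmetrisation of a tensor which has the symmetries of `δ_ij δ_kl`. -/
theorem sum_symmetrize_mul_symmetrize {H : ι → ι → ι → ι → ℂ} (h1 : ∀ a b c e, H a b c e = H b a c e)
    (h2 : ∀ a b c e, H a b c e = H a b e c) (h3 : ∀ a b c e, H a b c e = H c e a b) :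
    contraction (symmetrize fun i : Fin 4 → ι => H (i 0) (i 1) (i 2) (i 3)) =
      1 / 3 * (∑ a, ∑ b, ∑ c, ∑ e, H a b c e * H a b c e + 2 * ∑ a, ∑ b, ∑ c, ∑ e, H a b c e * H a c b e) := by
  rw [contraction, sum_symmetrize_mul _ _ fun e i => symmetrize_comp_perm _ i e, sum_fin_four]
  simp only [symmetrize_four h1 h2 h3]
  -- Exchanging `c` and `e` identifies the contraction with the third pairing with that of the
  -- second, hence the factor 2.
  have : ∑ a, ∑ b, ∑ c, ∑ e, H a b c e * H a e b c = ∑ a, ∑ b, ∑ c, ∑ e, H a b c e * H a c b e := by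
    refine Finset.sum_congr rfl fun a _ => Finset.sum_congr rfl fun b _ => ?_
    rw [Finset.sum_comm]
    exact Finset.sum_congr rfl fun c _ => Finset.sum_congr rfl fun e _ => by rw [h2 a b e c]
  rw [two_mul]
  nth_rewrite 2 [← this]
  simp only [Finset.mul_sum, ← Finset.sum_add_distrib]
  refine Finset.sum_congr rfl fun a _ => Finset.sum_congr rfl fun b _ => Finset.sum_congr rfl fun c _ =>
    Finset.sum_congr rfl fun e _ => ?_
  simp
  ring

end Symmetrization

/-! ### Loop contractions of d and the scalars K. -/

section Contractions

variable {n : ℕ} {T : Fin (n ^ 2 - 1) → Matrix (Fin n) (Fin n) ℂ}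

theorem sum_trace_mul_mul (hn : 0 < n) (hT : IsGenerators T) (M N : Matrix (Fin n) (Fin n) ℂ) :
    ∑ b, (T b * (M * (T b * N))).trace = 1 / 2 * (M.trace * N.trace - (M * N).trace / n) := by
  have h := congrArg (fun Z => (Z * N).trace) ((isComplete_X hn hT).sum_mul_mul M)
  simp only [X, smul_mul_assoc, mul_smul_comm, smul_smul, Finset.sum_mul, Matrix.trace_sum, Matrix.sub_mul,
    Matrix.trace_smul, Matrix.trace_sub, Matrix.one_mul, smul_eq_mul, Matrix.mul_assoc, ← Finset.mul_sum] at h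
  linear_combination (-1) * h + (∑ b, (T b * (M * (T b * N))).trace) * Complex.I_mul_I

theorem sum_d_mul_d (hn : 0 < n) (hT : IsGenerators T) (a b c e : Fin (n ^ 2 - 1)) :
    ∑ k, d T a b k * d T c e k = 2 * ((anti (T a) (T b) * anti (T c) (T e)).trace
      - 4 * ((T a * T b).trace * (T c * T e).trace) / n) := by
  have h := sum_trace_mul_trace hn hT (anti (T a) (T b)) (anti (T c) (T e))
  rw [trace_anti, trace_anti] at h
  have h2 : ∑ k, d T a b k * d T c e k =
      4 * ∑ k, (anti (T a) (T b) * T k).trace * (anti (T c) (T e) * T k).trace := by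
    rw [Finset.mul_sum]
    exact Finset.sum_congr rfl fun k _ => by rw [d_eq, d_eq]; ring
  rw [h2, h]
  ring

/-- The two-vertex loop: `k` is summed by joining traces, then `j` by the Fierz identity, once each
word is rotated to begin with `T j`. -/
theorem sum_sum_d_mul_d (hn : 0 < n) (hT : IsGenerators T) (x y : Fin (n ^ 2 - 1)) :
    ∑ j, ∑ k, d T x j k * d T y j k = ((n : ℂ) ^ 2 - 4) / n * delta x y := by
  have hn0 : (n : ℂ) ≠ 0 := by exact_mod_cast hn.ne'
  simp only [sum_d_mul_d hn hT]
  rw [← Finset.mul_sum, Finset.sum_sub_distrib, ← Finset.sum_div, ← Finset.mul_sum, sum_trace_mul_trace hn hT]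
  have h1 (j : Fin (n ^ 2 - 1)) : (anti (T x) (T j) * anti (T y) (T j)).trace =
      (T j * (T y * (T j * T x))).trace + (T j * (1 * (T j * (T y * T x)))).trace
        + (T j * ((T x * T y) * (T j * 1))).trace + (T j * (T x * (T j * T y))).trace := by
    simp only [anti, Matrix.add_mul, Matrix.mul_add, Matrix.trace_add, Matrix.one_mul, Matrix.mul_one,
      Matrix.mul_assoc]
    have e1 := Matrix.trace_mul_comm (T x) (T j * (T y * T j))
    have e2 := Matrix.trace_mul_comm (T x) (T j * (T j * T y))
    simp only [Matrix.mul_assoc] at e1 e2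
    rw [e1, e2]
    ring
  simp only [h1, Finset.sum_add_distrib, sum_trace_mul_mul hn hT]
  simp only [hT.trace_eq_zero, Matrix.trace_one,
    Fintype.card_fin, Matrix.one_mul, Matrix.mul_one, Matrix.trace_mul_comm (T y) (T x), hT.trace_mul]
  by_cases h : x = y <;> simp [h, delta]
  field_simp
  ring

/-- The sum of the squares of the generators is a multiple of the identity, which is orthogonal to
`T j`. -/
theorem sum_d_self (hn : 0 < n) (hT : IsGenerators T) (j : Fin (n ^ 2 - 1)) : ∑ a, d T a a j = 0 := by
  have h := sum_trace_mul_mul hn hT 1 (T j)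
  rw [hT.trace_eq_zero, Matrix.one_mul, hT.trace_eq_zero] at h
  simp only [Matrix.one_mul] at h
  have h2 (a : Fin (n ^ 2 - 1)) : d T a a j = 4 * (T a * (T a * T j)).trace := by
    rw [d, Matrix.add_mul, Matrix.trace_add, Matrix.mul_assoc]
    ring
  simp only [h2, ← Finset.mul_sum, h]
  simp

/-- The eight words are rotated to begin with `T b`. Tracelessness leaves the n/2 terms, where one
side of the cut is empty, and the 1/n corrections. -/
theorem sum_trace_anti_mul_anti (hn : 0 < n) (hT : IsGenerators T) {J C E : Matrix (Fin n) (Fin n) ℂ}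
    (hJ : J.trace = 0) (hC : C.trace = 0) (hE : E.trace = 0) :
    ∑ b, (anti (T b) J * anti C (anti (T b) E)).trace = ((n : ℂ) / 2 - 2 / n) * (anti C E * J).trace := by
  have hn0 : (n : ℂ) ≠ 0 := by exact_mod_cast hn.ne'
  have h1 (b : Fin (n ^ 2 - 1)) : (anti (T b) J * anti C (anti (T b) E)).trace =
      (T b * ((J * C) * (T b * E))).trace + (T b * ((J * (C * E)) * (T b * 1))).trace
      + (T b * (J * (T b * (E * C)))).trace + (T b * ((J * E) * (T b * C))).trace
      + (T b * (C * (T b * (E * J)))).trace + (T b * ((C * E) * (T b * J))).trace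
      + (T b * (1 * (T b * (E * (C * J))))).trace + (T b * (E * (T b * (C * J)))).trace := by
    simp only [anti, Matrix.add_mul, Matrix.mul_add, Matrix.trace_add, Matrix.one_mul, Matrix.mul_one,
      Matrix.mul_assoc]
    have e1 := Matrix.trace_mul_comm J (T b * (C * (T b * E)))
    have e2 := Matrix.trace_mul_comm J (T b * (C * (E * T b)))
    have e3 := Matrix.trace_mul_comm J (T b * (T b * (E * C)))
    have e4 := Matrix.trace_mul_comm J (T b * (E * (T b * C)))
    simp only [Matrix.mul_assoc] at e1 e2 e3 e4
    rw [e1, e2, e3, e4]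
    ring
  have c1 := Matrix.trace_mul_comm J (C * E)
  have c2 := Matrix.trace_mul_comm J (E * C)
  simp only [Matrix.mul_assoc] at c1 c2
  simp only [h1, Finset.sum_add_distrib, sum_trace_mul_mul hn hT]
  simp only [hJ, hC, hE, Matrix.trace_one,
    Fintype.card_fin, Matrix.one_mul, Matrix.mul_one, Matrix.mul_assoc, anti, Matrix.add_mul, Matrix.trace_add,
    c1, c2]
  field_simp
  ring

/-- The three-vertex loop: `k` and `a` are removed by joining traces, and `b` by
`sum_trace_anti_mul_anti`. By invariance the result is proportional to `d`. -/
theorem sum_d_mul_d_mul_d (hn : 0 < n) (hT : IsGenerators T) (j c e : Fin (n ^ 2 - 1)) :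
    ∑ b, ∑ a, ∑ k, d T a b j * (d T a c k * d T k b e) = ((n : ℂ) ^ 2 - 12) / (2 * n) * d T j c e := by
  have hn0 : (n : ℂ) ≠ 0 := by exact_mod_cast hn.ne'
  have h1 (b a : Fin (n ^ 2 - 1)) : ∑ k, d T a b j * (d T a c k * d T k b e) =
      4 * ((anti (T b) (T j) * T a).trace * (anti (T c) (anti (T b) (T e)) * T a).trace)
      - 16 / n * (T b * T e).trace * ((anti (T b) (T j) * T a).trace * (T c * T a).trace) := by
    rw [← Finset.mul_sum]
    simp only [d_cycle T _ b e]
    rw [sum_d_mul_d hn hT, d_cycle T a b j, d_eq, trace_anti_mul (T a) (T c),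
      trace_anti_mul (T b) (T j) (T a), trace_anti_mul (T j) (T a) (T b),
      trace_anti_mul (T a) (T b) (T j), Matrix.trace_mul_comm (T a) (T c)]
    ring
  have h2 (b : Fin (n ^ 2 - 1)) : ∑ a, ∑ k, d T a b j * (d T a c k * d T k b e) =
      2 * (anti (T b) (T j) * anti (T c) (anti (T b) (T e))).trace
      - 4 / n * ((T j * T b).trace * (anti (T c) (T e) * T b).trace) * 2
      - 8 / n * ((T e * T b).trace * (anti (T j) (T c) * T b).trace) := by
    simp only [h1, Finset.sum_sub_distrib, ← Finset.mul_sum, sum_trace_mul_trace hn hT, trace_anti,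
      hT.trace_eq_zero]
    rw [trace_anti_mul (T b) (T j) (T c), Matrix.trace_mul_comm (T b) (T e), Matrix.trace_mul_comm (T b) (T j),
      Matrix.trace_mul_comm (T c) (anti (T b) (T e)), trace_anti_mul (T b) (T e) (T c),
      show anti (T e) (T c) = anti (T c) (T e) from add_comm _ _]
    ring
  rw [Finset.sum_congr rfl fun b _ => h2 b]
  simp only [Finset.sum_sub_distrib, ← Finset.mul_sum, ← Finset.sum_mul, sum_trace_mul_trace hn hT,
    sum_trace_anti_mul_anti hn hT (hT.trace_eq_zero j) (hT.trace_eq_zero c) (hT.trace_eq_zero e),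
    hT.trace_eq_zero]
  rw [d_cycle, d_eq, Matrix.trace_mul_comm (T e), trace_anti_mul (T j) (T c) (T e),
    Matrix.trace_mul_comm (T j)]
  field_simp
  ring

theorem cast_card (hn : 0 < n) : ((n ^ 2 - 1 : ℕ) : ℂ) = (n : ℂ) ^ 2 - 1 := by
  rw [Nat.cast_sub (Nat.one_le_pow _ _ hn)]
  push_cast
  ring

theorem sum_d_sq (hn : 0 < n) (hT : IsGenerators T) :
    ∑ x, ∑ j, ∑ k, d T x j k * d T x j k = ((n : ℂ) ^ 2 - 4) / n * ((n : ℂ) ^ 2 - 1) := by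
  simp only [sum_sum_d_mul_d hn hT]
  simp [delta, cast_card hn]
  ring

theorem contraction_t2 (hn : 2 ≤ n) (hT : IsGenerators T) :
    contraction (t2 T) = (n : ℂ) ^ 2 * ((n : ℂ) ^ 2 - 1) := by
  simp only [contraction, t2_eq hn hT, sum_fin_succ]
  simp [delta, cast_card (by omega : 0 < n)]
  ring

theorem contraction_t3 (hn : 2 ≤ n) (hT : IsGenerators T) :
    contraction (t3 T) = -((1 / 144 : ℂ) * (n : ℂ) ^ 3 * ((n : ℂ) ^ 2 - 1) * ((n : ℂ) ^ 2 - 4)) := by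
  have hn0 : (n : ℂ) ≠ 0 := by exact_mod_cast (by omega : n ≠ 0)
  have h : contraction (t3 T) = -(n : ℂ) ^ 4 / 144 * ∑ x, ∑ j, ∑ k, d T x j k * d T x j k := by
    simp only [contraction, t3_eq hn hT, sum_fin_succ, Finset.univ_unique, Finset.sum_singleton, Finset.mul_sum]
    refine Finset.sum_congr rfl fun a _ => Finset.sum_congr rfl fun b _ => Finset.sum_congr rfl fun c _ => ?_
    have e1 : (Fin.cons a (Fin.cons b (Fin.cons c default)) : Fin 3 → Fin (n ^ 2 - 1)) 1 = b := rfl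
    have e2 : (Fin.cons a (Fin.cons b (Fin.cons c default)) : Fin 3 → Fin (n ^ 2 - 1)) 2 = c := rfl
    rw [e1, e2, Fin.cons_zero]
    linear_combination (n : ℂ) ^ 4 / 144 * d T a b c * d T a b c * Complex.I_mul_I
  rw [h, sum_d_sq (by omega) hT]
  field_simp

/-- The tensor `∑_j d_abj d_jce`. -/
def dd (T : Fin (n ^ 2 - 1) → Matrix (Fin n) (Fin n) ℂ) (a b c e : Fin (n ^ 2 - 1)) : ℂ :=
  ∑ j, d T a b j * d T j c e

theorem sum_dd_mul_dd (hn : 0 < n) (hT : IsGenerators T) : ∑ a, ∑ b, ∑ c, ∑ e, dd T a b c e * dd T a b c e =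
    (((n : ℂ) ^ 2 - 4) / n) ^ 2 * ((n : ℂ) ^ 2 - 1) := by
  have h (a b : Fin (n ^ 2 - 1)) : ∑ c, ∑ e, dd T a b c e * dd T a b c e =
      ((n : ℂ) ^ 2 - 4) / n * ∑ j, d T a b j * d T a b j := by
    have h1 (c e : Fin (n ^ 2 - 1)) : dd T a b c e * dd T a b c e =
        ∑ j, ∑ k, d T a b j * d T a b k * (d T j c e * d T k c e) := by
      rw [dd, Finset.sum_mul_sum]
      exact Finset.sum_congr rfl fun j _ => Finset.sum_congr rfl fun k _ => by ring
    simp only [h1]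
    rw [sum_comm_three, Finset.mul_sum]
    refine Finset.sum_congr rfl fun j _ => ?_
    rw [sum_comm_three]
    simp only [← Finset.mul_sum, sum_sum_d_mul_d hn hT]
    simp [delta]
    ring
  simp only [h, ← Finset.mul_sum, sum_d_sq hn hT]
  ring

/-- Fixing `c` and `e`, the other sums form the three-vertex loop; what remains is the full square
of `d`. -/
theorem sum_dd_mul_dd_swap (hn : 0 < n) (hT : IsGenerators T) :
    ∑ a, ∑ b, ∑ c, ∑ e, dd T a b c e * dd T a c b e =
      ((n : ℂ) ^ 2 - 12) / (2 * n) * (((n : ℂ) ^ 2 - 4) / n * ((n : ℂ) ^ 2 - 1)) := by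
  have h (c e : Fin (n ^ 2 - 1)) : ∑ b, ∑ a, dd T a b c e * dd T a c b e =
      ((n : ℂ) ^ 2 - 12) / (2 * n) * ∑ j, d T j c e * d T j c e := by
    have h1 (b a : Fin (n ^ 2 - 1)) : dd T a b c e * dd T a c b e =
        ∑ j, d T j c e * ∑ k, d T a b j * (d T a c k * d T k b e) := by
      rw [dd, dd, Finset.sum_mul]
      refine Finset.sum_congr rfl fun j _ => ?_
      rw [← Finset.mul_sum]
      ring
    simp only [h1]
    rw [sum_comm_three, Finset.mul_sum]
    refine Finset.sum_congr rfl fun j _ => ?_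
    have h4 := sum_d_mul_d_mul_d hn hT j c e
    simp only [← Finset.mul_sum] at h4 ⊢
    rw [h4]
    ring
  have h3 : ∑ a, ∑ b, ∑ c, ∑ e, dd T a b c e * dd T a c b e =
      ∑ c, ∑ e, ∑ b, ∑ a, dd T a b c e * dd T a c b e := by
    rw [Finset.sum_comm, sum_comm_three]
    refine Finset.sum_congr rfl fun c _ => ?_
    rw [sum_comm_three]
  rw [h3]
  simp only [h, ← Finset.mul_sum]
  rw [← sum_d_sq hn hT, Finset.sum_congr rfl fun c _ => Finset.sum_comm, Finset.sum_comm]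

theorem sum_dd_mul_delta_delta (hn : 0 < n) (hT : IsGenerators T) :
    ∑ a, ∑ b, ∑ c, ∑ e, dd T a b c e * (delta a b * delta c e) = 0 := by
  have h (a b : Fin (n ^ 2 - 1)) : ∑ c, ∑ e, dd T a b c e * (delta a b * delta c e) = 0 := by
    have h1 (c : Fin (n ^ 2 - 1)) : ∑ e, dd T a b c e * (delta a b * delta c e) =
        ∑ j, delta a b * d T a b j * d T c c j := by
      have h2 (e : Fin (n ^ 2 - 1)) : dd T a b c e * (delta a b * delta c e) =
        (delta a b * dd T a b c e) * delta c e := by ring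
      simp only [h2]
      simp only [delta, mul_ite, mul_one, mul_zero, Finset.sum_ite_eq, Finset.mem_univ, if_true]
      simp only [dd, d_cycle T _ c c]
      simp [Finset.mul_sum]
    simp only [h1]
    rw [Finset.sum_comm]
    simp [← Finset.mul_sum, sum_d_self hn hT]
  simp [h]

theorem sum_dd_mul_delta_delta_swap (hn : 0 < n) (hT : IsGenerators T) :
    ∑ a, ∑ b, ∑ c, ∑ e, dd T a b c e * (delta a c * delta b e) =
      ((n : ℂ) ^ 2 - 4) / n * ((n : ℂ) ^ 2 - 1) := by
  rw [← sum_d_sq hn hT]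
  refine Finset.sum_congr rfl fun a _ => Finset.sum_congr rfl fun b _ => ?_
  simp [delta, dd, d_cycle T _ a b]

theorem sum_delta_mul_delta (hn : 0 < n) :
    ∑ a : Fin (n ^ 2 - 1), ∑ b : Fin (n ^ 2 - 1), ∑ c : Fin (n ^ 2 - 1), ∑ e : Fin (n ^ 2 - 1),
      (delta a b * delta c e) * (delta a b * delta c e) = ((n : ℂ) ^ 2 - 1) ^ 2 := by
  simp [delta, cast_card hn]
  ring

theorem sum_delta_mul_delta_swap (hn : 0 < n) :
    ∑ a : Fin (n ^ 2 - 1), ∑ b : Fin (n ^ 2 - 1), ∑ c : Fin (n ^ 2 - 1), ∑ e : Fin (n ^ 2 - 1),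
      (delta a b * delta c e) * (delta a c * delta b e) = (n : ℂ) ^ 2 - 1 := by
  simp [delta, cast_card hn]

/-- Exhibits `t4` as the symmetrisation of one tensor having the symmetries of δδ, as required by
`sum_symmetrize_mul_symmetrize`. -/
theorem t4_eq_symmetrize (hn : 2 ≤ n) (hT : IsGenerators T) : t4 T = symmetrize fun i =>
    (n : ℂ) * ((n : ℂ) ^ 2 + 1) / 120 * dd T (i 0) (i 1) (i 2) (i 3)
      - ((n : ℂ) ^ 2 - 4) / 60 * (delta (i 0) (i 1) * delta (i 2) (i 3)) := by
  funext i
  have hD : dTensor T 2 = fun i => dd T (i 0) (i 1) (i 2) (i 3) := by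
    funext i
    rw [dTensor]
    simp only [dTensor_one]
    rfl
  rw [t4_eq hn hT, d4, deltaDelta, hD]
  simp only [symmetrize, Finset.sum_sub_distrib, ← Finset.mul_sum]
  ring

theorem contraction_t4 (hn : 2 ≤ n) (hT : IsGenerators T) : contraction (t4 T) =
    (1 / 120 : ℂ) ^ 2 * (2 / 3) * (n : ℂ) ^ 2 * ((n : ℂ) ^ 2 + 1) * ((n : ℂ) ^ 2 - 1) *
      ((n : ℂ) ^ 2 - 4) * ((n : ℂ) ^ 2 - 9) := by
  have hn0 : (n : ℂ) ≠ 0 := by exact_mod_cast (by omega : n ≠ 0)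
  have hn1 : 0 < n := by omega
  have hδ (a b : Fin (n ^ 2 - 1)) : delta a b = delta b a := if_congr eq_comm rfl rfl
  have s1 (a b c e : Fin (n ^ 2 - 1)) : dd T a b c e = dd T b a c e := by
    simp only [dd, d_comm T a b]
  have s2 (a b c e : Fin (n ^ 2 - 1)) : dd T a b c e = dd T a b e c := by
    simp only [dd, d_cycle T _ c e, d_cycle T _ e c, d_comm T c e]
  have s3 (a b c e : Fin (n ^ 2 - 1)) : dd T a b c e = dd T c e a b := by
    simp only [dd]
    refine Finset.sum_congr rfl fun j _ => ?_
    rw [d_cycle T j c e, d_cycle T j a b, mul_comm]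
  -- The coefficients are kept opaque while the quadratic form is expanded. On substitution, a
  -- common factor multiplies 2(n² + 1)(n² - 8) - 4(n² - 4) = 2n²(n² - 9).
  obtain ⟨A, hA⟩ : ∃ A : ℂ, A = (n : ℂ) * ((n : ℂ) ^ 2 + 1) / 120 := ⟨_, rfl⟩
  obtain ⟨B, hB⟩ : ∃ B : ℂ, B = ((n : ℂ) ^ 2 - 4) / 60 := ⟨_, rfl⟩
  rw [t4_eq_symmetrize hn hT, ← hA, ← hB]
  refine (sum_symmetrize_mul_symmetrize (H := fun a b c e => A * dd T a b c e - B * (delta a b * delta c e))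
    (fun a b c e => ?_) (fun a b c e => ?_) fun a b c e => ?_).trans ?_
  · rw [s1, hδ]
  · rw [s2, hδ c]
  · rw [s3, mul_comm (delta a b)]
  have e1 : ∑ a, ∑ b, ∑ c, ∑ e, (A * dd T a b c e - B * (delta a b * delta c e)) *
      (A * dd T a b c e - B * (delta a b * delta c e)) =
      A ^ 2 * (∑ a, ∑ b, ∑ c, ∑ e, dd T a b c e * dd T a b c e)
      - 2 * A * B * (∑ a, ∑ b, ∑ c, ∑ e, dd T a b c e * (delta a b * delta c e))
      + B ^ 2 * ∑ a : Fin (n ^ 2 - 1), ∑ b : Fin (n ^ 2 - 1), ∑ c : Fin (n ^ 2 - 1), ∑ e : Fin (n ^ 2 - 1),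
        (delta a b * delta c e) * (delta a b * delta c e) := by
    simp only [Finset.mul_sum, ← Finset.sum_sub_distrib, ← Finset.sum_add_distrib]
    exact Finset.sum_congr rfl fun a _ => Finset.sum_congr rfl fun b _ => Finset.sum_congr rfl fun c _ =>
      Finset.sum_congr rfl fun e _ => by ring
  have e0 : ∑ a, ∑ b, ∑ c, ∑ e, dd T a c b e * (delta a b * delta c e) =
      ∑ a, ∑ b, ∑ c, ∑ e, dd T a b c e * (delta a c * delta b e) :=
    Finset.sum_congr rfl fun a _ => Finset.sum_comm
  have e2 : ∑ a, ∑ b, ∑ c, ∑ e, (A * dd T a b c e - B * (delta a b * delta c e)) *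
      (A * dd T a c b e - B * (delta a c * delta b e)) =
      A ^ 2 * (∑ a, ∑ b, ∑ c, ∑ e, dd T a b c e * dd T a c b e)
      - A * B * (∑ a, ∑ b, ∑ c, ∑ e, dd T a b c e * (delta a c * delta b e))
      - A * B * (∑ a, ∑ b, ∑ c, ∑ e, dd T a c b e * (delta a b * delta c e))
      + B ^ 2 * ∑ a : Fin (n ^ 2 - 1), ∑ b : Fin (n ^ 2 - 1), ∑ c : Fin (n ^ 2 - 1), ∑ e : Fin (n ^ 2 - 1),
        (delta a b * delta c e) * (delta a c * delta b e) := by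
    simp only [Finset.mul_sum, ← Finset.sum_sub_distrib, ← Finset.sum_add_distrib]
    exact Finset.sum_congr rfl fun a _ => Finset.sum_congr rfl fun b _ => Finset.sum_congr rfl fun c _ =>
      Finset.sum_congr rfl fun e _ => by ring
  rw [e1, e2, e0, sum_dd_mul_dd hn1 hT, sum_dd_mul_dd_swap hn1 hT, sum_dd_mul_delta_delta hn1 hT,
    sum_dd_mul_delta_delta_swap hn1 hT, sum_delta_mul_delta hn1, sum_delta_mul_delta_swap hn1, hA, hB]
  field_simp
  ring

end Contractions

end
end SuN
-- The main theorem.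
theorem mainTheorem11 :
    ∃ lam : ℕ → ℂ, (∀ n : ℕ, 2 ≤ n → lam n ≠ 0) ∧
      ∀ (n : ℕ), 2 ≤ n → ∀ (T : Fin (n ^ 2 - 1) → Matrix (Fin n) (Fin n) ℂ), SuN.IsGenerators T →
        -- the tensors of order four and five
        (∀ i, SuN.t4 T i = (1 / 120 : ℂ) *
          ((n : ℂ) * ((n : ℂ) ^ 2 + 1) * SuN.d4 T i
            - 2 * ((n : ℂ) ^ 2 - 4) * SuN.deltaDelta i)) ∧
        (∀ i, SuN.t5 T i = lam n *
          ((n : ℂ) * ((n : ℂ) ^ 2 + 5) * SuN.d5 T i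
            - 2 * (3 * (n : ℂ) ^ 2 - 20) * SuN.dDelta T i)) ∧
        -- their collapse for `su(3)` and `su(4)`
        (n = 3 →
          (∀ i, SuN.t4 T i = (1 / 4 : ℂ) * (SuN.d4 T i - (1 / 3 : ℂ) * SuN.deltaDelta i) ∧
            SuN.t4 T i = 0) ∧
          (∀ i, SuN.t5 T i = 42 * lam 3 * (SuN.d5 T i - (1 / 3 : ℂ) * SuN.dDelta T i) ∧
            SuN.t5 T i = 0)) ∧
        (n = 4 →
          ∀ i, SuN.t5 T i = 84 * lam 4 * (SuN.d5 T i - (2 / 3 : ℂ) * SuN.dDelta T i) ∧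
            SuN.t5 T i = 0) ∧
        -- the scalars
        SuN.contraction (SuN.t2 T) = (n : ℂ) ^ 2 * ((n : ℂ) ^ 2 - 1) ∧
        SuN.contraction (SuN.t3 T) =
          -((1 / 144 : ℂ) * (n : ℂ) ^ 3 * ((n : ℂ) ^ 2 - 1) * ((n : ℂ) ^ 2 - 4)) ∧
        SuN.contraction (SuN.t4 T) =
          (1 / 120 : ℂ) ^ 2 * (2 / 3) * (n : ℂ) ^ 2 * ((n : ℂ) ^ 2 + 1) * ((n : ℂ) ^ 2 - 1) *
            ((n : ℂ) ^ 2 - 4) * ((n : ℂ) ^ 2 - 9) := by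
  -- The constant comes from `sum_mul_t5` and `sum_mul_d5`: n² Tr(x⁴y) has coefficient -i(n² +
  -- 5)/105 on one side, and 16(n² + 5) times λ(n)/n on the other.
  refine ⟨fun n => -Complex.I * n / 1680, fun n hn => ?_, fun n hn T hT => ⟨SuN.t4_eq hn hT, SuN.t5_eq hn hT,
    fun h => ?_, fun h => ?_, SuN.contraction_t2 hn hT, SuN.contraction_t3 hn hT, SuN.contraction_t4 hn hT⟩⟩
  · have hn0 : (n : ℂ) ≠ 0 := by exact_mod_cast (by omega : n ≠ 0)
    simp [Complex.I_ne_zero, hn0]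
  · subst h
    refine ⟨fun i => ⟨?_, SuN.t4_eq_zero_of_three hT i⟩, fun i => ⟨?_, SuN.t5_eq_zero_of_three hT i⟩⟩
    -- At n = 3, n(n² + 1) = 30 and 2(n² - 4) = 10.
    · rw [SuN.t4_eq hn hT]
      push_cast
      ring
    · rw [SuN.t5_eq hn hT]
      push_cast
      ring
  · subst h
    refine fun i => ⟨?_, SuN.t5_eq_zero_of_four hT i⟩
    rw [SuN.t5_eq hn hT]
    push_cast
    ring
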